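/- **Setting.** There are $n$ workers, at most $f<n/2$ of them malicious; $\mathcal H\subseteq[n]$, $|\mathcal H|=n-f$, are the honest ones. Worker $i$ holds $m$ data points $\mathcal D_i$. With a differentiable loss $\ell(\cdot;x):\mathbb R^d\to\mathbb R$ put $\mathcal L_i(\theta)=\frac1m\sum_{x\in\mathcal D_i}\ell(\theta;x)$, $\mathcal L_{\mathcal H}=\frac1{n-f}\sum_{i\in\mathcal H}\mathcal L_i$, $\mathcal L_\star=\inf\mathcal L_{\mathcal H}$, $\mathcal L_0=\mathcal L_{\mathcal H}(\theta_0)-\mathcal L_\star$. Assume for all $\theta$: $\frac1{n-f}\sum_{i\in\mathcal H}\langle v,\nabla\mathcal L_i(\theta)-\nabla\mathcal L_{\mathcal H}(\theta)\rangle^2\le G_{\rm cov}^2$ for all $\|v\|\le1$; $\frac1m\sum_{x\in\mathcal D_i}\|\nabla\ell(\theta;x)-\nabla\mathcal L_i(\theta)\|^2\le\sigma^2$ for $i\in\mathcal H$; and $\|\nabla\ell(\theta;x)\|\le C$ for $x\in\mathcal D_i$, $i\in\mathcal H$, where $C\in[0,\infty]$ is the clipping threshold ($C=\infty$: no clipping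 and no condition). Assume that $\nabla\mathcal L_{\mathcal H}$ is $L$-Lipschitz, $L>0$ ("$L$-smooth"). **CAF.** On input $x_1,\dots,x_n$, start with weights $c_i=1$. While $\sum_i c_i\ge n-2f$: let $\hat\mu_c$ be the weighted mean, $\hat\sigma_c^2$ the largest eigenvalue of the weighted covariance matrix, $\hat v_c$ a corresponding unit eigenvector, $\tau_i=\langle\hat v_c,x_i-\hat\mu_c\rangle^2$, $\tau_{\max}=\max_{c_i>0}\tau_i$, and replace $c_i$ by $c_i(1-\tau_i/\tau_{\max})$ (weights that give $\tau_{\max}=0$ are kept, and then nothing changes any more). The output is the $\hat\mu_c$ with the smallest $\hat\sigma_c^2$ met in the loop. A number $\kappa\ge0$ is a *robustness coefficient* of CAF if $\|\mathrm{CAF}(x_1,\dots,x_n)-\bar x_S\|^2\le\kappa\,\lambda_{\max}\big(\frac1{|S|}\sum_{i\in S}(x_i-\bar x_S)(x_i-\bar x_S)^\top\big)$ for all inputs $x_1,\dots,x_n\in\mathbb R^d$ and all $S$ with $|S|=n-f$, $\bar x_S$ being the average over $S$. **CafCor.** Given $\theta_0$, set $m^{(i)}_0=0$ for $i\in\mathcal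 H$. At step $t=0,\dots,T-1$, worker $i\in\mathcal H$ sends $m^{(i)}_t$, where for $t\ge1$ $$m_t^{(i)}=\beta_{t-1}m_{t-1}^{(i)}+(1-\beta_{t-1})\Big(g_t^{(i)}+\sum_{j\ne i}v_t^{(ij)}+\bar v_t^{(i)}\Big);$$ here $g_t^{(i)}$ is the average of the gradients $\nabla\ell(\theta_t;x)$, clipped at $C$, over a mini-batch of $b$ points ($1\le b\le m$) drawn uniformly without replacement from $\mathcal D_i$, $v_t^{(ij)}=-v_t^{(ji)}\sim\mathcal N(0,\sigma_{\rm cor}^2I_d)$, $\bar v^{(i)}_t\sim\mathcal N(0,\sigma_{\rm ind}^2I_d)$, and the mini-batches and noises (one correlated noise per pair) of a step are mutually independent and independent of the history of the previous steps. Malicious workers send arbitrary vectors that may depend on everything that has happened up to and including the current step. The server computes $R_t=\mathrm{CAF}(m_t^{(1)},\dots,m_t^{(n)})$ and $\theta_{t+1}=\theta_t-\gamma_tR_t$. Put $a_1=240$, $a_2=480$, $a_3=5760$, $a_4=270$, $\sigma_b^2=2(1-\frac bm)\frac{\sigma^2}b$ and $$\bar\sigma^2=\frac{\sigma_b^2+d(f\sigma_{\rm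 cor}^2+\sigma_{\rm ind}^2)}{n-f}+4\kappa\Big(\sigma_b^2+108\,(n\sigma_{\rm cor}^2+\sigma_{\rm ind}^2)\big(1+\tfrac d{n-f}\big)\Big).$$ **Theorem.** CAF has robustness coefficients; for instance, $\frac{2f}{n-2f}\big(1+\frac{6(n-f)}{n-2f}\big)$ is one. For every robustness coefficient $\kappa$ of CAF and every $T\ge1$: 1. (Strongly convex case.) If $\mathcal L_{\mathcal H}$ is $\mu$-strongly convex, $\mu>0$, then with $\gamma_t=\frac{10}{\mu(t+a_1L/\mu)}$ and $\beta_t=1-24L\gamma_t$ the random variable $\mathcal L_{\mathcal H}(\theta_T)$ is integrable and $$\mathbb E[\mathcal L_{\mathcal H}(\theta_T)-\mathcal L_\star]\le\frac{4a_1}{\mu}\kappa G_{\rm cov}^2+\frac{2a_1^2L\bar\sigma^2}{\mu^2T}+\frac{2a_1^2L^2\mathcal L_0}{\mu^2T^2}.$$ 2. (Non-convex case.) If $\mathcal L_{\mathcal H}$ is bounded below, then with the constants $\gamma_t=\gamma=\min\Big\{\frac1{24L},\frac{\sqrt{a_4\mathcal L_0}}{2\bar\sigma\sqrt{a_3LT}}\Big\}$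 (that is, $\gamma=\frac1{24L}$ if $\bar\sigma=0$) and $\beta_t=1-24L\gamma$, and with $\hat\theta$ drawn uniformly from $\{\theta_0,\dots,\theta_{T-1}\}$, independently of the run, $\|\nabla\mathcal L_{\mathcal H}(\hat\theta)\|^2$ is integrable and $$\mathbb E\|\nabla\mathcal L_{\mathcal H}(\hat\theta)\|^2\le a_2\kappa G_{\rm cov}^2+\frac{\sqrt{a_3a_4L\mathcal L_0}\,\bar\sigma}{\sqrt T}+\frac{a_4L\mathcal L_0}{T}.$$ -/

import Mathlib

open MeasureTheory ProbabilityTheory Finset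
open scoped Gradient ENNReal NNReal

namespace CafCor

/-- The parameter space `ℝ^d` with its Euclidean norm. -/
abbrev E (d : ℕ) : Type := EuclideanSpace ℝ (Fin d)

/-! ### The aggregation rule CAF (covariance-bound-agnostic filter) -/

section CAF

variable {d n : ℕ}

/-- Mean of `x₁, …, xₙ` with respect to the weights `c`. -/
noncomputable def weightedMean (c : Fin n → ℝ) (x : Fin n → E d) : E d :=
  (∑ i, c i)⁻¹ • ∑ i, c i • x i

/-- Covariance matrix of `x₁, …, xₙ` with respect to the weights `c`. -/
noncomputable def weightedCov (c : Fin n → ℝ) (x : Fin n → E d) : Matrix (Fin d) (Fin d) ℝ :=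
  (∑ i, c i)⁻¹ • ∑ i, c i •
    Matrix.vecMulVec (x i - weightedMean c x).ofLp (x i - weightedMean c x).ofLp

/-- The largest (real) eigenvalue of a matrix; it is applied to covariance matrices only. -/
noncomputable def lambdaMax (M : Matrix (Fin d) (Fin d) ℝ) : ℝ :=
  sSup {l : ℝ | Module.End.HasEigenvalue (Matrix.toEuclideanLin M) l}

/-- `v` is a unit eigenvector of `M` for its largest eigenvalue. -/
def IsTopEigenvector (M : Matrix (Fin d) (Fin d) ℝ) (v : E d) : Prop :=
  ‖v‖ = 1 ∧ Matrix.toEuclideanLin M v = lambdaMax M • v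

/-- Squared deviation of `xᵢ` from the weighted mean in direction `v`. -/
noncomputable def score (c : Fin n → ℝ) (x : Fin n → E d) (v : E d) (i : Fin n) : ℝ :=
  (inner ℝ v (x i - weightedMean c x)) ^ 2

/-- Largest score among the points that still have positive weight. -/
noncomputable def maxScore (c : Fin n → ℝ) (x : Fin n → E d) (v : E d) : ℝ :=
  ⨆ i : {i : Fin n // 0 < c i}, score c x v i

/-- One reweighting step of the filter, `cᵢ ← cᵢ (1 - τᵢ / τ_max)`.
(If `τ_max = 0`, all the remaining points coincide in direction `v`, and the weights are kept.) -/
noncomputable def reweight (c : Fin n → ℝ) (x : Fin n → E d) (v : E d) : Fin n → ℝ :=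
  fun i => c i * (1 - score c x v i / maxScore c x v)

/-- `y` is an output of CAF on the inputs `x₁, …, xₙ` with the bound `f` on the number of corrupted
inputs. Starting from unit weights, the weights are repeatedly updated with a top eigenvector
`v k` of the current weighted covariance (any choice is allowed) as long as their sum is at least
`n - 2f`; the output is the weighted mean at an iteration `k₀` at which the largest eigenvalue of
the weighted covariance is smallest among the iterations of the loop. Once the sum of the
weights has dropped below `n - 2f` it stays below, and the further terms are not used. -/
def IsCAFOutput (f : ℕ) (x : Fin n → E d) (y : E d) : Prop :=
  ∃ (c : ℕ → Fin n → ℝ) (v : ℕ → E d) (k₀ : ℕ),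
    (∀ i, c 0 i = 1) ∧
    (∀ k, IsTopEigenvector (weightedCov (c k) x) (v k)) ∧
    (∀ k, c (k + 1) = reweight (c k) x (v k)) ∧
    (n : ℝ) - 2 * f ≤ ∑ i, c k₀ i ∧
    (∀ k, (n : ℝ) - 2 * f ≤ ∑ i, c k i →
      lambdaMax (weightedCov (c k₀) x) ≤ lambdaMax (weightedCov (c k) x)) ∧
    y = weightedMean (c k₀) x

/-- Unit weights on the members of `S`, so that `weightedMean (unitWeights S) x` is the average and
`weightedCov (unitWeights S) x` the empirical covariance of `(xᵢ)_{i ∈ S}`. -/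
noncomputable def unitWeights (S : Finset (Fin n)) : Fin n → ℝ := fun i => if i ∈ S then 1 else 0

/-- `κ` is a robustness coefficient of CAF in dimension `d`, with `n` inputs of which `f` may be
corrupted: `‖CAF(x₁, …, xₙ) - x̄_S‖² ≤ κ λ_max(Cov_S(x))` for all inputs and all sets `S` of
`n - f` inputs. -/
def IsRobustnessCoefficient (d n f : ℕ) (κ : ℝ) : Prop :=
  0 ≤ κ ∧ ∀ (x : Fin n → E d) (y : E d), IsCAFOutput f x y →
    ∀ S : Finset (Fin n), S.card = n - f →
      ‖y - weightedMean (unitWeights S) x‖ ^ 2 ≤ κ * lambdaMax (weightedCov (unitWeights S) x)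

end CAF

/-! ### The learning problem -/

section Losses

variable {X : Type*} {d n m : ℕ}

/-- Empirical loss of worker `i`, whose dataset is `D i 0, …, D i (m-1)`. -/
noncomputable def localLoss (ℓ : E d → X → ℝ) (D : Fin n → Fin m → X) (i : Fin n) (θ : E d) : ℝ :=
  (m : ℝ)⁻¹ * ∑ k, ℓ θ (D i k)

/-- The honest loss `L_H`. -/
noncomputable def honestLoss (ℓ : E d → X → ℝ) (D : Fin n → Fin m → X) (H : Finset (Fin n))
    (θ : E d) : ℝ :=
  (H.card : ℝ)⁻¹ * ∑ i ∈ H, localLoss ℓ D i θ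

/-- Gradient of the loss at a data point. -/
noncomputable def gradAt (ℓ : E d → X → ℝ) (θ : E d) (x : X) : E d := ∇ (fun η => ℓ η x) θ

/-- Heterogeneity bounded by `G²` in every direction. -/
def BoundedHeterogeneity (ℓ : E d → X → ℝ) (D : Fin n → Fin m → X) (H : Finset (Fin n))
    (G : ℝ) : Prop :=
  ∀ θ v : E d, ‖v‖ ≤ 1 →
    (H.card : ℝ)⁻¹ * ∑ i ∈ H,
      (inner ℝ v (∇ (localLoss ℓ D i) θ - ∇ (honestLoss ℓ D H) θ)) ^ 2 ≤ G ^ 2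

/-- Variance of the gradients at a uniform data point of each honest worker bounded by `σ²`. -/
def BoundedVariance (ℓ : E d → X → ℝ) (D : Fin n → Fin m → X) (H : Finset (Fin n))
    (σ : ℝ) : Prop :=
  ∀ i ∈ H, ∀ θ : E d,
    (m : ℝ)⁻¹ * ∑ k, ‖gradAt ℓ θ (D i k) - ∇ (localLoss ℓ D i) θ‖ ^ 2 ≤ σ ^ 2

/-- Gradients at the honest data points bounded by `C ∈ [0, ∞]`; no condition for `C = ∞`. -/
def BoundedGradients (ℓ : E d → X → ℝ) (D : Fin n → Fin m → X) (H : Finset (Fin n))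
    (C : ℝ≥0∞) : Prop :=
  ∀ θ : E d, ∀ i ∈ H, ∀ k, ‖gradAt ℓ θ (D i k)‖ₑ ≤ C

/-- `F` is `L`-smooth: its gradient is `L`-Lipschitz. -/
def IsSmooth (L : ℝ) (F : E d → ℝ) : Prop :=
  ∀ θ θ' : E d, ‖∇ F θ' - ∇ F θ‖ ≤ L * ‖θ' - θ‖

/-- `F` is `μ`-strongly convex (first-order form). -/
def IsStronglyConvex (μ : ℝ) (F : E d → ℝ) : Prop :=
  ∀ θ θ' : E d, μ / 2 * ‖θ' - θ‖ ^ 2 ≤ F θ' - F θ - inner ℝ (∇ F θ) (θ' - θ)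

/-- Clipping at the threshold `C ∈ [0, ∞]`. -/
noncomputable def clip (C : ℝ≥0∞) (g : E d) : E d :=
  open Classical in if ‖g‖ₑ ≤ C then g else (C.toReal / ‖g‖) • g

/-- Average of the clipped gradients over the mini-batch `B` of worker `i`. -/
noncomputable def batchGrad (ℓ : E d → X → ℝ) (D : Fin n → Fin m → X) (C : ℝ≥0∞) (i : Fin n)
    (θ : E d) (B : Finset (Fin m)) : E d :=
  (B.card : ℝ)⁻¹ • ∑ k ∈ B, clip C (gradAt ℓ θ (D i k))

end Losses

/-! ### The algorithm CafCor -/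

/-- The random sources used at one step: the mini-batch of each worker, the correlated noise of each
pair of workers, the independent noise of each worker. -/
abbrev Source (n : ℕ) : Type := Fin n ⊕ {p : Fin n × Fin n // p.1 < p.2} ⊕ Fin n

/-- The centered Gaussian law `N(0, s² I_d)`. -/
noncomputable def gaussianNoise (d : ℕ) (s : ℝ) : Measure (E d) :=
  multivariateGaussian 0 (s ^ 2 • (1 : Matrix (Fin d) (Fin d) ℝ))

/-- An execution of `T` steps of CafCor on the probability space `(Ω, P)`, for the losses `ℓ`, the
datasets `D`, the honest workers `H`, at most `f` malicious workers, batch size `b`, clipping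
threshold `C`, standard deviations `sCor`, `sInd` of the correlated and the independent noise, step
sizes `γ`, momentum coefficients `β` and initial point `θ₀`.

`ℱ t` holds everything known up to and including step `t`. The malicious workers are omniscient:
their step-`t` messages are arbitrary `ℱ t`-measurable vectors. The fresh randomness of the
next step is independent of `ℱ t`. -/
structure Execution {X : Type*} {d n m : ℕ} (ℓ : E d → X → ℝ) (D : Fin n → Fin m → X)
    (H : Finset (Fin n)) (f b : ℕ) (C : ℝ≥0∞) (sCor sInd : ℝ) (γ β : ℕ → ℝ) (θ₀ : E d) (T : ℕ)
    {Ω : Type*} [mΩ : MeasurableSpace Ω] (P : Measure Ω) where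
  /-- history up to and including each step -/
  ℱ : Filtration ℕ mΩ
  /-- mini-batch `batch t i` of worker `i` at step `t` -/
  batch : ℕ → Fin n → Ω → Finset (Fin m)
  /-- correlated noise `corNoise t i j` that worker `i` adds because of worker `j` -/
  corNoise : ℕ → Fin n → Fin n → Ω → E d
  /-- independent noise of each worker -/
  indNoise : ℕ → Fin n → Ω → E d
  /-- `msg t i` is the vector sent by worker `i` at step `t`: the momentum if `i` is honest -/
  msg : ℕ → Fin n → Ω → E d
  /-- aggregate computed by the server -/
  agg : ℕ → Ω → E d
  /-- model parameters -/
  θ : ℕ → Ω → E d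
  -- randomness of step `t + 1`
  batch_measurable : ∀ t, t + 1 < T → ∀ i, Measurable[ℱ (t + 1)] (batch (t + 1) i)
  corNoise_measurable : ∀ t, t + 1 < T → ∀ i j, Measurable[ℱ (t + 1)] (corNoise (t + 1) i j)
  indNoise_measurable : ∀ t, t + 1 < T → ∀ i, Measurable[ℱ (t + 1)] (indNoise (t + 1) i)
  batch_law : ∀ t, t + 1 < T → ∀ i,
    P.map (batch (t + 1) i) = uniformOn {B : Finset (Fin m) | B.card = b}
  corNoise_law : ∀ t, t + 1 < T → ∀ i j, i < j →
    P.map (corNoise (t + 1) i j) = gaussianNoise d sCor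
  corNoise_antisymm : ∀ t, t + 1 < T → ∀ i j ω, corNoise (t + 1) j i ω = -corNoise (t + 1) i j ω
  indNoise_law : ∀ t, t + 1 < T → ∀ i, P.map (indNoise (t + 1) i) = gaussianNoise d sInd
  -- the history `ℱ t` and all the sources of step `t + 1` are mutually independent
  fresh : ∀ t, t + 1 < T → iIndep (fun s : Option (Source n) => match s with
    | none => ℱ t
    | some (.inl i) => MeasurableSpace.comap (batch (t + 1) i) inferInstance
    | some (.inr (.inl p)) => MeasurableSpace.comap (corNoise (t + 1) p.1.1 p.1.2) inferInstance
    | some (.inr (.inr i)) => MeasurableSpace.comap (indNoise (t + 1) i) inferInstance) P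
  -- messages
  msg_zero : ∀ i ∈ H, ∀ ω, msg 0 i ω = 0
  msg_succ : ∀ t, t + 1 < T → ∀ i ∈ H, ∀ ω,
    msg (t + 1) i ω = β t • msg t i ω + (1 - β t) •
      (batchGrad ℓ D C i (θ (t + 1) ω) (batch (t + 1) i ω)
        + ∑ j ∈ univ.erase i, corNoise (t + 1) i j ω + indNoise (t + 1) i ω)
  msg_malicious : ∀ t, t < T → ∀ i, i ∉ H → Measurable[ℱ t] (msg t i)
  -- server
  agg_measurable : ∀ t, t < T → Measurable[ℱ t] (agg t)
  agg_spec : ∀ t, t < T → ∀ ω, IsCAFOutput f (fun i => msg t i ω) (agg t ω)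
  θ_zero : ∀ ω, θ 0 ω = θ₀
  θ_succ : ∀ t, t < T → ∀ ω, θ (t + 1) ω = θ t ω - γ t • agg t ω

/-! ### Quantities in the bounds -/

/-- `σ_b² = 2 (1 - b/m) σ²/b`. -/
noncomputable def batchVariance (m b : ℕ) (σ : ℝ) : ℝ := 2 * (1 - (b : ℝ) / m) * (σ ^ 2 / b)

/-- `σ̄² = (σ_b² + d (f σ_cor² + σ_ind²)) / (n - f)
    + 4 κ (σ_b² + 108 (n σ_cor² + σ_ind²) (1 + d / (n - f)))`. -/
noncomputable def totalVariance (d n m f b : ℕ) (κ σ sCor sInd : ℝ) : ℝ :=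
  (batchVariance m b σ + d * (f * sCor ^ 2 + sInd ^ 2)) / ((n : ℝ) - f)
    + 4 * κ * (batchVariance m b σ
      + 108 * (n * sCor ^ 2 + sInd ^ 2) * (1 + d / ((n : ℝ) - f)))

/-- The constant step size `min {1/(24 L), √(a₄ L₀) / (2 σ̄ √(a₃ L T))}` with `a₃ = 5760` and
`a₄ = 270`; the second term is `+∞` when `σ̄ = 0`. -/
noncomputable def constantStep (L L₀ σbar : ℝ) (T : ℕ) : ℝ :=
  open Classical in
  if σbar = 0 then 1 / (24 * L)
  else min (1 / (24 * L)) (√(270 * L₀) / (2 * σbar * √(5760 * L * T)))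

end CafCor

namespace CafCor

/-! ### Weighted covariance matrices -/

section CAF

variable {d n : ℕ}

/-! Robustness of the filter. Fix a set S of n - f inputs. While the points outside S carry more
than half of the weighted scores, a reweighting step takes more weight from the complement than from
S, so S keeps its initial lead n - 2f. Every such step also annihilates a weight, hence some iterate
k has at least half of the scores in S (`exists_good_iterate`), and there the top eigenvalue is at
most r λ_S with r = 2(n-f)/(n-2f) (`lambdaMax_mul_le`). The output has no larger eigenvalue than
iterate k. When weight is removed, the squared displacement of the mean is at most λ times removed
weight over remaining weight (`sq_norm_weightedMean_sub_le`). At most three such displacements join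
the output to the average over S.

Error of the aggregate. Let F be the honest loss, M_t the mean of the honest momenta, R_t the
aggregate. Robustness bounds ‖R_t - M_t‖² by κ times the top eigenvalue of the covariance of the
honest momenta. Heterogeneity passes through the momentum by convexity and contributes G²;
mini-batch errors contribute their second moments; the injected noise contributes a supremum over
directions of a quadratic form in jointly sub-Gaussian vectors. Averaging its exponential over the
unit ball bounds this supremum by a variable of mean O(s(n + d)), where bounding it by the trace
would cost a product n d (`JointlySubGaussian.exists_uniform_bound`). Momentum damps both kinds of
noise by `momentumVariance`, which is of the order of η = 24 L γ. In M_t itself the noise shared by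
two honest workers cancels, so that only pairs of an honest and a malicious worker count.

Dynamics. Malicious messages may depend on all the noise of their step, but θ_{t+1} is determined by
the history up to t, and the noise of step t + 1 is orthogonal to that history. Hence E‖M_t -
∇F(θ_t)‖² contracts by 1 - 24 L γ_t, up to the drift of the gradient and the fresh noise. Combined
with the descent inequality this makes E[F(θ_t) - inf F] + E‖M_t - ∇F(θ_t)‖²/(8L) a Lyapunov
function (`Execution.lyapunov_succ_le`). With strong convexity its decrease is a recursion solved by
A + B/k + D/k², k = t + 240 L/μ; without it, one telescopes and tunes the constant step. -/

lemma toEuclideanLin_weightedCov (c : Fin n → ℝ) (x : Fin n → E d) (u : E d) :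
    Matrix.toEuclideanLin (weightedCov c x) u =
      (∑ i, c i)⁻¹ • ∑ i, c i •
        (inner ℝ u (x i - weightedMean c x) • (x i - weightedMean c x)) := by
  ext k
  simp only [weightedCov, map_smul, map_sum, LinearMap.smul_apply, LinearMap.sum_apply,
    PiLp.smul_apply, WithLp.ofLp_sum, Finset.sum_apply, smul_eq_mul]
  congr 1
  refine Finset.sum_congr rfl fun i _ => ?_
  congr 1
  simp only [Matrix.toLpLin_apply, Matrix.vecMulVec_mulVec, PiLp.inner_apply]
  simp [dotProduct, mul_comm]

/-- Empirical variance in direction `u`. -/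
noncomputable def directionalVariance (c : Fin n → ℝ) (x : Fin n → E d) (u : E d) : ℝ :=
  (∑ i, c i)⁻¹ * ∑ i, c i * (inner ℝ u (x i - weightedMean c x)) ^ 2

lemma inner_toEuclideanLin_weightedCov (c : Fin n → ℝ) (x : Fin n → E d) (u w : E d) :
    inner ℝ (Matrix.toEuclideanLin (weightedCov c x) u) w =
      (∑ i, c i)⁻¹ * ∑ i, c i *
        (inner ℝ u (x i - weightedMean c x) * inner ℝ (x i - weightedMean c x) w) := by
  simp only [toEuclideanLin_weightedCov, real_inner_smul_left, sum_inner]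

lemma inner_toEuclideanLin_weightedCov_self (c : Fin n → ℝ) (x : Fin n → E d) (u : E d) :
    inner ℝ (Matrix.toEuclideanLin (weightedCov c x) u) u = directionalVariance c x u := by
  rw [inner_toEuclideanLin_weightedCov, directionalVariance]
  congr 1
  refine Finset.sum_congr rfl fun i _ => ?_
  rw [real_inner_comm u, sq]

lemma isSymmetric_toEuclideanLin_weightedCov (c : Fin n → ℝ) (x : Fin n → E d) :
    (Matrix.toEuclideanLin (weightedCov c x)).IsSymmetric := by
  intro u w
  rw [real_inner_comm (Matrix.toEuclideanLin _ w) u, inner_toEuclideanLin_weightedCov,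
    inner_toEuclideanLin_weightedCov]
  congr 1
  refine Finset.sum_congr rfl fun i _ => ?_
  rw [real_inner_comm w, real_inner_comm (x i - weightedMean c x) u]
  ring

lemma bddAbove_hasEigenvalue (c : Fin n → ℝ) (x : Fin n → E d) :
    BddAbove {l : ℝ | Module.End.HasEigenvalue (Matrix.toEuclideanLin (weightedCov c x)) l} :=
  (Module.End.finite_hasEigenvalue _).bddAbove

/-- In finite dimension the supremum of the Rayleigh quotient of a symmetric operator is one of its
eigenvalues. `Nontrivial` excludes d = 0, where there are none. -/
lemma directionalVariance_le_lambdaMax [Nontrivial (E d)] (c : Fin n → ℝ) (x : Fin n → E d)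
    (u : E d) :
    directionalVariance c x u ≤ lambdaMax (weightedCov c x) * ‖u‖ ^ 2 := by
  by_cases hu : u = 0
  · simp [hu, directionalVariance]
  have hs := isSymmetric_toEuclideanLin_weightedCov c x
  have h1 := le_csSup (bddAbove_hasEigenvalue c x) hs.hasEigenvalue_iSup_of_finiteDimensional
  have hb : BddAbove (Set.range fun y : {y : E d // y ≠ 0} =>
      RCLike.re (inner ℝ (Matrix.toEuclideanLin (weightedCov c x) y) (y : E d))
        / ‖(y : E d)‖ ^ 2) := by
    obtain ⟨B, hB⟩ := (LinearMap.toContinuousLinearMap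
      (Matrix.toEuclideanLin (weightedCov c x))).bddAbove_rayleighQuotient
    refine ⟨B, ?_⟩
    rintro _ ⟨y, rfl⟩
    exact (le_abs_self _).trans (hB ⟨y, rfl⟩)
  have h2 := le_ciSup hb ⟨u, hu⟩
  have h3 := h2.trans h1
  simp only [inner_toEuclideanLin_weightedCov_self, RCLike.re_to_real] at h3
  rwa [div_le_iff₀ (by positivity)] at h3

lemma lambdaMax_le [Nontrivial (E d)] {c : Fin n → ℝ} {x : Fin n → E d} {B : ℝ}
    (h : ∀ u : E d, ‖u‖ = 1 → directionalVariance c x u ≤ B) :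
    lambdaMax (weightedCov c x) ≤ B := by
  refine csSup_le ⟨_, (isSymmetric_toEuclideanLin_weightedCov c
    x).hasEigenvalue_iSup_of_finiteDimensional⟩ ?_
  intro l hl
  obtain ⟨v, hv⟩ := hl.exists_hasEigenvector
  have hv0 : ‖v‖ ≠ 0 := norm_ne_zero_iff.2 hv.2
  have hw := hv.apply_eq_smul
  have h1 : ‖(‖v‖⁻¹ • v)‖ = 1 := by rw [norm_smul, norm_inv, norm_norm, inv_mul_cancel₀ hv0]
  have h2 := h _ h1
  rw [← inner_toEuclideanLin_weightedCov_self, map_smul, hw, smul_comm, real_inner_smul_left,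
    real_inner_self_eq_norm_sq, h1] at h2
  simpa using h2

lemma IsTopEigenvector.lambdaMax_eq {c : Fin n → ℝ} {x : Fin n → E d} {v : E d}
    (hv : IsTopEigenvector (weightedCov c x) v) :
    lambdaMax (weightedCov c x) = (∑ i, c i)⁻¹ * ∑ i, c i * score c x v i := by
  have := inner_toEuclideanLin_weightedCov_self c x v
  rw [hv.2, real_inner_smul_left, real_inner_self_eq_norm_sq, hv.1] at this
  simpa [score, directionalVariance] using this

/-- A unit vector exists only if d ≥ 1. For d = 0, CAF has no output and claims about its outputs
are vacuous. -/
lemma IsTopEigenvector.nontrivial {M : Matrix (Fin d) (Fin d) ℝ} {v : E d}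
    (hv : IsTopEigenvector M v) : Nontrivial (E d) :=
  ⟨v, 0, fun h => by simpa [h] using hv.1⟩

lemma sum_smul_sub_weightedMean {c : Fin n → ℝ} (hc : ∑ i, c i ≠ 0) (x : Fin n → E d) :
    ∑ i, c i • (x i - weightedMean c x) = 0 := by
  simp only [smul_sub, Finset.sum_sub_distrib, ← Finset.sum_smul]
  rw [weightedMean, smul_smul, mul_inv_cancel₀ hc, one_smul, sub_self]

/-- The second moment about a point `z` is the variance plus the squared bias. -/
lemma sum_mul_inner_sub_sq {c : Fin n → ℝ} (hc : ∑ i, c i ≠ 0) (x : Fin n → E d) (u z : E d) :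
    ∑ i, c i * (inner ℝ u (x i - z)) ^ 2 =
      ∑ i, c i * (inner ℝ u (x i - weightedMean c x)) ^ 2
        + (∑ i, c i) * (inner ℝ u (weightedMean c x - z)) ^ 2 := by
  have h0 : ∑ i, c i * inner ℝ u (x i - weightedMean c x) = 0 := by
    have := congrArg (fun y => inner ℝ u y) (sum_smul_sub_weightedMean hc x)
    simpa [inner_sum, real_inner_smul_right] using this
  have h1 : ∀ i, c i * (inner ℝ u (x i - z)) ^ 2 =
      c i * (inner ℝ u (x i - weightedMean c x)) ^ 2
      + 2 * inner ℝ u (weightedMean c x - z) * (c i * inner ℝ u (x i - weightedMean c x))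
      + c i * (inner ℝ u (weightedMean c x - z)) ^ 2 := by
    intro i
    rw [show x i - z = (x i - weightedMean c x) + (weightedMean c x - z) by abel, inner_add_right]
    ring
  simp only [h1, Finset.sum_add_distrib, ← Finset.mul_sum, ← Finset.sum_mul, h0]
  ring

lemma lambdaMax_weightedCov_nonneg [Nontrivial (E d)] {c : Fin n → ℝ} (hc : ∀ i, 0 ≤ c i)
    (x : Fin n → E d) : 0 ≤ lambdaMax (weightedCov c x) := by
  obtain ⟨u, hu⟩ := exists_ne (0 : E d)
  have h1 := directionalVariance_le_lambdaMax c x u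
  have h2 : 0 ≤ directionalVariance c x u :=
    mul_nonneg (inv_nonneg.2 (Finset.sum_nonneg fun i _ => hc i))
      (Finset.sum_nonneg fun i _ => mul_nonneg (hc i) (sq_nonneg _))
  exact nonneg_of_mul_nonneg_left (h2.trans h1) (by positivity)

/-- The mean moves little when part of the weight is removed. -/
lemma sq_norm_weightedMean_sub_le [Nontrivial (E d)] {c c' : Fin n → ℝ} (hc' : ∀ i, 0 ≤ c' i)
    (hle : ∀ i, c' i ≤ c i) (hpos : 0 < ∑ i, c' i) (x : Fin n → E d) :
    (∑ i, c' i) * ‖weightedMean c' x - weightedMean c x‖ ^ 2 ≤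
      (∑ i, c i - ∑ i, c' i) * lambdaMax (weightedCov c x) := by
  set W := ∑ i, c i with hW
  set W' := ∑ i, c' i with hW'
  have hWW : W' ≤ W := Finset.sum_le_sum fun i _ => hle i
  have hWpos : 0 < W := hpos.trans_le hWW
  set w := weightedMean c' x - weightedMean c x with hw
  by_cases hw0 : w = 0
  · rw [hw0]
    simp only [norm_zero, ne_eq, OfNat.ofNat_ne_zero, not_false_eq_true, zero_pow, mul_zero]
    exact mul_nonneg (by linarith)
      (lambdaMax_weightedCov_nonneg (fun i => (hc' i).trans (hle i)) x)
  have hwn : 0 < ‖w‖ ^ 2 := by positivity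
  set y : Fin n → ℝ := fun i => inner ℝ w (x i - weightedMean c x) with hy
  have hQ : ∑ i, c i * y i ^ 2 ≤ W * (lambdaMax (weightedCov c x) * ‖w‖ ^ 2) := by
    have := directionalVariance_le_lambdaMax c x w
    rw [directionalVariance, inv_mul_le_iff₀ hWpos] at this
    exact this
  have h0 : ∑ i, c i * y i = 0 := by
    have := congrArg (fun y => inner ℝ w y) (sum_smul_sub_weightedMean hWpos.ne' x)
    simpa [inner_sum, real_inner_smul_right] using this
  have h1 : ∑ i, c' i * y i = W' * ‖w‖ ^ 2 := by
    have : ∑ i, c' i • (x i - weightedMean c x) = W' • w := by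
      simp only [smul_sub, Finset.sum_sub_distrib, ← Finset.sum_smul, hw]
      rw [show weightedMean c' x = W'⁻¹ • ∑ i, c' i • x i from rfl, smul_smul W',
        mul_inv_cancel₀ hpos.ne', one_smul]
    have := congrArg (fun y => inner ℝ w y) this
    simpa [inner_sum, real_inner_smul_right] using this
  have h2 : ∑ i, (c i - c' i) * y i = - (W' * ‖w‖ ^ 2) := by
    simp only [sub_mul, Finset.sum_sub_distrib, h0, h1, zero_sub]
  -- Weighted Cauchy–Schwarz, used both for the kept weights c' and for the removed weights c - c'.
  -- The removed weights alone would give the bound with an extra factor W / W'.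
  have cs : ∀ e : Fin n → ℝ, (∀ i, 0 ≤ e i) →
      (∑ i, e i * y i) ^ 2 ≤ (∑ i, e i) * ∑ i, e i * y i ^ 2 := fun e he =>
    Finset.sum_sq_le_sum_mul_sum_of_sq_le_mul _ (fun i _ => he i)
      (fun i _ => mul_nonneg (he i) (sq_nonneg _)) (fun i _ => le_of_eq (by ring))
  have k1 := cs c' hc'
  have k2 := cs (fun i => c i - c' i) fun i => sub_nonneg.2 (hle i)
  rw [h1] at k1
  rw [h2, Finset.sum_sub_distrib, ← hW, ← hW'] at k2
  have k3 : ∑ i, (c i - c' i) * y i ^ 2 = ∑ i, c i * y i ^ 2 - ∑ i, c' i * y i ^ 2 := by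
    simp only [sub_mul, Finset.sum_sub_distrib]
  rw [k3] at k2
  set Q := ∑ i, c i * y i ^ 2
  set Q' := ∑ i, c' i * y i ^ 2
  set a := ‖w‖ ^ 2
  have k4 : W' * a ^ 2 ≤ Q' := by
    have : W' * (W' * a ^ 2) ≤ W' * Q' := by nlinarith
    exact le_of_mul_le_mul_left this hpos
  have k5 : (W' * a) ^ 2 ≤ (W - W') * (Q - W' * a ^ 2) := by
    refine (by nlinarith : (W' * a) ^ 2 ≤ (W - W') * (Q - Q')).trans ?_
    exact mul_le_mul_of_nonneg_left (by linarith) (by linarith)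
  have k6 : W' * W * a ^ 2 ≤ (W - W') * Q := by nlinarith
  have k7 : (W - W') * Q ≤ (W - W') * (W * (lambdaMax (weightedCov c x) * a)) :=
    mul_le_mul_of_nonneg_left hQ (by linarith)
  have k8 : (W * a) * (W' * a) ≤ (W * a) * ((W - W') * lambdaMax (weightedCov c x)) := by
    nlinarith
  exact le_of_mul_le_mul_left k8 (mul_pos hWpos hwn)

end CAF

/-! ### The filter -/

section Filter

variable {d n : ℕ}

lemma score_le_maxScore {c : Fin n → ℝ} (x : Fin n → E d) (v : E d) {i : Fin n} (hi : 0 < c i) :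
    score c x v i ≤ maxScore c x v :=
  le_ciSup (f := fun i : {i : Fin n // 0 < c i} => score c x v i) (Set.finite_range _).bddAbove
    ⟨i, hi⟩

lemma score_nonneg (c : Fin n → ℝ) (x : Fin n → E d) (v : E d) (i : Fin n) :
    0 ≤ score c x v i := sq_nonneg _

lemma maxScore_nonneg (c : Fin n → ℝ) (x : Fin n → E d) (v : E d) : 0 ≤ maxScore c x v :=
  Real.iSup_nonneg fun _ => score_nonneg _ _ _ _

lemma reweight_nonneg {c : Fin n → ℝ} (hc : ∀ i, 0 ≤ c i) (x : Fin n → E d) (v : E d)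
    (i : Fin n) : 0 ≤ reweight c x v i := by
  rcases (hc i).eq_or_lt with h | h
  · simp [reweight, ← h]
  · exact mul_nonneg h.le (sub_nonneg.2
      (div_le_one_of_le₀ (score_le_maxScore x v h) (maxScore_nonneg c x v)))

lemma reweight_le {c : Fin n → ℝ} (hc : ∀ i, 0 ≤ c i) (x : Fin n → E d) (v : E d)
    (i : Fin n) : reweight c x v i ≤ c i :=
  mul_le_of_le_one_right (hc i)
    (sub_le_self _ (div_nonneg (score_nonneg _ _ _ _) (maxScore_nonneg _ _ _)))

lemma sum_reweight (c : Fin n → ℝ) (x : Fin n → E d) (v : E d) (S : Finset (Fin n)) :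
    ∑ i ∈ S, reweight c x v i =
      ∑ i ∈ S, c i - (∑ i ∈ S, c i * score c x v i) / maxScore c x v := by
  rw [Finset.sum_div, ← Finset.sum_sub_distrib]
  exact Finset.sum_congr rfl fun i _ => by rw [reweight]; ring

/-- A reweighting step with a positive score puts the weight of some point to zero. -/
lemma exists_reweight_eq_zero {c : Fin n → ℝ} {x : Fin n → E d} {v : E d} {i : Fin n}
    (hi : 0 < c i) (hs : 0 < score c x v i) : ∃ j, 0 < c j ∧ reweight c x v j = 0 := by
  have : Nonempty {i : Fin n // 0 < c i} := ⟨⟨i, hi⟩⟩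
  obtain ⟨j, hj⟩ := exists_eq_ciSup_of_finite (f := fun i : {i : Fin n // 0 < c i} => score c x v i)
  have hm : 0 < maxScore c x v := hs.trans_le (score_le_maxScore x v hi)
  refine ⟨j, j.2, ?_⟩
  have : score c x v j = maxScore c x v := hj
  rw [reweight, this, div_self hm.ne', sub_self, mul_zero]

section Run

variable {c : ℕ → Fin n → ℝ} {v : ℕ → E d} {x : Fin n → E d}

lemma weights_nonneg (h0 : ∀ i, c 0 i = 1)
    (hstep : ∀ k, c (k + 1) = reweight (c k) x (v k)) (k : ℕ) : ∀ i, 0 ≤ c k i := by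
  induction k with
  | zero => intro i; rw [h0]; exact zero_le_one
  | succ k ih => intro i; rw [hstep]; exact reweight_nonneg ih x (v k) i

lemma weights_antitone (h0 : ∀ i, c 0 i = 1)
    (hstep : ∀ k, c (k + 1) = reweight (c k) x (v k)) {j k : ℕ} (hjk : j ≤ k) (i : Fin n) : c k i ≤ c j i := by
  induction k, hjk using Nat.le_induction with
  | base => exact le_rfl
  | succ k _ ih =>
    refine le_trans ?_ ih
    rw [hstep]
    exact reweight_le (weights_nonneg h0 hstep k) x (v k) i

/-- The filter reaches an iterate at which the points of `S` carry at least half of the weighted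
scores; until then, less weight has been removed from `S` than from its complement. -/
lemma exists_good_iterate (h0 : ∀ i, c 0 i = 1)
    (hstep : ∀ k, c (k + 1) = reweight (c k) x (v k)) {f : ℕ} (hf : 2 * f < n) {S : Finset (Fin n)} (hS : S.card = n - f) :
    ∃ k, (∀ j ≤ k, (n : ℝ) - 2 * f + ∑ i ∈ Sᶜ, c j i ≤ ∑ i ∈ S, c j i) ∧
      ∑ i ∈ Sᶜ, c k i * score (c k) x (v k) i ≤ ∑ i ∈ S, c k i * score (c k) x (v k) i := by
  -- If there were no such iterate, the invariant would propagate forever and each step would see a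
  -- positive score outside S, hence kill a weight. There are only n weights.
  by_contra! hcon
  have hinv : ∀ k, ∀ j ≤ k, (n : ℝ) - 2 * f + ∑ i ∈ Sᶜ, c j i ≤ ∑ i ∈ S, c j i := by
    intro k
    induction k with
    | zero =>
      intro j hj
      obtain rfl : j = 0 := by omega
      have h1 : Sᶜ.card = f := by rw [Finset.card_compl, hS, Fintype.card_fin]; omega
      have h2 : ((n - f : ℕ) : ℝ) = (n : ℝ) - f := by rw [Nat.cast_sub (by omega)]
      simp only [h0, Finset.sum_const, h1, hS, nsmul_eq_mul, mul_one, h2]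
      linarith
    | succ k ih =>
      intro j hj
      rcases Nat.le_succ_iff.1 hj with hj | rfl
      · exact ih j hj
      have h1 := ih k le_rfl
      -- The weight removed from a set is its weighted score divided by the common `maxScore`, so
      -- comparing scores compares removals.
      have h2 := div_le_div_of_nonneg_right (hcon k ih).le (maxScore_nonneg (c k) x (v k))
      rw [Nat.succ_eq_add_one, hstep, sum_reweight, sum_reweight]
      linarith
  have hcard : ∀ k, (univ.filter fun i => 0 < c k i).card + k ≤ n := by
    intro k
    induction k with
    | zero => simpa using Finset.card_filter_le (univ : Finset (Fin n)) fun i => 0 < c 0 i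
    | succ k ih =>
      have hk := hcon k (hinv k)
      have hn := weights_nonneg h0 hstep k
      have hpos : 0 < ∑ i ∈ Sᶜ, c k i * score (c k) x (v k) i :=
        (Finset.sum_nonneg fun i _ => mul_nonneg (hn i) (score_nonneg _ _ _ _)).trans_lt hk
      obtain ⟨i, -, hi⟩ := Finset.exists_lt_of_sum_lt (s := Sᶜ) (f := fun _ => (0 : ℝ))
        (by simpa using hpos)
      have hi1 : 0 < c k i := (hn i).lt_of_ne fun h => by simp [← h] at hi
      obtain ⟨j, hj, hj0⟩ := exists_reweight_eq_zero hi1 (pos_of_mul_pos_right hi hi1.le)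
      have : (univ.filter fun i => 0 < c (k + 1) i) ⊂ univ.filter fun i => 0 < c k i := by
        refine Finset.ssubset_iff_subset_ne.2 ⟨fun i hi => ?_, fun h => ?_⟩
        · simp only [Finset.mem_filter, Finset.mem_univ, true_and] at hi ⊢
          exact hi.trans_le (weights_antitone h0 hstep (Nat.le_succ k) i)
        · have : j ∈ univ.filter fun i => 0 < c (k + 1) i := by rw [h]; simpa using hj
          simp [hstep, hj0] at this
      have := Finset.card_lt_card this
      omega
  have := hcard (n + 1)
  omega

end Run

/-! ### The top eigenvalue at an iterate where S carries half of the scores -/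

section Bounds

variable [Nontrivial (E d)] {x : Fin n → E d} {f : ℕ} {S : Finset (Fin n)} {c : Fin n → ℝ}

lemma sum_unitWeights (S : Finset (Fin n)) : ∑ i, unitWeights S i = S.card := by
  simp [unitWeights]

/-- Restriction of weights to a set. -/
noncomputable def restrictWeights (S : Finset (Fin n)) (c : Fin n → ℝ) : Fin n → ℝ :=
  fun i => if i ∈ S then c i else 0

lemma sum_restrictWeights (S : Finset (Fin n)) (c : Fin n → ℝ) :
    ∑ i, restrictWeights S c i = ∑ i ∈ S, c i := by
  simp [restrictWeights, Finset.sum_ite_mem]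

lemma sum_restrictWeights_mul (S : Finset (Fin n)) (c y : Fin n → ℝ) :
    ∑ i, restrictWeights S c i * y i = ∑ i ∈ S, c i * y i := by
  simp [restrictWeights, ite_mul, Finset.sum_ite_mem]

/-- Bound on the weighted variance when `S` carries at least half of the scores. -/
lemma lambdaMax_mul_le {v : E d} (hv : IsTopEigenvector (weightedCov c x) v)
    (hc0 : ∀ i, 0 ≤ c i) (hc1 : ∀ i, c i ≤ 1) (hApos : 0 < ∑ i ∈ S, c i) (hS : 0 < S.card)
    (hhalf : ∑ i ∈ Sᶜ, c i * score c x v i ≤ ∑ i ∈ S, c i * score c x v i) :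
    (∑ i ∈ S, c i - ∑ i ∈ Sᶜ, c i) * lambdaMax (weightedCov c x) ≤
      2 * S.card * lambdaMax (weightedCov (unitWeights S) x) := by
  set A := ∑ i ∈ S, c i with hA
  set B := ∑ i ∈ Sᶜ, c i with hB
  have hBn : 0 ≤ B := Finset.sum_nonneg fun i _ => hc0 i
  have hW : ∑ i, c i = A + B := (Finset.sum_add_sum_compl S c).symm
  have hWpos : 0 < ∑ i, c i := by rw [hW]; linarith
  have hlam := hv.lambdaMax_eq
  rw [eq_inv_mul_iff_mul_eq₀ hWpos.ne', hW] at hlam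
  set lam := lambdaMax (weightedCov c x)
  set cS := restrictWeights S c with hcS
  have hsub := sq_norm_weightedMean_sub_le (c := c) (c' := cS)
    (fun i => by rw [hcS, restrictWeights]; split_ifs <;> simp [hc0])
    (fun i => by rw [hcS, restrictWeights]; split_ifs <;> simp [hc0])
    (by rw [sum_restrictWeights]; exact hApos) x
  rw [sum_restrictWeights, hW] at hsub
  have hin : (inner ℝ v (weightedMean cS x - weightedMean c x)) ^ 2 ≤
      ‖weightedMean cS x - weightedMean c x‖ ^ 2 := by
    rw [sq_le_sq, abs_norm]
    refine (abs_real_inner_le_norm _ _).trans ?_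
    rw [hv.1, one_mul]
  -- The scores of S are the variance of S about its own mean plus the squared shift of that mean;
  -- the shift comes from the weight B outside S and costs at most B λ.
  have hS1 : ∑ i ∈ S, c i * score c x v i =
      ∑ i, cS i * (inner ℝ v (x i - weightedMean cS x)) ^ 2
        + A * (inner ℝ v (weightedMean cS x - weightedMean c x)) ^ 2 := by
    have := sum_mul_inner_sub_sq (c := cS) (by rw [sum_restrictWeights]; exact hApos.ne') x v
      (weightedMean c x)
    rw [sum_restrictWeights] at this
    rw [← this, hcS, sum_restrictWeights_mul]
    rfl
  have hS2 : ∑ i, cS i * (inner ℝ v (x i - weightedMean cS x)) ^ 2 ≤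
      S.card * lambdaMax (weightedCov (unitWeights S) x) := by
    have h1 := sum_mul_inner_sub_sq (c := cS) (by rw [sum_restrictWeights]; exact hApos.ne') x v
      (weightedMean (unitWeights S) x)
    have h2 : 0 ≤ (∑ i, cS i) *
        (inner ℝ v (weightedMean cS x - weightedMean (unitWeights S) x)) ^ 2 := by
      rw [sum_restrictWeights]; positivity
    have h3 := directionalVariance_le_lambdaMax (unitWeights S) x v
    rw [hv.1, directionalVariance, sum_unitWeights, inv_mul_le_iff₀ (by exact_mod_cast hS)] at h3
    have h4 : ∑ i, cS i * (inner ℝ v (x i - weightedMean (unitWeights S) x)) ^ 2 ≤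
        ∑ i, unitWeights S i * (inner ℝ v (x i - weightedMean (unitWeights S) x)) ^ 2 := by
      refine Finset.sum_le_sum fun i _ => mul_le_mul_of_nonneg_right ?_ (sq_nonneg _)
      rw [hcS, restrictWeights, unitWeights]
      split_ifs <;> simp [hc1]
    simp only [one_pow, mul_one] at h3
    linarith
  have htot : ∑ i, c i * score c x v i =
      ∑ i ∈ S, c i * score c x v i + ∑ i ∈ Sᶜ, c i * score c x v i :=
    (Finset.sum_add_sum_compl S _).symm
  have h5 : A * (inner ℝ v (weightedMean cS x - weightedMean c x)) ^ 2 ≤ B * lam := by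
    refine (mul_le_mul_of_nonneg_left hin hApos.le).trans (hsub.trans (le_of_eq ?_))
    ring
  -- This is (A + B) λ ≤ 2 (|S| λ_S + B λ), with the term 2 B λ moved to the left.
  linarith

end Bounds

/-- Here a is the lead of S minus its minimum N, so that F - a is the weight lost by S. The weighted
inequality (X + Y)² ≤ 5/3 X² + 5/2 Y² with B ≤ a gives N (X + Y)² ≤ 35/6 a r lam ≤ 6 a r lam.
Splitting off Z with weight 6r then makes the terms in a cancel against F - a, leaving (6r + 1) F
lam. -/
lemma robustness_arithmetic {N F r lam a B X Y Z : ℝ} (hN : 0 < N) (hr : 0 ≤ r)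
    (hlam : 0 ≤ lam) (hB : B ≤ a) (ha : a ≤ F) (ha0 : 0 ≤ a)
    (hX : N * X ^ 2 ≤ (a + B) * (r * lam)) (hY : N * Y ^ 2 ≤ B * (r * lam))
    (hZ : N * Z ^ 2 ≤ (F - a) * lam) :
    (X + Y + Z) ^ 2 ≤ 2 * F / N * (1 + 3 * r) * lam := by
  have hF : 0 ≤ F := ha0.trans ha
  have hrl : 0 ≤ r * lam := mul_nonneg hr hlam
  have h1 : (X + Y) ^ 2 ≤ 5 / 3 * X ^ 2 + 5 / 2 * Y ^ 2 := by nlinarith [sq_nonneg (2 * X - 3 * Y)]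
  have h2 : N * (X + Y) ^ 2 ≤ 6 * a * (r * lam) := by nlinarith
  have h3 : N * (X + Y + Z) ^ 2 ≤ (6 * r + 1) * F * lam := by
    -- The split with weight 6r divides by r; for r = 0 one has X + Y = 0 directly.
    rcases hr.eq_or_lt with h | h
    · subst h
      have : (X + Y) ^ 2 = 0 := by nlinarith [sq_nonneg (X + Y)]
      have h0 : X + Y = 0 := by simpa using this
      rw [h0]
      nlinarith
    · have h4 : 6 * r * (X + Y + Z) ^ 2 ≤ (6 * r + 1) * ((X + Y) ^ 2 + 6 * r * Z ^ 2) := by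
        nlinarith [sq_nonneg (X + Y - 6 * r * Z)]
      have h5 : N * ((X + Y) ^ 2 + 6 * r * Z ^ 2) ≤ 6 * r * (F * lam) := by nlinarith
      have h6 : 6 * r * (N * (X + Y + Z) ^ 2) ≤ 6 * r * ((6 * r + 1) * F * lam) := by
        calc 6 * r * (N * (X + Y + Z) ^ 2) = N * (6 * r * (X + Y + Z) ^ 2) := by ring
          _ ≤ N * ((6 * r + 1) * ((X + Y) ^ 2 + 6 * r * Z ^ 2)) :=
            mul_le_mul_of_nonneg_left h4 hN.le
          _ = (6 * r + 1) * (N * ((X + Y) ^ 2 + 6 * r * Z ^ 2)) := by ring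
          _ ≤ (6 * r + 1) * (6 * r * (F * lam)) :=
            mul_le_mul_of_nonneg_left h5 (by positivity)
          _ = _ := by ring
      exact le_of_mul_le_mul_left h6 (by positivity)
  rw [show 2 * F / N * (1 + 3 * r) * lam = (2 * F * (1 + 3 * r) * lam) / N by ring,
    le_div_iff₀ hN]
  nlinarith [mul_nonneg hF hlam]

theorem isRobustnessCoefficient_caf (d : ℕ) {n f : ℕ} (hf : 2 * f < n) :
    IsRobustnessCoefficient d n f
      (2 * f / ((n : ℝ) - 2 * f) * (1 + 6 * ((n : ℝ) - f) / ((n : ℝ) - 2 * f))) := by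
  have hfn : (2 : ℝ) * f < n := by exact_mod_cast hf
  have hf0 : (0 : ℝ) ≤ f := Nat.cast_nonneg f
  have hN : 0 < (n : ℝ) - 2 * f := by linarith
  have hnf : 0 < (n : ℝ) - f := by linarith
  refine ⟨by positivity, ?_⟩
  rintro x y ⟨c, v, k₀, h0, hv, hstep, hk₀, hmin, rfl⟩ S hS
  have := (hv 0).nontrivial
  obtain ⟨k, hinv, hhalf⟩ := exists_good_iterate (v := v) (x := x) h0 hstep hf hS
  have hcard : (S.card : ℝ) = n - f := by rw [hS, Nat.cast_sub (by omega)]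
  have hn := weights_nonneg h0 hstep
  have h1 : ∀ k i, c k i ≤ 1 := fun k i => by
    have := weights_antitone h0 hstep (Nat.zero_le k) i
    rwa [h0] at this
  set lamS := lambdaMax (weightedCov (unitWeights S) x) with hlamS
  have hlamS0 : 0 ≤ lamS := lambdaMax_weightedCov_nonneg
    (fun i => by rw [unitWeights]; split_ifs <;> simp) x
  set N := (n : ℝ) - 2 * f with hNdef
  set r := 2 * ((n : ℝ) - f) / N with hr
  have hr0 : 0 ≤ r := by positivity
  -- masses of an iterate that satisfies the invariant
  have hB0 : ∀ j, 0 ≤ ∑ i ∈ Sᶜ, c j i := fun j => Finset.sum_nonneg fun i _ => hn j i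
  have hAle : ∀ j, ∑ i ∈ S, c j i ≤ n - f := fun j => by
    rw [← hcard, ← nsmul_one]
    exact Finset.sum_le_card_nsmul _ _ _ fun i _ => h1 j i
  have hW : ∀ j, ∑ i, c j i = ∑ i ∈ S, c j i + ∑ i ∈ Sᶜ, c j i := fun j =>
    (Finset.sum_add_sum_compl S _).symm
  have hlamk : lambdaMax (weightedCov (c k) x) ≤ r * lamS := by
    have hk := hinv k le_rfl
    have := lambdaMax_mul_le (hv k) (hn k) (h1 k) (by linarith [hB0 k])
      (by rw [hS]; omega) hhalf
    have hl0 := lambdaMax_weightedCov_nonneg (hn k) x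
    rw [hr, div_mul_eq_mul_div, le_div_iff₀ hN, mul_comm]
    rw [hcard] at this
    refine le_trans (mul_le_mul_of_nonneg_right ?_ hl0) this
    linarith
  -- Iterate k still belongs to the loop, since its total weight is at least N; so the minimality of
  -- k₀ applies to it.
  have hlamk₀ : lambdaMax (weightedCov (c k₀) x) ≤ r * lamS := by
    refine (hmin k ?_).trans hlamk
    rw [hW]
    linarith [hinv k le_rfl, hB0 k]
  -- distance to the mean of `S` for an iterate that satisfies the invariant
  have hdist : ∀ j, N + ∑ i ∈ Sᶜ, c j i ≤ ∑ i ∈ S, c j i →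
      lambdaMax (weightedCov (c j) x) ≤ r * lamS →
      ∃ Y Z : ℝ,
        ‖weightedMean (c j) x - weightedMean (unitWeights S) x‖ ≤ Y + Z ∧
        N * Y ^ 2 ≤ (∑ i ∈ Sᶜ, c j i) * (r * lamS) ∧
        N * Z ^ 2 ≤ (f - (∑ i ∈ S, c j i - N)) * lamS := by
    intro j hj hl
    set cS := restrictWeights S (c j) with hcS
    have hcS0 : ∀ i, 0 ≤ cS i := fun i => by
      rw [hcS, restrictWeights]; split_ifs <;> simp [hn]
    have hApos : N ≤ ∑ i ∈ S, c j i := by linarith [hB0 j]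
    have hpos : 0 < ∑ i, cS i := by rw [sum_restrictWeights]; linarith
    have hY := sq_norm_weightedMean_sub_le (c := c j) (c' := cS) hcS0
      (fun i => by rw [hcS, restrictWeights]; split_ifs <;> simp [hn]) hpos x
    have hZ := sq_norm_weightedMean_sub_le (c := unitWeights S) (c' := cS) hcS0
      (fun i => by rw [hcS, restrictWeights, unitWeights]; split_ifs <;> simp [h1]) hpos x
    rw [sum_restrictWeights, hW] at hY
    rw [sum_restrictWeights, sum_unitWeights, hcard] at hZ
    refine ⟨‖weightedMean cS x - weightedMean (c j) x‖,
      ‖weightedMean cS x - weightedMean (unitWeights S) x‖, ?_, ?_, ?_⟩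
    · rw [show weightedMean (c j) x - weightedMean (unitWeights S) x =
        (weightedMean cS x - weightedMean (unitWeights S) x)
          - (weightedMean cS x - weightedMean (c j) x) by abel, add_comm]
      exact norm_sub_le _ _
    · refine (mul_le_mul_of_nonneg_right hApos (sq_nonneg _)).trans (hY.trans ?_)
      rw [add_sub_cancel_left]
      exact mul_le_mul_of_nonneg_left hl (hB0 j)
    · refine (mul_le_mul_of_nonneg_right hApos (sq_nonneg _)).trans (hZ.trans (le_of_eq ?_))
      rw [hNdef]
      ring
  have hgoal : 2 * (f : ℝ) / N * (1 + 6 * ((n : ℝ) - f) / N) * lamS =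
      2 * f / N * (1 + 3 * r) * lamS := by rw [hr]; ring
  rw [hgoal]
  -- If k₀ ≤ k, the invariant holds at k₀ and j = k₀ works with X = 0. Otherwise j = k: the loop is
  -- still running at k₀, so at most the excess of the weight of iterate k over N has been removed
  -- in between.
  obtain ⟨j, X, hjinv, hjl, hXd, hX⟩ : ∃ j X, N + ∑ i ∈ Sᶜ, c j i ≤ ∑ i ∈ S, c j i ∧
      lambdaMax (weightedCov (c j) x) ≤ r * lamS ∧
      ‖weightedMean (c k₀) x - weightedMean (c j) x‖ ≤ X ∧
      N * X ^ 2 ≤ ((∑ i ∈ S, c j i - N) + ∑ i ∈ Sᶜ, c j i) * (r * lamS) := by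
    rcases le_total k₀ k with hk | hk
    · refine ⟨k₀, 0, hinv k₀ hk, hlamk₀, by simp, ?_⟩
      rw [sq, mul_zero, mul_zero]
      exact mul_nonneg (by linarith [hinv k₀ hk, hB0 k₀]) (mul_nonneg hr0 hlamS0)
    · refine ⟨k, _, hinv k le_rfl, hlamk, le_rfl, ?_⟩
      have := sq_norm_weightedMean_sub_le (hn k₀) (weights_antitone h0 hstep hk)
        (hN.trans_le hk₀) x
      refine (mul_le_mul_of_nonneg_right hk₀ (sq_nonneg _)).trans (this.trans ?_)
      rw [hW k]
      refine mul_le_mul ?_ hlamk (lambdaMax_weightedCov_nonneg (hn k) x) ?_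
      · linarith
      · linarith [hinv k le_rfl, hB0 k]
  obtain ⟨Y, Z, hYZ, hY, hZ⟩ := hdist j hjinv hjl
  have htri : ‖weightedMean (c k₀) x - weightedMean (unitWeights S) x‖ ≤ X + Y + Z := by
    have := norm_sub_le_norm_sub_add_norm_sub (weightedMean (c k₀) x) (weightedMean (c j) x)
      (weightedMean (unitWeights S) x)
    linarith
  refine (pow_le_pow_left₀ (norm_nonneg _) htri 2).trans
    (robustness_arithmetic (a := ∑ i ∈ S, c j i - N) hN hr0 hlamS0 (by linarith) ?_
      (by linarith [hB0 j]) hX hY hZ)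
  linarith [hAle j]

end Filter

/-! ### Sampling without replacement -/

section Sampling

variable {d m : ℕ}

lemma sum_powersetCard_sum (b : ℕ) (hb : 1 ≤ b) (u : Fin m → E d) (hu : ∑ k, u k = 0) :
    ∑ B ∈ powersetCard b (univ : Finset (Fin m)), ∑ k ∈ B, u k = 0 := by
  have h1 : ∀ B ∈ powersetCard b (univ : Finset (Fin m)),
      ∑ k ∈ B, u k = ∑ k, if k ∈ B then u k else 0 := fun B _ => by
    rw [Finset.sum_ite_mem, Finset.univ_inter]
  rw [Finset.sum_congr rfl h1, Finset.sum_comm]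
  have h2 : ∀ k : Fin m, ∑ B ∈ powersetCard b (univ : Finset (Fin m)),
      (if k ∈ B then u k else 0) = (m - 1).choose (b - 1) • u k := fun k => by
    rw [← Finset.sum_filter, Finset.sum_const]
    congr 1
    have := card_filter_powersetCard_subset ({k} : Finset (Fin m)) univ b (by simp) (by simpa)
    simpa using this
  rw [Finset.sum_congr rfl fun k _ => h2 k, ← Finset.smul_sum, hu, smul_zero]

/-- A point lies in C(m-1, b-1) of the sets and a pair of distinct points in C(m-2, b-2). Completing
the off-diagonal part to ‖∑ u‖² = 0 leaves the difference of the two counts on the diagonal. -/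
lemma sum_powersetCard_sq_norm_sum (b : ℕ) (hb : 2 ≤ b) (u : Fin m → E d)
    (hu : ∑ k, u k = 0) :
    ∑ B ∈ powersetCard b (univ : Finset (Fin m)), ‖∑ k ∈ B, u k‖ ^ 2 =
      (((m - 1).choose (b - 1) : ℝ) - (m - 2).choose (b - 2)) * ∑ k, ‖u k‖ ^ 2 := by
  have h1 : ∀ B ∈ powersetCard b (univ : Finset (Fin m)),
      ‖∑ k ∈ B, u k‖ ^ 2 = ∑ k, ∑ l, if k ∈ B ∧ l ∈ B then inner ℝ (u k) (u l) else 0 :=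
    fun B _ => by
      have : ∑ k ∈ B, u k = ∑ k, if k ∈ B then u k else 0 := by
        rw [Finset.sum_ite_mem, Finset.univ_inter]
      rw [this, ← real_inner_self_eq_norm_sq, sum_inner]
      refine Finset.sum_congr rfl fun k _ => ?_
      rw [inner_sum]
      refine Finset.sum_congr rfl fun l _ => ?_
      by_cases h : k ∈ B <;> by_cases h' : l ∈ B <;> simp [h, h']
  rw [Finset.sum_congr rfl h1, Finset.sum_comm]
  set n1 : ℝ := ((Nat.choose (m - 1) (b - 1) : ℕ) : ℝ)
  set n2 : ℝ := ((Nat.choose (m - 2) (b - 2) : ℕ) : ℝ)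
  have h2 : ∀ k : Fin m, ∑ B ∈ powersetCard b (univ : Finset (Fin m)),
      ∑ l, (if k ∈ B ∧ l ∈ B then inner ℝ (u k) (u l) else 0)
        = ∑ l, ((if k = l then (n1 - n2) * ‖u k‖ ^ 2 else 0) + n2 * inner ℝ (u k) (u l)) := by
    intro k
    rw [Finset.sum_comm]
    refine Finset.sum_congr rfl fun l _ => ?_
    rw [← Finset.sum_filter, Finset.sum_const, nsmul_eq_mul]
    have h3 := card_filter_powersetCard_subset ({k, l} : Finset (Fin m)) univ b (by simp)
      ((Finset.card_le_two).trans hb)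
    simp only [Finset.insert_subset_iff, Finset.singleton_subset_iff, Finset.card_univ,
      Fintype.card_fin] at h3
    rw [h3]
    by_cases hkl : k = l
    · subst hkl
      simp only [Finset.pair_eq_singleton, Finset.card_singleton, if_true,
        real_inner_self_eq_norm_sq]
      ring
    · rw [Finset.card_pair hkl, if_neg hkl, zero_add]
  rw [Finset.sum_congr rfl fun k _ => h2 k]
  simp only [Finset.sum_add_distrib, Finset.sum_ite_eq, Finset.mem_univ, if_true,
    ← Finset.mul_sum, ← inner_sum, hu, inner_zero_right, mul_zero, add_zero]

/-- Variance of the mean of a uniform sample without replacement. -/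
lemma sum_powersetCard_sq_norm_mean_le {b : ℕ} (hb : 1 ≤ b) (hbm : b ≤ m) (u : Fin m → E d)
    (hu : ∑ k, u k = 0) {s : ℝ} (hs : (m : ℝ)⁻¹ * ∑ k, ‖u k‖ ^ 2 ≤ s ^ 2) :
    (m.choose b : ℝ)⁻¹ * ∑ B ∈ powersetCard b (univ : Finset (Fin m)),
      ‖(b : ℝ)⁻¹ • ∑ k ∈ B, u k‖ ^ 2 ≤ batchVariance m b s := by
  have hm : (0 : ℝ) < m := by exact_mod_cast (show 0 < m by omega)
  have hb' : (0 : ℝ) < b := by exact_mod_cast (show 0 < b by omega)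
  have hbm' : (b : ℝ) ≤ m := by exact_mod_cast hbm
  have hch : (0 : ℝ) < m.choose b := by exact_mod_cast Nat.choose_pos hbm
  have hs' : ∑ k, ‖u k‖ ^ 2 ≤ m * s ^ 2 := by rwa [inv_mul_le_iff₀ hm] at hs
  have hs0 : 0 ≤ ∑ k, ‖u k‖ ^ 2 := Finset.sum_nonneg fun _ _ => sq_nonneg _
  have hbv : 0 ≤ batchVariance m b s := by
    have : (b : ℝ) / m ≤ 1 := div_le_one_of_le₀ hbm' hm.le
    rw [batchVariance]
    have : 0 ≤ 1 - (b : ℝ) / m := by linarith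
    positivity
  simp only [norm_smul, mul_pow, ← Finset.mul_sum, norm_inv, Real.norm_natCast]
  -- the second moment in terms of `∑ ‖u k‖²`
  have key : m * (m - 1) * ∑ B ∈ powersetCard b (univ : Finset (Fin m)), ‖∑ k ∈ B, u k‖ ^ 2 =
      m.choose b * (b * (m - b)) * ∑ k, ‖u k‖ ^ 2 := by
    -- For b = 1 the natural subtraction b - 2 truncates, so this case is computed by hand.
    rcases (show b = 1 ∨ 2 ≤ b by omega) with rfl | hb2
    · have : ∑ B ∈ powersetCard 1 (univ : Finset (Fin m)), ‖∑ k ∈ B, u k‖ ^ 2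
          = ∑ k, ‖u k‖ ^ 2 := by
        simp [Finset.powersetCard_one]
      rw [this, Nat.choose_one_right]
      push_cast
      ring
    · rw [sum_powersetCard_sq_norm_sum b hb2 u hu]
      obtain ⟨b', rfl⟩ : ∃ b', b = b' + 2 := ⟨b - 2, by omega⟩
      obtain ⟨m', rfl⟩ : ∃ m', m = m' + 2 := ⟨m - 2, by omega⟩
      have e1 : ((m' + 2 : ℕ) : ℝ) * (m' + 1).choose (b' + 1)
          = (m' + 2).choose (b' + 2) * (b' + 2 : ℕ) := by
        exact_mod_cast Nat.add_one_mul_choose_eq (m' + 1) (b' + 1)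
      have e2 : ((m' + 1 : ℕ) : ℝ) * m'.choose b' = (m' + 1).choose (b' + 1) * (b' + 1 : ℕ) := by
        exact_mod_cast Nat.add_one_mul_choose_eq m' b'
      simp only [show m' + 2 - 1 = m' + 1 by omega, show b' + 2 - 1 = b' + 1 by omega,
        show m' + 2 - 2 = m' by omega, show b' + 2 - 2 = b' by omega]
      push_cast at e1 e2 ⊢
      linear_combination (∑ k, ‖u k‖ ^ 2) * ((m' - b' : ℝ) * e1 - (m' + 2 : ℝ) * e2)
  -- For m = 1 the identity `key` reads 0 = 0; but then the only vector u 0 vanishes.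
  rcases (show m = 1 ∨ 2 ≤ m by omega) with rfl | hm2
  · obtain rfl : b = 1 := by omega
    have h0 : u 0 = 0 := by simpa using hu
    have : ∑ B ∈ powersetCard 1 (univ : Finset (Fin 1)), ‖∑ k ∈ B, u k‖ ^ 2 = 0 := by
      simp [Finset.powersetCard_one, h0]
    rw [this]
    simpa using hbv
  have hm2' : (2 : ℝ) ≤ m := by exact_mod_cast hm2
  set Q := ∑ B ∈ powersetCard b (univ : Finset (Fin m)), ‖∑ k ∈ B, u k‖ ^ 2
  have hQ : (m.choose b : ℝ)⁻¹ * Q = b * (m - b) / (m * (m - 1)) * ∑ k, ‖u k‖ ^ 2 := by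
    have : (m : ℝ) - 1 ≠ 0 := by linarith
    field_simp
    linear_combination key
  -- The exact variance has m - 1 in the denominator; m - 1 ≥ m / 2 is the origin of the factor 2 in
  -- σ_b².
  have h3 : (b : ℝ) * (m - b) / (m * (m - 1)) * ∑ k, ‖u k‖ ^ 2 ≤
      b * (m - b) / (m * (m / 2)) * (m * s ^ 2) := by
    have : (0 : ℝ) ≤ m - b := by linarith
    refine mul_le_mul (div_le_div_of_nonneg_left (by positivity) (by positivity) ?_) hs' hs0
      (by positivity)
    exact mul_le_mul_of_nonneg_left (by linarith) hm.le
  calc (m.choose b : ℝ)⁻¹ * ((b : ℝ)⁻¹ ^ 2 * Q) = (b : ℝ)⁻¹ ^ 2 * ((m.choose b : ℝ)⁻¹ * Q) := by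
        ring
    _ ≤ (b : ℝ)⁻¹ ^ 2 * (b * (m - b) / (m * (m / 2)) * (m * s ^ 2)) := by
        rw [hQ]; exact mul_le_mul_of_nonneg_left h3 (by positivity)
    _ = batchVariance m b s := by
        rw [batchVariance]
        field_simp

end Sampling

/-! ### Smooth functions -/

section Smooth

variable {d : ℕ} {F : E d → ℝ} {L : ℝ}

/-- Along the segment from θ to η, the derivative of the difference φ between the function and its
quadratic model is nonpositive by the Lipschitz bound and Cauchy–Schwarz. -/
lemma IsSmooth.descent (hF : Differentiable ℝ F) (h : IsSmooth L F) (θ η : E d) :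
    F η ≤ F θ + inner ℝ (∇ F θ) (η - θ) + L / 2 * ‖η - θ‖ ^ 2 := by
  set w := η - θ with hw
  let φ : ℝ → ℝ := fun s => F (θ + s • w) - s * inner ℝ (∇ F θ) w - L / 2 * s ^ 2 * ‖w‖ ^ 2
  have hd : ∀ s : ℝ, HasDerivAt φ
      (inner ℝ (∇ F (θ + s • w) - ∇ F θ) w - L * s * ‖w‖ ^ 2) s := by
    intro s
    have h1 : HasDerivAt (fun s : ℝ => θ + s • w) w s := by
      simpa using ((hasDerivAt_id s).smul_const w).const_add θ
    have h2 : HasDerivAt (fun s : ℝ => F (θ + s • w)) (inner ℝ (∇ F (θ + s • w)) w) s := by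
      have := ((hF (θ + s • w)).hasFDerivAt).comp_hasDerivAt s h1
      rwa [← inner_gradient_left] at this
    have h3 := (h2.sub ((hasDerivAt_id s).mul_const (inner ℝ (∇ F θ) w))).sub
      ((((hasDerivAt_id s).pow 2).const_mul (L / 2)).mul_const (‖w‖ ^ 2))
    convert! h3 using 1
    rw [inner_sub_left]
    simp only [id_eq, Nat.reduceSub, pow_one, Nat.cast_ofNat]
    ring
  have hanti : AntitoneOn φ (Set.Icc 0 1) := by
    refine antitoneOn_of_deriv_nonpos (convex_Icc 0 1)
      (fun s _ => (hd s).continuousAt.continuousWithinAt)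
      (fun s _ => (hd s).differentiableAt.differentiableWithinAt) fun s hs => ?_
    rw [interior_Icc] at hs
    rw [(hd s).deriv, sub_nonpos]
    have h1 := h θ (θ + s • w)
    rw [add_sub_cancel_left, norm_smul, Real.norm_of_nonneg hs.1.le] at h1
    calc inner ℝ (∇ F (θ + s • w) - ∇ F θ) w ≤ ‖∇ F (θ + s • w) - ∇ F θ‖ * ‖w‖ :=
          real_inner_le_norm _ _
      _ ≤ L * (s * ‖w‖) * ‖w‖ := mul_le_mul_of_nonneg_right h1 (norm_nonneg _)
      _ = L * s * ‖w‖ ^ 2 := by ring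
  have := hanti (by simp) (by simp) zero_le_one
  simp only [φ, zero_smul, add_zero, one_smul, hw, add_sub_cancel] at this
  rw [hw]
  linarith

/-- A gradient step of length 1/L lowers F by at least ‖∇F‖²/(2L), and cannot go below the infimum.
-/
lemma IsSmooth.sq_norm_gradient_le (hL : 0 < L) (hF : Differentiable ℝ F) (h : IsSmooth L F)
    (hbdd : BddBelow (Set.range F)) (θ : E d) : ‖∇ F θ‖ ^ 2 ≤ 2 * L * (F θ - ⨅ η, F η) := by
  have h1 := h.descent hF θ (θ - L⁻¹ • ∇ F θ)
  have h2 := ciInf_le hbdd (θ - L⁻¹ • ∇ F θ)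
  rw [sub_sub_cancel_left, inner_neg_right, real_inner_smul_right, real_inner_self_eq_norm_sq,
    norm_neg, norm_smul, norm_inv, Real.norm_of_nonneg hL.le] at h1
  have h3 : L / 2 * (L⁻¹ * ‖∇ F θ‖) ^ 2 = L⁻¹ * ‖∇ F θ‖ ^ 2 / 2 := by field_simp
  rw [h3] at h1
  have h4 : L⁻¹ * ‖∇ F θ‖ ^ 2 ≤ 2 * (F θ - ⨅ η, F η) := by linarith
  rw [inv_mul_le_iff₀ hL] at h4
  linarith

/-- Minimizing the strongly convex quadratic lower bound over η gives this value. It yields both the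
lower bound on F and the Polyak–Łojasiewicz inequality. -/
lemma IsStronglyConvex.sub_le {μ : ℝ} (hμ : 0 < μ) (h : IsStronglyConvex μ F) (θ η : E d) :
    F θ - ‖∇ F θ‖ ^ 2 / (2 * μ) ≤ F η := by
  have h1 := h θ η
  have h2 : -(‖∇ F θ‖ * ‖η - θ‖) ≤ inner ℝ (∇ F θ) (η - θ) :=
    (abs_le.1 (abs_real_inner_le_norm _ _)).1
  have h3 : F θ - F η ≤ ‖∇ F θ‖ ^ 2 / (2 * μ) := by
    rw [le_div_iff₀ (by positivity)]
    nlinarith [sq_nonneg (μ * ‖η - θ‖ - ‖∇ F θ‖)]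
  linarith

lemma IsStronglyConvex.bddBelow {μ : ℝ} (hμ : 0 < μ) (h : IsStronglyConvex μ F) :
    BddBelow (Set.range F) :=
  ⟨F 0 - ‖∇ F 0‖ ^ 2 / (2 * μ), by rintro _ ⟨η, rfl⟩; exact h.sub_le hμ 0 η⟩

lemma IsStronglyConvex.le_sq_norm_gradient {μ : ℝ} (hμ : 0 < μ) (h : IsStronglyConvex μ F)
    (θ : E d) : 2 * μ * (F θ - ⨅ η, F η) ≤ ‖∇ F θ‖ ^ 2 := by
  have h1 := le_ciInf fun η => h.sub_le hμ θ η
  have h2 : F θ - (⨅ η, F η) ≤ ‖∇ F θ‖ ^ 2 / (2 * μ) := by linarith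
  rwa [le_div_iff₀ (by positivity), mul_comm] at h2

/-- At two distinct points the quadratic lower bound cannot exceed the quadratic upper bound; a
second point exists only for d ≥ 1. -/
lemma IsStronglyConvex.le_of_isSmooth [Nontrivial (E d)] {μ : ℝ} (hF : Differentiable ℝ F)
    (h : IsStronglyConvex μ F) (hs : IsSmooth L F) : μ ≤ L := by
  obtain ⟨w, hw⟩ := exists_ne (0 : E d)
  have h1 := h 0 w
  have h2 := hs.descent hF 0 w
  rw [sub_zero] at h1 h2
  have h3 : μ * ‖w‖ ^ 2 ≤ L * ‖w‖ ^ 2 := by linarith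
  exact le_of_mul_le_mul_right h3 (by positivity)

end Smooth

/-! ### Gradients of the losses -/

section Losses

variable {X : Type*} {d n m : ℕ} {ℓ : E d → X → ℝ} {D : Fin n → Fin m → X} {H : Finset (Fin n)}

lemma hasGradientAt_const_mul_sum {ι : Type*} {s : Finset ι} {F : ι → E d → ℝ} {g : ι → E d}
    {θ : E d} (a : ℝ) (h : ∀ i ∈ s, HasGradientAt (F i) (g i) θ) :
    HasGradientAt (fun η => a * ∑ i ∈ s, F i η) (a • ∑ i ∈ s, g i) θ := by
  rw [hasGradientAt_iff_hasFDerivAt, map_smul, map_sum]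
  exact (HasFDerivAt.fun_sum fun i hi => (h i hi).hasFDerivAt).const_mul a

lemma hasGradientAt_localLoss (hℓ : ∀ x, Differentiable ℝ fun θ => ℓ θ x) (i : Fin n) (θ : E d) :
    HasGradientAt (localLoss ℓ D i) ((m : ℝ)⁻¹ • ∑ k, gradAt ℓ θ (D i k)) θ :=
  hasGradientAt_const_mul_sum _ fun k _ => (hℓ (D i k) θ).hasGradientAt

lemma hasGradientAt_honestLoss (hℓ : ∀ x, Differentiable ℝ fun θ => ℓ θ x) (θ : E d) :
    HasGradientAt (honestLoss ℓ D H) ((H.card : ℝ)⁻¹ • ∑ i ∈ H, ∇ (localLoss ℓ D i) θ) θ :=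
  hasGradientAt_const_mul_sum _ fun i _ =>
    (hasGradientAt_localLoss hℓ i θ).differentiableAt.hasGradientAt

lemma differentiable_honestLoss (hℓ : ∀ x, Differentiable ℝ fun θ => ℓ θ x) :
    Differentiable ℝ (honestLoss ℓ D H) := fun θ =>
  (hasGradientAt_honestLoss hℓ θ).differentiableAt

lemma measurable_gradient (F : E d → ℝ) : Measurable (∇ F) :=
  ((InnerProductSpace.toDual ℝ (E d)).symm.continuous.measurable).comp (measurable_fderiv ℝ F)

lemma sum_gradAt_sub (hm : m ≠ 0) (hℓ : ∀ x, Differentiable ℝ fun θ => ℓ θ x) (i : Fin n)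
    (θ : E d) : ∑ k, (gradAt ℓ θ (D i k) - ∇ (localLoss ℓ D i) θ) = 0 := by
  rw [Finset.sum_sub_distrib, (hasGradientAt_localLoss hℓ i θ).gradient, Finset.sum_const,
    Finset.card_univ, Fintype.card_fin, ← Nat.cast_smul_eq_nsmul ℝ, smul_smul,
    mul_inv_cancel₀ (by exact_mod_cast hm), one_smul, sub_self]

lemma sum_gradient_sub (hH : H.card ≠ 0) (hℓ : ∀ x, Differentiable ℝ fun θ => ℓ θ x) (θ : E d) :
    ∑ i ∈ H, (∇ (localLoss ℓ D i) θ - ∇ (honestLoss ℓ D H) θ) = 0 := by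
  rw [Finset.sum_sub_distrib, (hasGradientAt_honestLoss hℓ θ).gradient, Finset.sum_const,
    ← Nat.cast_smul_eq_nsmul ℝ, smul_smul, mul_inv_cancel₀ (by exact_mod_cast hH), one_smul,
    sub_self]

/-- Deviation of the mini-batch gradient from the local gradient. -/
noncomputable def batchError (ℓ : E d → X → ℝ) (D : Fin n → Fin m → X) (C : ℝ≥0∞) (i : Fin n)
    (θ : E d) (B : Finset (Fin m)) : E d :=
  batchGrad ℓ D C i θ B - ∇ (localLoss ℓ D i) θ

lemma clip_gradAt {C : ℝ≥0∞} (hC : BoundedGradients ℓ D H C) {i : Fin n} (hi : i ∈ H) (θ : E d)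
    (k : Fin m) : clip C (gradAt ℓ θ (D i k)) = gradAt ℓ θ (D i k) :=
  if_pos (hC θ i hi k)

lemma batchError_eq {C : ℝ≥0∞} (hC : BoundedGradients ℓ D H C) {i : Fin n} (hi : i ∈ H) (θ : E d)
    {B : Finset (Fin m)} (hB : B.card ≠ 0) :
    batchError ℓ D C i θ B =
      (B.card : ℝ)⁻¹ • ∑ k ∈ B, (gradAt ℓ θ (D i k) - ∇ (localLoss ℓ D i) θ) := by
  rw [Finset.sum_sub_distrib, Finset.sum_const, ← Nat.cast_smul_eq_nsmul ℝ, smul_sub, smul_smul,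
    inv_mul_cancel₀ (by exact_mod_cast hB), one_smul, batchError, batchGrad]
  simp only [clip_gradAt hC hi]

lemma measurable_batchError {C : ℝ≥0∞} (hC : BoundedGradients ℓ D H C) {i : Fin n} (hi : i ∈ H)
    (B : Finset (Fin m)) : Measurable fun θ => batchError ℓ D C i θ B := by
  have : (fun θ => batchError ℓ D C i θ B) = fun θ =>
      (B.card : ℝ)⁻¹ • ∑ k ∈ B, ∇ (fun η => ℓ η (D i k)) θ - ∇ (localLoss ℓ D i) θ := by
    ext1 θ
    simp only [batchError, batchGrad, clip_gradAt hC hi]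
    rfl
  rw [this]
  have h : Measurable fun θ => ∑ k ∈ B, ∇ (fun η => ℓ η (D i k)) θ :=
    Finset.measurable_fun_sum _ fun k _ => measurable_gradient _
  exact (h.const_smul ((B.card : ℝ)⁻¹)).sub (measurable_gradient _)

lemma sum_batchError_eq_zero {C : ℝ≥0∞} (hC : BoundedGradients ℓ D H C) {i : Fin n} (hi : i ∈ H)
    (hℓ : ∀ x, Differentiable ℝ fun θ => ℓ θ x) {b : ℕ} (hb : 1 ≤ b) (hbm : b ≤ m) (θ : E d) :
    ∑ B ∈ powersetCard b (univ : Finset (Fin m)), batchError ℓ D C i θ B = 0 := by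
  have h1 : ∀ B ∈ powersetCard b (univ : Finset (Fin m)), batchError ℓ D C i θ B =
      (b : ℝ)⁻¹ • ∑ k ∈ B, (gradAt ℓ θ (D i k) - ∇ (localLoss ℓ D i) θ) := fun B hB => by
    have hB' := (Finset.mem_powersetCard.1 hB).2
    rw [batchError_eq hC hi θ (by omega), hB']
  rw [Finset.sum_congr rfl h1, ← Finset.smul_sum, sum_powersetCard_sum b hb _
    (sum_gradAt_sub (by omega) hℓ i θ), smul_zero]

lemma sum_sq_norm_batchError_le {C : ℝ≥0∞} (hC : BoundedGradients ℓ D H C) {σ : ℝ}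
    (hσ : BoundedVariance ℓ D H σ) {i : Fin n} (hi : i ∈ H)
    (hℓ : ∀ x, Differentiable ℝ fun θ => ℓ θ x) {b : ℕ} (hb : 1 ≤ b) (hbm : b ≤ m) (θ : E d) :
    (m.choose b : ℝ)⁻¹ * ∑ B ∈ powersetCard b (univ : Finset (Fin m)),
      ‖batchError ℓ D C i θ B‖ ^ 2 ≤ batchVariance m b σ := by
  have h1 : ∀ B ∈ powersetCard b (univ : Finset (Fin m)), ‖batchError ℓ D C i θ B‖ ^ 2 =
      ‖(b : ℝ)⁻¹ • ∑ k ∈ B, (gradAt ℓ θ (D i k) - ∇ (localLoss ℓ D i) θ)‖ ^ 2 := fun B hB => by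
    have hB' := (Finset.mem_powersetCard.1 hB).2
    rw [batchError_eq hC hi θ (by omega), hB']
  rw [Finset.sum_congr rfl h1]
  exact sum_powersetCard_sq_norm_mean_le hb hbm _ (sum_gradAt_sub (by omega) hℓ i θ) (hσ i hi θ)

/-- One term of the average over all batches is at most the whole sum. The bound is crude but
uniform in θ, so the errors are square-integrable whatever the law of the iterate. -/
lemma sq_norm_batchError_le {C : ℝ≥0∞} (hC : BoundedGradients ℓ D H C) {σ : ℝ}
    (hσ : BoundedVariance ℓ D H σ) {i : Fin n} (hi : i ∈ H)
    (hℓ : ∀ x, Differentiable ℝ fun θ => ℓ θ x) {b : ℕ} (hb : 1 ≤ b) (hbm : b ≤ m) (θ : E d)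
    {B : Finset (Fin m)} (hB : B.card = b) :
    ‖batchError ℓ D C i θ B‖ ^ 2 ≤ m.choose b * batchVariance m b σ := by
  have h := sum_sq_norm_batchError_le hC hσ hi hℓ hb hbm θ
  rw [inv_mul_le_iff₀ (by exact_mod_cast Nat.choose_pos hbm)] at h
  refine le_trans ?_ h
  exact Finset.single_le_sum (f := fun B => ‖batchError ℓ D C i θ B‖ ^ 2)
    (fun _ _ => sq_nonneg _) (Finset.mem_powersetCard.2 ⟨Finset.subset_univ _, hB⟩)

end Losses

/-! ### The operator norm of a matrix with sub-Gaussian columns -/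

section OperatorNorm

lemma integral_exp_sq_gaussianReal :
    ∫ x, Real.exp (x ^ 2 / 4) ∂(gaussianReal 0 1) = √2 := by
  rw [integral_gaussianReal_eq_integral_smul one_ne_zero]
  have h : ∀ x : ℝ, gaussianPDFReal 0 1 x • Real.exp (x ^ 2 / 4) =
      (√(2 * Real.pi))⁻¹ * Real.exp (-(1 / 4) * x ^ 2) := by
    intro x
    rw [gaussianPDFReal, smul_eq_mul, mul_assoc, ← Real.exp_add]
    simp only [NNReal.coe_one, mul_one, sub_zero]
    congr 2
    ring
  simp only [h]
  rw [integral_const_mul, integral_gaussian, ← Real.sqrt_inv, ← Real.sqrt_mul (by positivity)]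
  congr 1
  have := Real.pi_pos.ne'
  field_simp
  norm_num

lemma lintegral_pi_prod_ofReal {ι : Type*} [Fintype ι] {μ : Measure ℝ} [IsProbabilityMeasure μ]
    {f : ι → ℝ → ℝ} (hf : ∀ i, Integrable (f i) μ) (hf0 : ∀ i x, 0 ≤ f i x) :
    ∫⁻ g, ENNReal.ofReal (∏ i, f i (g i)) ∂(Measure.pi fun _ : ι => μ) =
      ENNReal.ofReal (∏ i, ∫ x, f i x ∂μ) := by
  rw [← integral_fintype_prod_eq_prod (μ := fun _ => μ), ofReal_integral_eq_lintegral_ofReal]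
  · exact Integrable.fintype_prod hf
  · exact Filter.Eventually.of_forall fun g => Finset.prod_nonneg fun i _ => hf0 i _

variable {Ω : Type*} [MeasurableSpace Ω] {P : Measure Ω} [IsProbabilityMeasure P] {d : ℕ}
  {ι : Type*} [Fintype ι] {N : ι → Ω → E d} {s : ℝ}

/-- The vectors `N i` are jointly sub-Gaussian with variance proxy `s`. -/
def JointlySubGaussian (N : ι → Ω → E d) (s : ℝ) (P : Measure Ω) : Prop :=
  ∀ a : ι → E d, ∫⁻ ω, ENNReal.ofReal (Real.exp (∑ i, inner ℝ (a i) (N i ω))) ∂P ≤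
    ENNReal.ofReal (Real.exp (s / 2 * ∑ i, ‖a i‖ ^ 2))

/-- The square in the exponent is linearized by auxiliary standard Gaussians: with r² = 1/(2s),
exp(q²/(4s)) is the mean of exp(r g q). After swapping the integrals, the sub-Gaussian bound at the
vectors r gᵢ v leaves ∏ exp(gᵢ²/4), whose factors have mean √2. -/
lemma JointlySubGaussian.lintegral_exp_sum_sq_le (hN : ∀ i, Measurable (N i))
    (hs : 0 < s) (h : JointlySubGaussian N s P) {v : E d} (hv : ‖v‖ ≤ 1) :
    ∫⁻ ω, ENNReal.ofReal (Real.exp (1 / (4 * s) * ∑ i, (inner ℝ v (N i ω)) ^ 2)) ∂P ≤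
      ENNReal.ofReal (√2 ^ Fintype.card ι) := by
  set r : ℝ := √(1 / (2 * s)) with hr
  have hr2 : r ^ 2 = 1 / (2 * s) := Real.sq_sqrt (by positivity)
  set γ : Measure (ι → ℝ) := Measure.pi fun _ => gaussianReal 0 1 with hγ
  have h1 : ∀ ω, ENNReal.ofReal (Real.exp (1 / (4 * s) * ∑ i, (inner ℝ v (N i ω)) ^ 2)) =
      ∫⁻ g, ENNReal.ofReal (Real.exp (∑ i, inner ℝ ((r * g i) • v) (N i ω))) ∂γ := by
    intro ω
    have e1 : ∀ g : ι → ℝ, Real.exp (∑ i, inner ℝ ((r * g i) • v) (N i ω)) =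
        ∏ i, Real.exp (r * inner ℝ v (N i ω) * g i) := fun g => by
      rw [Real.exp_sum]
      refine Finset.prod_congr rfl fun i _ => ?_
      rw [real_inner_smul_left]
      congr 1
      ring
    simp only [e1]
    rw [hγ, lintegral_pi_prod_ofReal (f := fun i x => Real.exp (r * inner ℝ v (N i ω) * x))
      (fun i => integrable_exp_mul_gaussianReal _) (fun i x => (Real.exp_pos _).le)]
    congr 1
    rw [Finset.mul_sum, Real.exp_sum]
    refine Finset.prod_congr rfl fun i _ => ?_
    have := congrFun (mgf_fun_id_gaussianReal (μ := 0) (v := 1)) (r * inner ℝ v (N i ω))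
    rw [mgf] at this
    rw [this, mul_pow, hr2]
    congr 1
    simp only [NNReal.coe_one]
    field_simp
    ring
  have hmeas : Measurable fun p : Ω × (ι → ℝ) =>
      ENNReal.ofReal (Real.exp (∑ i, inner ℝ ((r * p.2 i) • v) (N i p.1))) := by
    refine ENNReal.measurable_ofReal.comp (Real.measurable_exp.comp ?_)
    refine Finset.measurable_fun_sum _ fun i _ => ?_
    refine Measurable.inner ?_ ((hN i).comp measurable_fst)
    fun_prop
  simp only [h1]
  rw [lintegral_lintegral_swap hmeas.aemeasurable]
  calc ∫⁻ g, ∫⁻ ω, ENNReal.ofReal (Real.exp (∑ i, inner ℝ ((r * g i) • v) (N i ω))) ∂P ∂γ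
      ≤ ∫⁻ g, ENNReal.ofReal (∏ i, Real.exp ((g i) ^ 2 / 4)) ∂γ := by
        refine lintegral_mono fun g => (h _).trans (ENNReal.ofReal_le_ofReal ?_)
        rw [← Real.exp_sum, Finset.mul_sum]
        refine Real.exp_le_exp.2 (Finset.sum_le_sum fun i _ => ?_)
        rw [norm_smul, mul_pow, Real.norm_eq_abs, sq_abs, mul_pow, hr2]
        have hv2 : ‖v‖ ^ 2 ≤ 1 := pow_le_one₀ (norm_nonneg v) hv
        calc s / 2 * (1 / (2 * s) * g i ^ 2 * ‖v‖ ^ 2) = g i ^ 2 / 4 * ‖v‖ ^ 2 := by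
              field_simp; ring
          _ ≤ g i ^ 2 / 4 := mul_le_of_le_one_right (by positivity) hv2
    _ = ENNReal.ofReal (√2 ^ Fintype.card ι) := by
        rw [hγ, lintegral_pi_prod_ofReal (f := fun _ x => Real.exp (x ^ 2 / 4))]
        · simp [integral_exp_sq_gaussianReal]
        · refine fun _ => Integrable.of_integral_ne_zero ?_
          rw [integral_exp_sq_gaussianReal]
          positivity
        · exact fun _ _ => (Real.exp_pos _).le

/-- Averaging over a ball dominates the value of an exponential of a quadratic form at a smaller
radius, by symmetrization around that point. -/
lemma exp_mul_volume_ball_le (t : ℝ) (ht : 0 ≤ t) (y : ι → E d) {u : E d} (hu : ‖u‖ = 1) :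
    ENNReal.ofReal (Real.exp (t / 4 * ∑ i, (inner ℝ u (y i)) ^ 2))
        * volume (Metric.ball (0 : E d) (1 / 2)) ≤
      ∫⁻ v in Metric.ball (0 : E d) 1,
        ENNReal.ofReal (Real.exp (t * ∑ i, (inner ℝ v (y i)) ^ 2)) := by
  set e : E d → ℝ≥0∞ := fun v => ENNReal.ofReal (Real.exp (t * ∑ i, (inner ℝ v (y i)) ^ 2)) with he
  set c : E d := (1 / 2 : ℝ) • u with hc
  have hcn : ‖c‖ = 1 / 2 := by rw [hc, norm_smul, hu]; norm_num
  set Bh := Metric.ball (0 : E d) (1 / 2) with hBh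
  have hem : Measurable e := by
    rw [he]
    refine ENNReal.measurable_ofReal.comp (Real.measurable_exp.comp ?_)
    fun_prop
  have h1 : ∫⁻ w in Bh, e (c + w) ≤ ∫⁻ v in Metric.ball (0 : E d) 1, e v := by
    have hp := (measurePreserving_add_left (volume : Measure (E d)) c).setLIntegral_comp_preimage
      (s := Metric.ball c (1 / 2)) measurableSet_ball hem
    have hpre : (fun w => c + w) ⁻¹' Metric.ball c (1 / 2) = Bh := by
      ext w; simp [hBh]
    rw [hpre] at hp
    rw [hp]
    refine lintegral_mono_set ?_
    refine Metric.ball_subset_ball' ?_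
    rw [dist_zero_right, hcn]
    norm_num
  have h2 : ∫⁻ w in Bh, e (c - w) = ∫⁻ w in Bh, e (c + w) := by
    have hp := (Measure.measurePreserving_neg (volume : Measure (E d))).setLIntegral_comp_preimage
      (s := Bh) measurableSet_ball (f := fun w => e (c + w)) (by fun_prop)
    have hpre : (Neg.neg : E d → E d) ⁻¹' Bh = Bh := by
      ext w; simp [hBh]
    rw [hpre] at hp
    simpa only [sub_eq_add_neg] using hp
  -- For a quadratic form p, the mean of p(c + w) and p(c - w) is p(c) + p(w) ≥ p(u)/4, because the
  -- mixed terms cancel. Convexity of exp does the rest.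
  have h3 : ∀ w, 2 * ENNReal.ofReal (Real.exp (t / 4 * ∑ i, (inner ℝ u (y i)) ^ 2)) ≤
      e (c + w) + e (c - w) := by
    intro w
    simp only [he]
    have htwo : ∀ a : ℝ, 2 * ENNReal.ofReal a = ENNReal.ofReal (2 * a) := fun a => by
      rw [ENNReal.ofReal_mul zero_le_two, ENNReal.ofReal_ofNat]
    rw [← ENNReal.ofReal_add (Real.exp_pos _).le (Real.exp_pos _).le, htwo]
    refine ENNReal.ofReal_le_ofReal ?_
    have hab : ∀ a b : ℝ, 2 * Real.exp ((a + b) / 2) ≤ Real.exp a + Real.exp b := fun a b => by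
      have e1 : Real.exp a = Real.exp (a / 2) ^ 2 := by
        rw [← Real.exp_nat_mul]; congr 1; push_cast; ring
      have e2 : Real.exp b = Real.exp (b / 2) ^ 2 := by
        rw [← Real.exp_nat_mul]; congr 1; push_cast; ring
      rw [e1, e2, add_div, Real.exp_add]
      nlinarith [sq_nonneg (Real.exp (a / 2) - Real.exp (b / 2))]
    refine le_trans ?_ (hab _ _)
    refine mul_le_mul_of_nonneg_left (Real.exp_le_exp.2 ?_) (by norm_num)
    rw [← mul_add, ← Finset.sum_add_distrib, Finset.mul_sum, Finset.mul_sum, Finset.sum_div]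
    refine Finset.sum_le_sum fun i _ => ?_
    rw [inner_add_left, inner_sub_left, hc, real_inner_smul_left]
    nlinarith [mul_nonneg ht (sq_nonneg (inner ℝ w (y i)))]
  have h4 : 2 * (ENNReal.ofReal (Real.exp (t / 4 * ∑ i, (inner ℝ u (y i)) ^ 2)) * volume Bh) ≤
      2 * ∫⁻ v in Metric.ball (0 : E d) 1, e v := by
    calc _ = ∫⁻ _ in Bh, 2 * ENNReal.ofReal (Real.exp (t / 4 * ∑ i, (inner ℝ u (y i)) ^ 2)) := by
          rw [setLIntegral_const, mul_assoc]
      _ ≤ ∫⁻ w in Bh, (e (c + w) + e (c - w)) := lintegral_mono h3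
      _ = (∫⁻ w in Bh, e (c + w)) + ∫⁻ w in Bh, e (c - w) :=
          lintegral_add_left (hem.comp (measurable_const_add c)) _
      _ ≤ _ := by rw [h2, ← two_mul]; gcongr
  exact (ENNReal.mul_le_mul_iff_right (by norm_num) (by norm_num)).1 h4

/-- For jointly sub-Gaussian vectors, `∑ᵢ ⟨u, Nᵢ⟩²` is bounded uniformly in the unit vector `u` by a
random variable of mean `O(s (card ι + d))`. -/
theorem JointlySubGaussian.exists_uniform_bound (hN : ∀ i, Measurable (N i)) (hs : 0 < s)
    (h : JointlySubGaussian N s P) :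
    ∃ Φ : Ω → ℝ, Integrable Φ P ∧ ∫ ω, Φ ω ∂P ≤ 12 * s * (Fintype.card ι + d) ∧
      ∀ ω u, ‖u‖ = 1 → ∑ i, (inner ℝ u (N i ω)) ^ 2 ≤ Φ ω := by
  set t : ℝ := 1 / (4 * s) with ht
  have htpos : 0 < t := by positivity
  set V := volume (Metric.ball (0 : E d) 1) with hV
  have hV0 : V ≠ 0 := (Metric.measure_ball_pos _ _ one_pos).ne'
  have hVt : V ≠ ∞ := measure_ball_lt_top.ne
  -- The average over the ball is measurable in ω and controls all directions at once; the
  -- measurability of a supremum never comes up.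
  set J : Ω → ℝ≥0∞ := fun ω => ∫⁻ v in Metric.ball (0 : E d) 1,
    ENNReal.ofReal (Real.exp (t * ∑ i, (inner ℝ v (N i ω)) ^ 2)) with hJ
  have hmeas : Measurable fun p : Ω × E d =>
      ENNReal.ofReal (Real.exp (t * ∑ i, (inner ℝ p.2 (N i p.1)) ^ 2)) := by
    refine ENNReal.measurable_ofReal.comp (Real.measurable_exp.comp (Measurable.const_mul ?_ _))
    refine Finset.measurable_fun_sum _ fun i _ => Measurable.pow_const ?_ _
    exact Measurable.inner measurable_snd ((hN i).comp measurable_fst)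
  have hJm : Measurable J := hmeas.lintegral_prod_right'
  set q : ℝ := √2 ^ Fintype.card ι with hq
  have hqpos : 0 < q := by positivity
  have hJint : ∫⁻ ω, J ω ∂P ≤ ENNReal.ofReal q * V := by
    rw [hJ, lintegral_lintegral_swap hmeas.aemeasurable]
    calc _ ≤ ∫⁻ _ in Metric.ball (0 : E d) 1, ENNReal.ofReal q := by
          refine setLIntegral_mono' measurableSet_ball fun v hv => ?_
          exact h.lintegral_exp_sum_sq_le hN hs (mem_ball_zero_iff.1 hv).le
      _ = _ := setLIntegral_const _ _
  have hJtop : ∀ ω, J ω ≠ ∞ := by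
    intro ω
    refine ne_of_lt (lt_of_le_of_lt (b := ∫⁻ _ in Metric.ball (0 : E d) 1,
      ENNReal.ofReal (Real.exp (t * ∑ i, ‖N i ω‖ ^ 2))) ?_ ?_)
    · refine setLIntegral_mono' measurableSet_ball fun v hv => ?_
      refine ENNReal.ofReal_le_ofReal (Real.exp_le_exp.2
        (mul_le_mul_of_nonneg_left (Finset.sum_le_sum fun i _ => ?_) htpos.le))
      rw [sq_le_sq, abs_norm]
      refine (abs_real_inner_le_norm _ _).trans (mul_le_of_le_one_left (norm_nonneg _) ?_)
      exact (mem_ball_zero_iff.1 hv).le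
    · rw [setLIntegral_const]
      exact ENNReal.mul_lt_top ENNReal.ofReal_lt_top hVt.lt_top
  have hvol : volume (Metric.ball (0 : E d) (1 / 2)) = ENNReal.ofReal ((1 / 2) ^ d) * V := by
    rw [Measure.addHaar_ball_of_pos _ _ (by norm_num), finrank_euclideanSpace_fin]
  set K : ℝ := 2 ^ d * q with hK
  have hKpos : 0 < K := by positivity
  set Z : Ω → ℝ := fun ω => (J ω).toReal / (q * V.toReal) with hZ
  have hVr : 0 < V.toReal := ENNReal.toReal_pos hV0 hVt
  have hJi : Integrable (fun ω => (J ω).toReal) P :=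
    integrable_toReal_of_lintegral_ne_top hJm.aemeasurable
      (ne_of_lt (hJint.trans_lt (ENNReal.mul_lt_top ENNReal.ofReal_lt_top hVt.lt_top)))
  have hZi : Integrable Z P := hJi.div_const _
  have hZ1 : ∫ ω, Z ω ∂P ≤ 1 := by
    rw [hZ, integral_div, integral_toReal hJm.aemeasurable
      (Filter.Eventually.of_forall fun ω => (hJtop ω).lt_top)]
    refine div_le_one_of_le₀ ?_ (by positivity)
    have := ENNReal.toReal_mono (ENNReal.mul_ne_top ENNReal.ofReal_ne_top hVt) hJint
    rwa [ENNReal.toReal_mul, ENNReal.toReal_ofReal hqpos.le] at this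
  -- The ball estimate says exp(p(u)/(16s)) ≤ K Z, and log Z ≤ Z - 1 makes the resulting bound
  -- linear in Z, so that E Z ≤ 1 suffices.
  refine ⟨fun ω => 16 * s * (Real.log K - 1 + Z ω), ?_, ?_, ?_⟩
  · exact ((integrable_const _).add hZi).const_mul _
  · rw [integral_const_mul, integral_add (integrable_const _) hZi]
    simp only [integral_const, probReal_univ, one_smul]
    have hlog : Real.log K = (d + Fintype.card ι / 2) * Real.log 2 := by
      rw [hK, hq, Real.log_mul (by positivity) (by positivity), Real.log_pow, Real.log_pow,
        Real.log_sqrt (by norm_num)]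
      ring
    -- This turns the factor 16 into 12.
    have h2 : Real.log 2 ≤ 3 / 4 := by linarith [Real.log_two_lt_d9]
    have h3 : Real.log K ≤ (d + Fintype.card ι / 2) * (3 / 4) := by
      rw [hlog]; exact mul_le_mul_of_nonneg_left h2 (by positivity)
    have h4 : (0 : ℝ) ≤ Fintype.card ι := Nat.cast_nonneg _
    calc 16 * s * (Real.log K - 1 + ∫ ω, Z ω ∂P) ≤ 16 * s * ((d + Fintype.card ι) * (3 / 4)) := by
          refine mul_le_mul_of_nonneg_left ?_ (by positivity)
          linarith
      _ = _ := by ring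
  · intro ω u hu
    have h1 := exp_mul_volume_ball_le t htpos.le (fun i => N i ω) hu
    rw [hvol] at h1
    have h2 := ENNReal.toReal_mono (hJtop ω) h1
    rw [ENNReal.toReal_mul, ENNReal.toReal_mul, ENNReal.toReal_ofReal (Real.exp_pos _).le,
      ENNReal.toReal_ofReal (by positivity)] at h2
    set p := ∑ i, (inner ℝ u (N i ω)) ^ 2 with hp
    have h3 : Real.exp (t / 4 * p) ≤ K * Z ω := by
      have e1 : K * Z ω = (J ω).toReal * 2 ^ d / V.toReal := by
        rw [hK, hZ]; field_simp
      rw [e1, le_div_iff₀ hVr]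
      have e2 : Real.exp (t / 4 * p) * V.toReal
          = (Real.exp (t / 4 * p) * ((1 / 2) ^ d * V.toReal)) * 2 ^ d := by
        rw [one_div, inv_pow]; field_simp
      rw [e2]
      exact mul_le_mul_of_nonneg_right h2 (by positivity)
    have hZpos : 0 < Z ω := pos_of_mul_pos_right ((Real.exp_pos _).trans_le h3) hKpos.le
    have h4 := Real.log_le_log (Real.exp_pos _) h3
    rw [Real.log_exp, Real.log_mul hKpos.ne' hZpos.ne'] at h4
    have h5 := Real.log_le_sub_one_of_pos hZpos
    have h6 : t / 4 * p ≤ Real.log K - 1 + Z ω := by linarith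
    calc p = 16 * s * (t / 4 * p) := by rw [ht]; field_simp; norm_num
      _ ≤ _ := mul_le_mul_of_nonneg_left h6 (by positivity)

end OperatorNorm

/-! ### Gaussian vectors -/

section Gaussian

variable {Ω : Type*} [mΩ : MeasurableSpace Ω] {P : Measure Ω} {d : ℕ} {s : ℝ} {Y : Ω → E d}

lemma posSemidef_sq_smul_one (d : ℕ) (s : ℝ) :
    (s ^ 2 • (1 : Matrix (Fin d) (Fin d) ℝ)).PosSemidef :=
  Matrix.PosSemidef.one.smul (sq_nonneg s)

instance (d : ℕ) (s : ℝ) : IsGaussian (gaussianNoise d s) := by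
  unfold gaussianNoise
  infer_instance

lemma integral_id_gaussianNoise (d : ℕ) (s : ℝ) : ∫ y, y ∂(gaussianNoise d s) = 0 :=
  integral_id_multivariateGaussian

lemma map_inner_gaussianNoise (d : ℕ) (s : ℝ) (a : E d) :
    (gaussianNoise d s).map (fun y => inner ℝ a y) = gaussianReal 0 (s ^ 2 * ‖a‖ ^ 2).toNNReal := by
  have h := IsGaussian.map_eq_gaussianReal (μ := gaussianNoise d s) (innerSL ℝ a)
  have h1 : ∫ y, innerSL ℝ a y ∂(gaussianNoise d s) = 0 := by
    rw [ContinuousLinearMap.integral_comp_comm _ IsGaussian.integrable_fun_id,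
      integral_id_gaussianNoise, map_zero]
  have h2 : Var[innerSL ℝ a; gaussianNoise d s] = s ^ 2 * ‖a‖ ^ 2 := by
    have := covarianceBilin_self (μ := gaussianNoise d s) IsGaussian.memLp_two_id a
    rw [gaussianNoise, covarianceBilin_multivariateGaussian (posSemidef_sq_smul_one d s)] at this
    rw [show (innerSL ℝ a : E d → ℝ) = fun u => inner ℝ a u from rfl, gaussianNoise, ← this,
      Matrix.smul_mulVec, Matrix.one_mulVec, dotProduct_smul, smul_eq_mul,
      EuclideanSpace.norm_sq_eq]
    simp [dotProduct, sq]
  rw [h1, h2] at h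
  exact h

lemma aemeasurable_of_map_gaussianNoise (h : P.map Y = gaussianNoise d s) : AEMeasurable Y P :=
  aemeasurable_of_map_neZero (by rw [h]; infer_instance)

lemma memLp_two_of_map_gaussianNoise (h : P.map Y = gaussianNoise d s) : MemLp Y 2 P := by
  have := (memLp_map_measure_iff (μ := P) (f := Y) (g := id) (p := 2) (by fun_prop)
    (aemeasurable_of_map_gaussianNoise h)).1 (by rw [h]; exact IsGaussian.memLp_two_id)
  exact this

lemma integral_of_map_gaussianNoise (h : P.map Y = gaussianNoise d s) : ∫ ω, Y ω ∂P = 0 := by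
  rw [← integral_id_gaussianNoise d s, ← h,
    integral_map (aemeasurable_of_map_gaussianNoise h) (by fun_prop)]

lemma map_inner_of_map_gaussianNoise (h : P.map Y = gaussianNoise d s) (a : E d) :
    P.map (fun ω => inner ℝ a (Y ω)) = gaussianReal 0 (s ^ 2 * ‖a‖ ^ 2).toNNReal := by
  rw [← map_inner_gaussianNoise, ← h,
    AEMeasurable.map_map_of_aemeasurable (by fun_prop) (aemeasurable_of_map_gaussianNoise h)]
  rfl

lemma lintegral_exp_inner_of_map_gaussianNoise (h : P.map Y = gaussianNoise d s) (a : E d) :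
    ∫⁻ ω, ENNReal.ofReal (Real.exp (inner ℝ a (Y ω))) ∂P =
      ENNReal.ofReal (Real.exp (s ^ 2 / 2 * ‖a‖ ^ 2)) := by
  have hm := map_inner_of_map_gaussianNoise h a
  have h1 := mgf_gaussianReal hm 1
  have h2 : Integrable (fun ω => Real.exp (1 * inner ℝ a (Y ω))) P := by
    refine Integrable.of_integral_ne_zero ?_
    rw [mgf] at h1
    rw [h1]
    exact (Real.exp_pos _).ne'
  rw [← ofReal_integral_eq_lintegral_ofReal (by simpa using h2)
    (Filter.Eventually.of_forall fun _ => (Real.exp_pos _).le)]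
  simp only [mgf, one_mul] at h1
  rw [h1, Real.coe_toNNReal _ (by positivity)]
  congr 2
  ring

lemma integral_sq_norm_of_map_gaussianNoise (h : P.map Y = gaussianNoise d s) :
    ∫ ω, ‖Y ω‖ ^ 2 ∂P = d * s ^ 2 := by
  have hY := memLp_two_of_map_gaussianNoise h
  have hi : ∀ k : Fin d, ∫ ω, (Y ω k) ^ 2 ∂P = s ^ 2 := fun k => by
    have e : ∀ ω, Y ω k = inner ℝ (EuclideanSpace.single k (1 : ℝ)) (Y ω) := fun ω => by
      simp [EuclideanSpace.inner_single_left]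
    have hm := map_inner_of_map_gaussianNoise h (EuclideanSpace.single k (1 : ℝ))
    have hae : AEMeasurable (fun ω => inner ℝ (EuclideanSpace.single k (1 : ℝ)) (Y ω)) P :=
      aemeasurable_of_map_neZero (by rw [hm]; infer_instance)
    simp only [e]
    have h1 : ∫ ω, (inner ℝ (EuclideanSpace.single k (1 : ℝ)) (Y ω)) ^ 2 ∂P =
        ∫ z, z ^ 2 ∂(gaussianReal 0 (s ^ 2 * ‖EuclideanSpace.single k (1 : ℝ)‖ ^ 2).toNNReal) := by
      rw [← hm, integral_map hae (by fun_prop)]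
    rw [h1, ← variance_of_integral_eq_zero (X := fun z : ℝ => z) (by fun_prop)
      integral_id_gaussianReal, variance_fun_id_gaussianReal]
    simp
    positivity
  simp only [EuclideanSpace.norm_sq_eq, Real.norm_eq_abs, sq_abs]
  rw [integral_finsetSum]
  · simp [hi]
  · intro k _
    have : MemLp (fun ω => Y ω k) 2 P := by
      have := hY.const_inner (𝕜 := ℝ) (EuclideanSpace.single k (1 : ℝ))
      simpa [EuclideanSpace.inner_single_left] using this
    exact this.integrable_sq

end Gaussian

/-! ### Uniform mixtures and orthogonality -/

section Mixture

variable {Ω : Type*} {𝒢 𝒢' mΩ : MeasurableSpace Ω} {P : Measure Ω} {d : ℕ}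

/-- Split along the events {Z = z}: each has probability 1/|s| and is independent of ψ z. The family
ψ as a whole need not be independent of Z. -/
lemma integral_uniform_mixture [IsProbabilityMeasure P] {ι : Type*} [MeasurableSpace ι] [MeasurableSingletonClass ι]
    {Z : Ω → ι} (hZ : Measurable Z) {s : Finset ι} (hs : s.Nonempty)
    (hlaw : P.map Z = uniformOn (s : Set ι)) {ψ : ι → Ω → ℝ} (hψ : ∀ z ∈ s, Integrable (ψ z) P)
    (hind : ∀ z ∈ s, IndepFun Z (ψ z) P) :
    Integrable (fun ω => ψ (Z ω) ω) P ∧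
      ∫ ω, ψ (Z ω) ω ∂P = (s.card : ℝ)⁻¹ * ∑ z ∈ s, ∫ ω, ψ z ω ∂P := by
  classical
  have hmem : ∀ᵐ ω ∂P, Z ω ∈ s := by
    have h1 : uniformOn (s : Set ι) (s : Set ι) = 1 := uniformOn_self s.finite_toSet hs
    rw [← hlaw, Measure.map_apply hZ s.measurableSet] at h1
    exact (prob_compl_eq_zero_iff (hZ s.measurableSet)).2 h1
  have hae : (fun ω => ψ (Z ω) ω) =ᵐ[P]
      fun ω => ∑ z ∈ s, (Z ⁻¹' {z}).indicator (ψ z) ω := by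
    filter_upwards [hmem] with ω hω
    have h0 : ∀ z ∈ s, z ≠ Z ω → (Z ⁻¹' {z}).indicator (ψ z) ω = 0 := fun z _ hz =>
      Set.indicator_of_notMem
        (fun h : ω ∈ Z ⁻¹' {z} => hz (Set.mem_singleton_iff.1 h).symm) _
    rw [Finset.sum_eq_single_of_mem (Z ω) hω h0]
    simp
  have hms : ∀ z, MeasurableSet (Z ⁻¹' {z}) := fun z => hZ (measurableSet_singleton z)
  have hint : ∀ z ∈ s, Integrable ((Z ⁻¹' {z}).indicator (ψ z)) P := fun z hz =>
    (hψ z hz).indicator (hms z)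
  refine ⟨(integrable_congr hae).2 (integrable_finsetSum _ hint), ?_⟩
  rw [integral_congr_ae hae, integral_finsetSum _ hint, Finset.mul_sum]
  refine Finset.sum_congr rfl fun z hz => ?_
  have h1 : (Z ⁻¹' {z}).indicator (ψ z) =
      fun ω : Ω => (({z} : Set ι).indicator (fun _ => (1 : ℝ)) (Z ω)) * ψ z ω := by
    ext ω
    by_cases h : Z ω = z <;> simp [Set.indicator, h]
  have hmi : Measurable (({z} : Set ι).indicator fun _ => (1 : ℝ)) :=
    measurable_const.indicator (measurableSet_singleton z)
  have hI : IndepFun (fun ω => ({z} : Set ι).indicator (fun _ => (1 : ℝ)) (Z ω)) (ψ z) P :=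
    (hind z hz).comp hmi measurable_id
  rw [h1, hI.integral_fun_mul_eq_mul_integral (hmi.comp hZ).aestronglyMeasurable
    (hψ z hz).aestronglyMeasurable]
  congr 1
  have h2 : (fun ω => ({z} : Set ι).indicator (fun _ => (1 : ℝ)) (Z ω)) =
      (Z ⁻¹' {z}).indicator fun _ => 1 := by
    ext ω
    simp [Set.indicator]
  rw [h2, integral_indicator_const _ (hms z), smul_eq_mul, mul_one, measureReal_def,
    ← Measure.map_apply hZ (measurableSet_singleton z), hlaw, ← Finset.coe_singleton,
    uniformOn_apply_finset]
  rw [Finset.inter_singleton_of_mem hz]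
  simp

/-- `U` is square-integrable and orthogonal to the square-integrable `𝒢`-measurable vectors. -/
def IsCentered (𝒢 : MeasurableSpace Ω) {mΩ : MeasurableSpace Ω} (U : Ω → E d)
    (P : Measure Ω) : Prop :=
  MemLp U 2 P ∧ ∀ Y : Ω → E d, Measurable[𝒢] Y → MemLp Y 2 P → ∫ ω, inner ℝ (Y ω) (U ω) ∂P = 0

lemma IsCentered.smul {U : Ω → E d} (h : IsCentered 𝒢 U P) (c : ℝ) :
    IsCentered 𝒢 (fun ω => c • U ω) P := by
  refine ⟨h.1.const_smul c, fun Y hY hY2 => ?_⟩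
  simp only [real_inner_smul_right, integral_const_mul, h.2 Y hY hY2, mul_zero]

lemma IsCentered.mono {U : Ω → E d} (h : IsCentered 𝒢 U P)
    (hle : 𝒢' ≤ 𝒢) : IsCentered 𝒢' U P :=
  ⟨h.1, fun Y hY hY2 => h.2 Y (hY.mono hle le_rfl) hY2⟩

lemma isCentered_zero : IsCentered 𝒢 (fun _ => (0 : E d)) P :=
  ⟨MemLp.zero, fun _ _ _ => by simp⟩

lemma memLp_inner {U V : Ω → E d} (hU : MemLp U 2 P) (hV : MemLp V 2 P) :
    Integrable (fun ω => inner ℝ (U ω) (V ω)) P := by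
  have h1 : Integrable (fun ω => ‖U ω‖ ^ 2 + ‖V ω‖ ^ 2) P :=
    ((memLp_two_iff_integrable_sq_norm hU.1).1 hU).add
      ((memLp_two_iff_integrable_sq_norm hV.1).1 hV)
  refine h1.mono' (hU.1.inner hV.1) (Filter.Eventually.of_forall fun ω => ?_)
  refine (norm_inner_le_norm _ _).trans ?_
  nlinarith [sq_nonneg (‖U ω‖ - ‖V ω‖), sq_nonneg ‖U ω‖, sq_nonneg ‖V ω‖]

lemma integrable_sq_norm {U : Ω → E d} (hU : MemLp U 2 P) : Integrable (fun ω => ‖U ω‖ ^ 2) P :=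
  (memLp_two_iff_integrable_sq_norm hU.1).1 hU

lemma isCentered_of_indep [IsProbabilityMeasure P] {U : Ω → E d} (hU : MemLp U 2 P) (h0 : ∫ ω, U ω ∂P = 0)
    (hind : Indep (MeasurableSpace.comap U inferInstance) 𝒢 P) : IsCentered 𝒢 U P := by
  refine ⟨hU, fun Y hY hY2 => ?_⟩
  have hI : IndepFun Y U P :=
    (indep_of_indep_of_le_right hind (measurable_iff_comap_le.1 hY)).symm
  have := hI.integral_bilin (hY2.integrable one_le_two) (hU.integrable one_le_two) (innerSL ℝ)
  rw [h0, map_zero] at this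
  exact this

/-- Given 𝒢, the index Z is still uniform, so φ_Z averages to zero against any 𝒢-measurable Y. This
replaces conditional expectations for the mini-batches. -/
lemma isCentered_uniform [IsProbabilityMeasure P] {ι : Type*} [MeasurableSpace ι]
    [MeasurableSingletonClass ι] {Z : Ω → ι} (hZ : Measurable Z)
    {s : Finset ι} (hs : s.Nonempty) (hlaw : P.map Z = uniformOn (s : Set ι))
    (hind : Indep (MeasurableSpace.comap Z inferInstance) 𝒢 P)
    {φ : ι → Ω → E d} (hφ : ∀ z, Measurable[𝒢] (φ z)) (hφ2 : ∀ z ∈ s, MemLp (φ z) 2 P)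
    (h0 : ∀ ω, ∑ z ∈ s, φ z ω = 0) (hm : AEStronglyMeasurable (fun ω => φ (Z ω) ω) P) :
    IsCentered 𝒢 (fun ω => φ (Z ω) ω) P ∧
      ∫ ω, ‖φ (Z ω) ω‖ ^ 2 ∂P = (s.card : ℝ)⁻¹ * ∑ z ∈ s, ∫ ω, ‖φ z ω‖ ^ 2 ∂P := by
  have hI : ∀ ψ : Ω → ℝ, Measurable[𝒢] ψ → IndepFun Z ψ P := fun ψ hψ =>
    indep_of_indep_of_le_right hind (measurable_iff_comap_le.1 hψ)
  obtain ⟨h1, h2⟩ := integral_uniform_mixture hZ hs hlaw (ψ := fun z ω => ‖φ z ω‖ ^ 2)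
    (fun z hz => integrable_sq_norm (hφ2 z hz)) fun z _ => hI _ ((measurable_norm.pow_const 2).comp (hφ z))
  refine ⟨⟨(memLp_two_iff_integrable_sq_norm hm).2 h1, fun Y hY hY2 => ?_⟩, h2⟩
  obtain ⟨h3, h4⟩ := integral_uniform_mixture hZ hs hlaw (ψ := fun z ω => inner ℝ (Y ω) (φ z ω))
    (fun z hz => memLp_inner hY2 (hφ2 z hz)) fun z _ => hI _ (hY.inner (hφ z))
  rw [h4, ← integral_finsetSum _ fun z hz => memLp_inner hY2 (hφ2 z hz)]
  simp only [← inner_sum, h0, inner_zero_right, integral_zero, mul_zero]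

/-- Pythagoras for a finite orthogonal family of random vectors. -/
lemma integral_sq_norm_sum {κ : Type*} (s : Finset κ) {U : κ → Ω → E d}
    (hU : ∀ k ∈ s, MemLp (U k) 2 P)
    (horth : ∀ k ∈ s, ∀ l ∈ s, k ≠ l → ∫ ω, inner ℝ (U k ω) (U l ω) ∂P = 0) :
    ∫ ω, ‖∑ k ∈ s, U k ω‖ ^ 2 ∂P = ∑ k ∈ s, ∫ ω, ‖U k ω‖ ^ 2 ∂P := by
  classical
  have h1 : ∀ ω, ‖∑ k ∈ s, U k ω‖ ^ 2 = ∑ k ∈ s, ∑ l ∈ s, inner ℝ (U k ω) (U l ω) := fun ω => by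
    rw [← real_inner_self_eq_norm_sq, sum_inner]
    exact Finset.sum_congr rfl fun k _ => inner_sum _ _ _
  simp only [h1]
  rw [integral_finsetSum _ fun k hk => integrable_finsetSum _ fun l hl =>
    memLp_inner (hU k hk) (hU l hl)]
  refine Finset.sum_congr rfl fun k hk => ?_
  rw [integral_finsetSum _ fun l hl => memLp_inner (hU k hk) (hU l hl),
    Finset.sum_eq_single_of_mem k hk fun l hl hlk => horth k hk l hl hlk.symm]
  simp only [real_inner_self_eq_norm_sq]

end Mixture

section Centered

variable {Ω : Type*} {𝒢 mΩ : MeasurableSpace Ω} {P : Measure Ω} {d : ℕ}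

lemma IsCentered.integral_sq_norm_add {Y U : Ω → E d} (hU : IsCentered 𝒢 U P)
    (hY : Measurable[𝒢] Y) (hY2 : MemLp Y 2 P) :
    ∫ ω, ‖Y ω + U ω‖ ^ 2 ∂P = ∫ ω, ‖Y ω‖ ^ 2 ∂P + ∫ ω, ‖U ω‖ ^ 2 ∂P := by
  have h1 := integrable_sq_norm hY2
  have h2 := (memLp_inner hY2 hU.1).const_mul 2
  have h3 := integrable_sq_norm hU.1
  have h12 : Integrable (fun ω => ‖Y ω‖ ^ 2 + 2 * inner ℝ (Y ω) (U ω)) P := h1.add h2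
  simp only [norm_add_sq_real]
  rw [integral_add h12 h3, integral_add h1 h2, integral_const_mul, hU.2 Y hY hY2, mul_zero,
    add_zero]

lemma isCentered_sum {κ : Type*} (s : Finset κ) {U : κ → Ω → E d}
    (hU : ∀ k ∈ s, IsCentered 𝒢 (U k) P) : IsCentered 𝒢 (fun ω => ∑ k ∈ s, U k ω) P := by
  refine ⟨memLp_finsetSum _ fun k hk => (hU k hk).1, fun Y hY hY2 => ?_⟩
  simp only [inner_sum]
  rw [integral_finsetSum _ fun k hk => memLp_inner hY2 (hU k hk).1]
  exact Finset.sum_eq_zero fun k hk => (hU k hk).2 Y hY hY2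

end Centered

/-! ### Sums over pairs -/

section Pairs

variable {n : ℕ}

lemma sum_sum_erase_eq_sum_pairs {M : Type*} [AddCommMonoid M] (F : Fin n → Fin n → M) :
    ∑ i, ∑ j ∈ univ.erase i, F i j =
      ∑ p : {p : Fin n × Fin n // p.1 < p.2}, (F p.1.1 p.1.2 + F p.1.2 p.1.1) := by
  have key : ∀ G : Fin n → Fin n → M, ∑ p : {p : Fin n × Fin n // p.1 < p.2}, G p.1.1 p.1.2 =
      ∑ i, ∑ j, if i < j then G i j else 0 := fun G => by
    rw [← Fintype.sum_prod_type' (f := fun i j => if i < j then G i j else 0),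
      ← Finset.sum_filter (fun p : Fin n × Fin n => p.1 < p.2) fun p => G p.1 p.2]
    exact (Finset.sum_subtype _ (by simp) fun p : Fin n × Fin n => G p.1 p.2).symm
  rw [Finset.sum_add_distrib, key F, key fun i j => F j i,
    Finset.sum_comm (f := fun i j => if i < j then F j i else 0), ← Finset.sum_add_distrib]
  refine Finset.sum_congr rfl fun i _ => ?_
  rw [← Finset.sum_add_distrib, ← Finset.filter_ne', Finset.sum_filter]
  refine Finset.sum_congr rfl fun j _ => ?_
  rcases lt_trichotomy i j with h | h | h
  · simp [h, h.ne', h.not_gt]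
  · simp [h]
  · simp [h, h.ne, h.not_gt]

/-- Used twice: with a the indicator of H it counts the pairs with exactly one honest end, and for
general a it shows that the correlated noise acts at most with the factor n. -/
lemma sum_pairs_sq_norm_sub {V : Type*} [NormedAddCommGroup V] [InnerProductSpace ℝ V]
    (a : Fin n → V) :
    ∑ p : {p : Fin n × Fin n // p.1 < p.2}, ‖a p.1.1 - a p.1.2‖ ^ 2 =
      n * ∑ i, ‖a i‖ ^ 2 - ‖∑ i, a i‖ ^ 2 := by
  have h1 := sum_sum_erase_eq_sum_pairs fun i j => ‖a i‖ ^ 2 - inner ℝ (a i) (a j)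
  have h2 : ∀ p : {p : Fin n × Fin n // p.1 < p.2}, ‖a p.1.1 - a p.1.2‖ ^ 2 =
      ‖a p.1.1‖ ^ 2 - inner ℝ (a p.1.1) (a p.1.2)
        + (‖a p.1.2‖ ^ 2 - inner ℝ (a p.1.2) (a p.1.1)) := fun p => by
    rw [norm_sub_sq_real, real_inner_comm (a p.1.1) (a p.1.2)]
    ring
  rw [Finset.sum_congr rfl fun p _ => h2 p, ← h1]
  have h3 : ∀ i, ∑ j ∈ univ.erase i, (‖a i‖ ^ 2 - inner ℝ (a i) (a j)) =
      ∑ j, (‖a i‖ ^ 2 - inner ℝ (a i) (a j)) := fun i =>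
    Finset.sum_erase _ (by rw [real_inner_self_eq_norm_sq, sub_self])
  simp only [h3, Finset.sum_sub_distrib, Finset.sum_const, Finset.card_univ, Fintype.card_fin,
    nsmul_eq_mul, ← inner_sum, ← sum_inner, real_inner_self_eq_norm_sq, ← Finset.mul_sum]

end Pairs

/-! ### Momentum -/

section Momentum

variable {Ω : Type*} {d : ℕ}

/-- Exponential averages of a sequence of random vectors, started at zero. -/
def momentum (β : ℕ → ℝ) (u : ℕ → Ω → E d) : ℕ → Ω → E d
  | 0 => fun _ => 0
  | t + 1 => fun ω => β t • momentum β u t ω + (1 - β t) • u (t + 1) ω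

/-- Sum of the squared weights in `momentum`. -/
def momentumVariance (β : ℕ → ℝ) : ℕ → ℝ
  | 0 => 0
  | t + 1 => β t ^ 2 * momentumVariance β t + (1 - β t) ^ 2

lemma momentumVariance_nonneg (β : ℕ → ℝ) (t : ℕ) : 0 ≤ momentumVariance β t := by
  induction t with
  | zero => exact le_rfl
  | succ t ih => rw [momentumVariance]; positivity

end Momentum

/-- Membership events are measurable, and a singleton is a finite intersection of such events or
their complements. -/
instance (m : ℕ) : MeasurableSingletonClass (Finset (Fin m)) where
  measurableSet_singleton B := by
    have : ({B} : Set (Finset (Fin m))) = ⋂ k, {B' | k ∈ B' ↔ k ∈ B} := by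
      ext B'
      simp [Finset.ext_iff]
    rw [this]
    refine MeasurableSet.iInter fun k => ?_
    by_cases hk : k ∈ B
    · simpa [hk] using measurable_finset_mem k
    · simpa [hk] using (measurable_finset_mem k).not

namespace Execution

/-! ### The noise of one step -/

variable {X : Type*} {d n m : ℕ} {ℓ : E d → X → ℝ} {D : Fin n → Fin m → X}
  {H : Finset (Fin n)} {f b : ℕ} {C : ℝ≥0∞} {sCor sInd : ℝ} {γ β : ℕ → ℝ} {θ₀ : E d} {T : ℕ}
  {Ω : Type*} {𝒜 : MeasurableSpace Ω} [mΩ : MeasurableSpace Ω] {P : Measure Ω}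
  (ex : Execution ℓ D H f b C sCor sInd γ β θ₀ T P)

lemma measurable_θ {t : ℕ} (ht : t ≤ T) : Measurable[ex.ℱ t] (ex.θ t) := by
  induction t with
  | zero => rw [show ex.θ 0 = fun _ => θ₀ from funext ex.θ_zero]; exact measurable_const
  | succ t ih =>
    have h1 := (ih (by omega)).mono (ex.ℱ.mono (Nat.le_succ t)) le_rfl
    have h2 := (ex.agg_measurable t (by omega)).mono (ex.ℱ.mono (Nat.le_succ t)) le_rfl
    rw [show ex.θ (t + 1) = fun ω => ex.θ t ω - γ t • ex.agg t ω from
      funext (ex.θ_succ t (by omega))]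
    exact h1.sub (h2.const_smul (γ t))

/-- The model is predictable: θ_{t+1} is already fixed by the aggregate of step t. This is why the
noise of step t + 1 is fresh with respect to it, however the malicious workers behave. -/
lemma measurable_θ_succ {t : ℕ} (ht : t < T) : Measurable[ex.ℱ t] (ex.θ (t + 1)) := by
  rw [show ex.θ (t + 1) = fun ω => ex.θ t ω - γ t • ex.agg t ω from funext (ex.θ_succ t ht)]
  exact (ex.measurable_θ ht.le).sub ((ex.agg_measurable t ht).const_smul (γ t))

/-- The σ-algebras of the history and of the fresh sources of step `t + 1`. -/
@[reducible]
def sourceAlgebra (t : ℕ) (s : Option (Source n)) : MeasurableSpace Ω :=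
  match s with
  | none => ex.ℱ t
  | some (.inl i) => MeasurableSpace.comap (ex.batch (t + 1) i) inferInstance
  | some (.inr (.inl p)) => MeasurableSpace.comap (ex.corNoise (t + 1) p.1.1 p.1.2) inferInstance
  | some (.inr (.inr i)) => MeasurableSpace.comap (ex.indNoise (t + 1) i) inferInstance

/-- What the history and the sources of step `t + 1` other than `s` generate. -/
@[reducible]
def otherSources (t : ℕ) (s : Option (Source n)) : MeasurableSpace Ω :=
  ⨆ s' ∈ ({s}ᶜ : Set (Option (Source n))), ex.sourceAlgebra t s'

lemma sourceAlgebra_le {t : ℕ} (ht : t + 1 < T) (s : Option (Source n)) :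
    ex.sourceAlgebra t s ≤ mΩ := by
  rcases s with _ | i | p | i
  · exact ex.ℱ.le t
  · exact (measurable_iff_comap_le.1 (ex.batch_measurable t ht i)).trans (ex.ℱ.le _)
  · exact (measurable_iff_comap_le.1 (ex.corNoise_measurable t ht _ _)).trans (ex.ℱ.le _)
  · exact (measurable_iff_comap_le.1 (ex.indNoise_measurable t ht i)).trans (ex.ℱ.le _)

lemma iIndep_sourceAlgebra {t : ℕ} (ht : t + 1 < T) : iIndep (ex.sourceAlgebra t) P := by
  refine iIndep_of_iIndep_of_le (ex.fresh t ht) fun s => ?_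
  rcases s with _ | i | p | i <;> exact le_rfl

lemma indep_otherSources {t : ℕ} (ht : t + 1 < T) (s : Option (Source n)) :
    Indep (ex.sourceAlgebra t s) (ex.otherSources t s) P := by
  have := indep_iSup_of_disjoint (ex.sourceAlgebra_le ht) (ex.iIndep_sourceAlgebra ht)
    (S := {s}) (T := {s}ᶜ) disjoint_compl_right
  simpa [otherSources] using this

lemma sourceAlgebra_le_otherSources {t : ℕ} {s s' : Option (Source n)} (h : s' ≠ s) :
    ex.sourceAlgebra t s' ≤ ex.otherSources t s :=
  le_iSup₂ (f := fun s' (_ : s' ∈ ({s}ᶜ : Set (Option (Source n)))) => ex.sourceAlgebra t s') s' h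

lemma history_le_otherSources (t : ℕ) (s : Source n) : ex.ℱ t ≤ ex.otherSources t (some s) :=
  ex.sourceAlgebra_le_otherSources (s' := none) (by simp)

/-- Error of the mini-batch gradient of worker `i`. -/
noncomputable def batchErr (t : ℕ) (i : Fin n) (ω : Ω) : E d :=
  batchError ℓ D C i (ex.θ t ω) (ex.batch t i ω)

/-- Noise injected by worker `i`. -/
noncomputable def gauss (t : ℕ) (i : Fin n) (ω : Ω) : E d :=
  ∑ j ∈ univ.erase i, ex.corNoise t i j ω + ex.indNoise t i ω

/-- The σ-algebra is left free because the fact is needed both for the history of step t + 1 and for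
the sources other than a given one. -/
lemma measurable_batchErr (hC : BoundedGradients ℓ D H C) {i : Fin n} (hi : i ∈ H) {t : ℕ}
    (ht : t + 1 < T) (h1 : ex.ℱ t ≤ 𝒜)
    (h2 : ex.sourceAlgebra t (some (.inl i)) ≤ 𝒜) : Measurable[𝒜] (ex.batchErr (t + 1) i) := by
  have h3 : Measurable (Function.uncurry (batchError ℓ D C i)) :=
    measurable_from_prod_countable_left fun B => measurable_batchError hC hi B
  have hB : Measurable[𝒜] (ex.batch (t + 1) i) := measurable_iff_comap_le.2 h2
  have hθ : Measurable[𝒜] (ex.θ (t + 1)) := (ex.measurable_θ_succ (by omega)).mono h1 le_rfl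
  have h : ex.batchErr (t + 1) i = Function.uncurry (batchError ℓ D C i) ∘
      fun ω => (ex.θ (t + 1) ω, ex.batch (t + 1) i ω) := by
    ext1 ω
    rw [Function.comp_apply, Function.uncurry_apply_pair, batchErr]
  rw [h]
  exact h3.comp (hθ.prodMk hB)

/-- The history determines θ_{t+1}, and the batch is uniform and independent of it. For each frozen
θ the errors sum to zero over the batches and their mean square is at most σ_b². -/
lemma isCentered_batchErr [IsProbabilityMeasure P] (hℓ : ∀ x, Differentiable ℝ fun θ => ℓ θ x)
    (hC : BoundedGradients ℓ D H C) {σ : ℝ} (hσ : BoundedVariance ℓ D H σ) (hb : 1 ≤ b)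
    (hbm : b ≤ m) {i : Fin n} (hi : i ∈ H) {t : ℕ} (ht : t + 1 < T) :
    IsCentered (ex.otherSources t (some (.inl i))) (ex.batchErr (t + 1) i) P ∧
      ∫ ω, ‖ex.batchErr (t + 1) i ω‖ ^ 2 ∂P ≤ batchVariance m b σ := by
  set s := powersetCard b (univ : Finset (Fin m)) with hs
  have hset : {B : Finset (Fin m) | B.card = b} = (s : Set (Finset (Fin m))) := by
    ext B; simp [hs]
  have hcard : s.card = m.choose b := by simp [hs]
  have hθ := ex.measurable_θ_succ (show t < T by omega)
  have hφm : ∀ B, Measurable[ex.ℱ t] fun ω => batchError ℓ D C i (ex.θ (t + 1) ω) B := fun B =>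
    (measurable_batchError hC hi B).comp hθ
  have hφ2 : ∀ B ∈ s, MemLp (fun ω => batchError ℓ D C i (ex.θ (t + 1) ω) B) 2 P := fun B hB => by
    refine MemLp.of_bound ((hφm B).mono (ex.ℱ.le t) le_rfl).aestronglyMeasurable
      (√(m.choose b * batchVariance m b σ)) (Filter.Eventually.of_forall fun ω => ?_)
    exact Real.le_sqrt_of_sq_le (sq_norm_batchError_le hC hσ hi hℓ hb hbm _
      (Finset.mem_powersetCard.1 hB).2)
  obtain ⟨h1, h2⟩ := isCentered_uniform (P := P) (𝒢 := ex.otherSources t (some (.inl i)))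
    (Z := ex.batch (t + 1) i) (s := s)
    (φ := fun B ω => batchError ℓ D C i (ex.θ (t + 1) ω) B)
    ((ex.batch_measurable t ht i).mono (ex.ℱ.le _) le_rfl)
    (Finset.powersetCard_nonempty.2 (by simpa using hbm))
    (by rw [ex.batch_law t ht i, hset]) (ex.indep_otherSources ht (some (.inl i)))
    (fun B => (hφm B).mono (ex.history_le_otherSources t _) le_rfl) hφ2
    (fun ω => sum_batchError_eq_zero hC hi hℓ hb hbm _)
    ((ex.measurable_batchErr hC hi ht (ex.ℱ.le t) (ex.sourceAlgebra_le ht _)).aestronglyMeasurable)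
  refine ⟨h1, le_of_eq_of_le h2 ?_⟩
  rw [← integral_finsetSum _ fun B hB => integrable_sq_norm (hφ2 B hB), ← integral_const_mul, hcard]
  calc _ ≤ ∫ _, batchVariance m b σ ∂P := by
        refine integral_mono ((integrable_finsetSum _ fun B hB =>
          integrable_sq_norm (hφ2 B hB)).const_mul _) (integrable_const _) fun ω => ?_
        exact sum_sq_norm_batchError_le hC hσ hi hℓ hb hbm _
    _ = _ := by simp

lemma isCentered_corNoise [IsProbabilityMeasure P] {t : ℕ} (ht : t + 1 < T)
    (p : {p : Fin n × Fin n // p.1 < p.2}) :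
    IsCentered (ex.otherSources t (some (.inr (.inl p))))
      (ex.corNoise (t + 1) p.1.1 p.1.2) P :=
  have h := ex.corNoise_law t ht _ _ p.2
  isCentered_of_indep (memLp_two_of_map_gaussianNoise h) (integral_of_map_gaussianNoise h)
    (ex.indep_otherSources ht (some (.inr (.inl p))))

lemma isCentered_indNoise [IsProbabilityMeasure P] {t : ℕ} (ht : t + 1 < T) (i : Fin n) :
    IsCentered (ex.otherSources t (some (.inr (.inr i)))) (ex.indNoise (t + 1) i) P :=
  have h := ex.indNoise_law t ht i
  isCentered_of_indep (memLp_two_of_map_gaussianNoise h) (integral_of_map_gaussianNoise h)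
    (ex.indep_otherSources ht (some (.inr (.inr i))))

/-- Average over the honest workers of the noise of step `t`. -/
noncomputable def meanNoise (t : ℕ) (ω : Ω) : E d :=
  (H.card : ℝ)⁻¹ • ∑ i ∈ H, (ex.batchErr t i ω + ex.gauss t i ω)

/-- Contribution of one source to `meanNoise`. -/
noncomputable def noisePart (t : ℕ) : Source n → Ω → E d
  | .inl i => fun ω => unitWeights H i • ex.batchErr (t + 1) i ω
  | .inr (.inl p) => fun ω =>
      (unitWeights H p.1.1 - unitWeights H p.1.2) • ex.corNoise (t + 1) p.1.1 p.1.2 ω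
  | .inr (.inr i) => fun ω => unitWeights H i • ex.indNoise (t + 1) i ω

lemma sum_unitWeights_smul {V : Type*} [AddCommGroup V] [Module ℝ V] (S : Finset (Fin n))
    (y : Fin n → V) : ∑ i, unitWeights S i • y i = ∑ i ∈ S, y i := by
  simp [unitWeights, ite_smul, Finset.sum_ite_mem]

lemma sum_inner_gauss {t : ℕ} (ht : t + 1 < T) (a : Fin n → E d) (ω : Ω) :
    ∑ i, inner ℝ (a i) (ex.gauss (t + 1) i ω) =
      ∑ p : {p : Fin n × Fin n // p.1 < p.2},
        inner ℝ (a p.1.1 - a p.1.2) (ex.corNoise (t + 1) p.1.1 p.1.2 ω)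
      + ∑ i, inner ℝ (a i) (ex.indNoise (t + 1) i ω) := by
  simp only [gauss, inner_add_right, Finset.sum_add_distrib, inner_sum]
  rw [sum_sum_erase_eq_sum_pairs fun i j => inner ℝ (a i) (ex.corNoise (t + 1) i j ω)]
  congr 1
  refine Finset.sum_congr rfl fun p _ => ?_
  rw [ex.corNoise_antisymm t ht p.1.1 p.1.2, inner_neg_right, inner_sub_left, sub_eq_add_neg]

/-- By antisymmetry, the noise of the pair i < j enters the sum over H with the coefficient 1_H(i) -
1_H(j), which vanishes when both workers are honest. -/
lemma sum_noisePart {t : ℕ} (ht : t + 1 < T) (ω : Ω) :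
    ex.meanNoise (t + 1) ω = ∑ s, (H.card : ℝ)⁻¹ • ex.noisePart t s ω := by
  rw [← Finset.smul_sum, meanNoise, Fintype.sum_sum_type, Fintype.sum_sum_type]
  congr 1
  simp only [noisePart, sum_unitWeights_smul, Finset.sum_add_distrib]
  congr 1
  rw [← sum_unitWeights_smul H fun i => ex.gauss (t + 1) i ω,
    ← sum_unitWeights_smul H fun i => ex.indNoise (t + 1) i ω]
  simp only [gauss, smul_add, Finset.sum_add_distrib, Finset.smul_sum]
  rw [sum_sum_erase_eq_sum_pairs fun i j => unitWeights H i • ex.corNoise (t + 1) i j ω]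
  congr 1
  refine Finset.sum_congr rfl fun p _ => ?_
  rw [ex.corNoise_antisymm t ht p.1.1 p.1.2, smul_neg, sub_smul, sub_eq_add_neg]

lemma isCentered_noisePart [IsProbabilityMeasure P]
    (hℓ : ∀ x, Differentiable ℝ fun θ => ℓ θ x)
    (hC : BoundedGradients ℓ D H C) {σ : ℝ} (hσ : BoundedVariance ℓ D H σ) (hb : 1 ≤ b)
    (hbm : b ≤ m) {t : ℕ} (ht : t + 1 < T) (s : Source n) :
    IsCentered (ex.otherSources t (some s)) (ex.noisePart t s) P := by
  rcases s with i | p | i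
  · by_cases hi : i ∈ H
    · exact (ex.isCentered_batchErr hℓ hC hσ hb hbm hi ht).1.smul _
    · have : ex.noisePart t (.inl i) = fun _ => 0 := by
        ext1 ω; simp [noisePart, unitWeights, hi]
      rw [this]
      exact isCentered_zero
  · exact (ex.isCentered_corNoise ht p).smul _
  · exact (ex.isCentered_indNoise ht i).smul _

lemma measurable_noisePart (hC : BoundedGradients ℓ D H C) {t : ℕ} (ht : t + 1 < T)
    (s : Source n) (h1 : ex.ℱ t ≤ 𝒜)
    (h2 : ex.sourceAlgebra t (some s) ≤ 𝒜) : Measurable[𝒜] (ex.noisePart t s) := by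
  rcases s with i | p | i
  · by_cases hi : i ∈ H
    · exact (ex.measurable_batchErr hC hi ht h1 h2).const_smul (unitWeights H i)
    · have : ex.noisePart t (.inl i) = fun _ => 0 := by
        ext1 ω; simp [noisePart, unitWeights, hi]
      rw [this]
      exact measurable_const
  · have : Measurable[𝒜] (ex.corNoise (t + 1) p.1.1 p.1.2) := measurable_iff_comap_le.2 h2
    exact this.const_smul (unitWeights H p.1.1 - unitWeights H p.1.2)
  · have : Measurable[𝒜] (ex.indNoise (t + 1) i) := measurable_iff_comap_le.2 h2
    exact this.const_smul (unitWeights H i)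

lemma isCentered_meanNoise [IsProbabilityMeasure P]
    (hℓ : ∀ x, Differentiable ℝ fun θ => ℓ θ x)
    (hC : BoundedGradients ℓ D H C) {σ : ℝ} (hσ : BoundedVariance ℓ D H σ) (hb : 1 ≤ b)
    (hbm : b ≤ m) {t : ℕ} (ht : t + 1 < T) :
    IsCentered (ex.ℱ t) (ex.meanNoise (t + 1)) P := by
  rw [show ex.meanNoise (t + 1) = fun ω => ∑ s, (H.card : ℝ)⁻¹ • ex.noisePart t s ω from
    funext (ex.sum_noisePart ht)]
  exact isCentered_sum _ fun s _ => ((ex.isCentered_noisePart hℓ hC hσ hb hbm ht s).smul _).mono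
    (ex.history_le_otherSources t s)

/-- Each part is centered given the history and all other sources, hence the parts are pairwise
orthogonal and their second moments add up. Orthogonality suffices here: the mini-batch errors are
not independent of one another, since they share θ. -/
lemma integral_sq_norm_meanNoise_le [IsProbabilityMeasure P]
    (hℓ : ∀ x, Differentiable ℝ fun θ => ℓ θ x)
    (hC : BoundedGradients ℓ D H C) {σ : ℝ} (hσ : BoundedVariance ℓ D H σ) (hb : 1 ≤ b)
    (hbm : b ≤ m) (hf : 2 * f < n) (hH : H.card = n - f) {t : ℕ} (ht : t + 1 < T) :
    ∫ ω, ‖ex.meanNoise (t + 1) ω‖ ^ 2 ∂P ≤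
      (batchVariance m b σ + d * (f * sCor ^ 2 + sInd ^ 2)) / ((n : ℝ) - f) := by
  have hcard : (H.card : ℝ) = n - f := by rw [hH, Nat.cast_sub (by omega)]
  have hpos : (0 : ℝ) < H.card := by exact_mod_cast (show 0 < H.card by omega)
  have hcent := ex.isCentered_noisePart hℓ hC hσ hb hbm ht
  have horth : ∀ s s' : Source n, s ≠ s' →
      ∫ ω, inner ℝ (ex.noisePart t s ω) (ex.noisePart t s' ω) ∂P = 0 := fun s s' hss =>
    (hcent s').2 _ (ex.measurable_noisePart hC ht s (ex.history_le_otherSources t s')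
      (ex.sourceAlgebra_le_otherSources (by simpa using hss))) (hcent s).1
  simp only [fun ω => ex.sum_noisePart ht ω, ← Finset.smul_sum, norm_smul, mul_pow]
  rw [integral_const_mul, integral_sq_norm_sum _ (fun s _ => (hcent s).1)
    fun s _ s' _ hss => horth s s' hss, Fintype.sum_sum_type, Fintype.sum_sum_type]
  have huw : ∀ i, ‖unitWeights H i‖ ^ 2 = unitWeights H i := fun i => by
    rw [unitWeights]; split_ifs <;> simp
  have h1 : ∑ i, ∫ ω, ‖ex.noisePart t (.inl i) ω‖ ^ 2 ∂P ≤ H.card * batchVariance m b σ := by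
    calc _ ≤ ∑ i, unitWeights H i • batchVariance m b σ := by
          refine Finset.sum_le_sum fun i _ => ?_
          simp only [noisePart, norm_smul, mul_pow, huw, integral_const_mul, smul_eq_mul]
          by_cases hi : i ∈ H
          · exact mul_le_mul_of_nonneg_left (ex.isCentered_batchErr hℓ hC hσ hb hbm hi ht).2
              (by rw [unitWeights, if_pos hi]; exact zero_le_one)
          · simp [unitWeights, hi]
      _ = _ := by rw [sum_unitWeights_smul]; simp
  -- The number of pairs with exactly one end in H is n |H| - |H|² = |H| f.
  have h2 : ∑ p, ∫ ω, ‖ex.noisePart t (.inr (.inl p)) ω‖ ^ 2 ∂P =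
      H.card * f * (d * sCor ^ 2) := by
    simp only [noisePart, norm_smul, mul_pow, integral_const_mul]
    rw [Finset.sum_congr rfl fun p _ => by
      rw [integral_sq_norm_of_map_gaussianNoise (ex.corNoise_law t ht _ _ p.2)],
      ← Finset.sum_mul, sum_pairs_sq_norm_sub (unitWeights H)]
    simp only [huw, sum_unitWeights]
    rw [Real.norm_natCast]
    have : (f : ℝ) = n - H.card := by rw [hcard]; ring
    rw [this]
    ring
  have h3 : ∑ i, ∫ ω, ‖ex.noisePart t (.inr (.inr i)) ω‖ ^ 2 ∂P = H.card * (d * sInd ^ 2) := by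
    simp only [noisePart, norm_smul, mul_pow, integral_const_mul, huw]
    rw [Finset.sum_congr rfl fun i _ => by
      rw [integral_sq_norm_of_map_gaussianNoise (ex.indNoise_law t ht i)],
      ← Finset.sum_mul, sum_unitWeights]
  rw [h2, h3, norm_inv, Real.norm_natCast, ← hcard, inv_pow, inv_mul_le_iff₀ (by positivity)]
  have : (H.card : ℝ) ^ 2 * ((batchVariance m b σ + d * (f * sCor ^ 2 + sInd ^ 2)) / H.card) =
      H.card * batchVariance m b σ + (H.card * f * (d * sCor ^ 2) + H.card * (d * sInd ^ 2)) := by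
    field_simp
  rw [this]
  linarith

end Execution

/-! ### Second moments of momenta of centered sequences -/

section Momentum

variable {Ω : Type*} {mΩ : MeasurableSpace Ω} {P : Measure Ω} {d T : ℕ} {β : ℕ → ℝ}
  {u : ℕ → Ω → E d} {ℱ : Filtration ℕ mΩ}

lemma measurable_momentum (hu : ∀ t, t + 1 < T → Measurable[ℱ (t + 1)] (u (t + 1))) {t : ℕ}
    (ht : t < T) : Measurable[ℱ t] (momentum β u t) := by
  induction t with
  | zero => exact measurable_const
  | succ t ih =>
    have h1 := (ih (by omega)).mono (ℱ.mono (Nat.le_succ t)) le_rfl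
    exact (h1.const_smul (β t)).add ((hu t ht).const_smul (1 - β t))

lemma memLp_momentum (hu : ∀ t, t + 1 < T → MemLp (u (t + 1)) 2 P) {t : ℕ} (ht : t < T) :
    MemLp (momentum β u t) 2 P := by
  induction t with
  | zero => exact MemLp.zero
  | succ t ih => exact ((ih (by omega)).const_smul (β t)).add ((hu t ht).const_smul (1 - β t))

/-- The new term is orthogonal to the accumulated momentum, which belongs to the past; so the second
moments obey the recursion that defines `momentumVariance`. -/
lemma integral_sq_norm_momentum_le {V : ℝ}
    (hu : ∀ t, t + 1 < T → Measurable[ℱ (t + 1)] (u (t + 1)))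
    (hc : ∀ t, t + 1 < T → IsCentered (ℱ t) (u (t + 1)) P)
    (hV : ∀ t, t + 1 < T → ∫ ω, ‖u (t + 1) ω‖ ^ 2 ∂P ≤ V) {t : ℕ} (ht : t < T) :
    ∫ ω, ‖momentum β u t ω‖ ^ 2 ∂P ≤ momentumVariance β t * V := by
  induction t with
  | zero => simp [momentum, momentumVariance]
  | succ t ih =>
    have h1 := ih (by omega)
    have h2 := ((hc t ht).smul (1 - β t)).integral_sq_norm_add
      ((measurable_momentum (β := β) hu (show t < T by omega)).const_smul (β t))
      ((memLp_momentum (β := β) (fun t ht => (hc t ht).1) (show t < T by omega)).const_smul (β t))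
    simp only [momentum]
    simp only [Pi.smul_apply, norm_smul, mul_pow, integral_const_mul, Real.norm_eq_abs,
      sq_abs] at h2
    rw [h2, momentumVariance, add_mul, mul_assoc]
    exact add_le_add (mul_le_mul_of_nonneg_left h1 (sq_nonneg _))
      (mul_le_mul_of_nonneg_left (hV t ht) (sq_nonneg _))

end Momentum

lemma sq_convex_combination_le {w x y : ℝ} (h0 : 0 ≤ w) (h1 : w ≤ 1) :
    (w * x + (1 - w) * y) ^ 2 ≤ w * x ^ 2 + (1 - w) * y ^ 2 := by
  nlinarith [mul_nonneg (mul_nonneg h0 (sub_nonneg.2 h1)) (sq_nonneg (x - y))]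

namespace Execution

variable {X : Type*} {d n m : ℕ} {ℓ : E d → X → ℝ} {D : Fin n → Fin m → X}
  {H : Finset (Fin n)} {f b : ℕ} {C : ℝ≥0∞} {sCor sInd : ℝ} {γ β : ℕ → ℝ} {θ₀ : E d} {T : ℕ}
  {Ω : Type*} [mΩ : MeasurableSpace Ω] {P : Measure Ω}
  (ex : Execution ℓ D H f b C sCor sInd γ β θ₀ T P)

/-! ### Deviation of the momenta of the honest workers -/

lemma measurable_gauss {t : ℕ} (ht : t + 1 < T) (i : Fin n) :
    Measurable[ex.ℱ (t + 1)] (ex.gauss (t + 1) i) :=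
  (Finset.measurable_fun_sum _ fun j _ => ex.corNoise_measurable t ht i j).add
    (ex.indNoise_measurable t ht i)

/-- Momentum of the noise injected by worker `i`. -/
noncomputable def gaussMomentum (t : ℕ) (i : Fin n) : Ω → E d :=
  momentum β (fun t => ex.gauss t i) t

/-- Momentum of the mini-batch errors of worker `i`. -/
noncomputable def batchMomentum (t : ℕ) (i : Fin n) : Ω → E d :=
  momentum β (fun t => ex.batchErr t i) t

/-- Momentum of the deviation of the local gradient of worker `i` from the honest gradient. -/
noncomputable def driftMomentum (t : ℕ) (i : Fin n) : Ω → E d :=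
  momentum β (fun t ω => ∇ (localLoss ℓ D i) (ex.θ t ω) - ∇ (honestLoss ℓ D H) (ex.θ t ω)) t

/-- Momentum of the honest gradients. -/
noncomputable def gradMomentum (t : ℕ) : Ω → E d :=
  momentum β (fun t ω => ∇ (honestLoss ℓ D H) (ex.θ t ω)) t

lemma msg_eq {t : ℕ} (ht : t < T) {i : Fin n} (hi : i ∈ H) (ω : Ω) :
    ex.msg t i ω = ex.gradMomentum t ω +
      (ex.driftMomentum t i ω + ex.batchMomentum t i ω + ex.gaussMomentum t i ω) := by
  induction t with
  | zero =>
    rw [ex.msg_zero i hi]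
    simp [gradMomentum, driftMomentum, batchMomentum, gaussMomentum, momentum]
  | succ t ih =>
    rw [ex.msg_succ t ht i hi, ih (by omega)]
    simp only [gradMomentum, driftMomentum, batchMomentum, gaussMomentum, momentum, batchErr,
      batchError, gauss]
    module

lemma measurable_gaussMomentum {t : ℕ} (ht : t < T) (i : Fin n) :
    Measurable[ex.ℱ t] (ex.gaussMomentum t i) :=
  measurable_momentum (fun _ ht => ex.measurable_gauss ht i) ht

/-- Exponential moments multiply over the independent sources, and the past momentum is one more
factor. The correlated noise enters through ∑ ‖aᵢ - aⱼ‖² ≤ n ∑ ‖aᵢ‖², which explains the proxy n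
σ_cor² + σ_ind². -/
lemma jointlySubGaussian_gaussMomentum [IsProbabilityMeasure P] {t : ℕ} (ht : t < T) :
    JointlySubGaussian (ex.gaussMomentum t)
      (momentumVariance β t * (n * sCor ^ 2 + sInd ^ 2)) P := by
  induction t with
  | zero =>
    intro a
    simp [gaussMomentum, momentum, momentumVariance]
  | succ t ih =>
    intro a
    -- The exponent is split over the history and the sources; mini-batches are sources too but
    -- contribute 0.
    let W : Option (Source n) → Ω → ℝ := fun s => match s with
      | none => fun ω => ∑ i, inner ℝ (β t • a i) (ex.gaussMomentum t i ω)
      | some (.inl _) => fun _ => 0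
      | some (.inr (.inl p)) => fun ω =>
          inner ℝ ((1 - β t) • (a p.1.1 - a p.1.2)) (ex.corNoise (t + 1) p.1.1 p.1.2 ω)
      | some (.inr (.inr i)) => fun ω => inner ℝ ((1 - β t) • a i) (ex.indNoise (t + 1) i ω)
    have hWm : ∀ s, Measurable[ex.sourceAlgebra t s] (W s) := by
      rintro (_ | i | p | i)
      · exact Finset.measurable_fun_sum _ fun i _ =>
          (ex.measurable_gaussMomentum (by omega) i).const_inner
      · exact measurable_const
      · exact (measurable_iff_comap_le.2 le_rfl : Measurable[ex.sourceAlgebra t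
          (some (.inr (.inl p)))] (ex.corNoise (t + 1) p.1.1 p.1.2)).const_inner
      · exact (measurable_iff_comap_le.2 le_rfl : Measurable[ex.sourceAlgebra t
          (some (.inr (.inr i)))] (ex.indNoise (t + 1) i)).const_inner
    have hexp : Measurable fun y : ℝ => ENNReal.ofReal (Real.exp y) := by fun_prop
    have hind : iIndepFun (fun s ω => ENNReal.ofReal (Real.exp (W s ω))) P := by
      rw [iIndepFun_iff_iIndep]
      exact iIndep_of_iIndep_of_le (ex.iIndep_sourceAlgebra ht) fun s =>
        measurable_iff_comap_le.1 (hexp.comp (hWm s))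
    have hsum : ∀ ω, ∑ i, inner ℝ (a i) (ex.gaussMomentum (t + 1) i ω) = ∑ s, W s ω := by
      intro ω
      have h1 : ∀ i, inner ℝ (a i) (ex.gaussMomentum (t + 1) i ω) =
          inner ℝ (β t • a i) (ex.gaussMomentum t i ω)
            + inner ℝ ((1 - β t) • a i) (ex.gauss (t + 1) i ω) := fun i => by
        rw [gaussMomentum, momentum, inner_add_right, real_inner_smul_right,
          real_inner_smul_right, real_inner_smul_left, real_inner_smul_left]
        rfl
      simp only [h1, Finset.sum_add_distrib]
      rw [ex.sum_inner_gauss ht (fun i => (1 - β t) • a i), Fintype.sum_option,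
        Fintype.sum_sum_type, Fintype.sum_sum_type]
      simp only [W, Finset.sum_const_zero, zero_add, smul_sub]
    have hprod : ∀ ω, ENNReal.ofReal (Real.exp (∑ s, W s ω)) =
        ∏ s, ENNReal.ofReal (Real.exp (W s ω)) := fun ω => by
      rw [Real.exp_sum, ENNReal.ofReal_prod_of_nonneg fun s _ => (Real.exp_pos _).le]
    simp only [hsum, hprod]
    rw [lintegral_prod_eq_prod_lintegral_of_indepFun _ _ hind fun s =>
      (hexp.comp (hWm s)).mono (ex.sourceAlgebra_le ht s) le_rfl, Fintype.prod_option,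
      Fintype.prod_sum_type, Fintype.prod_sum_type]
    have h0 := ih (by omega) (fun i => β t • a i)
    simp only [W, lintegral_exp_inner_of_map_gaussianNoise (ex.indNoise_law t ht _)]
    rw [Finset.prod_congr rfl fun p _ =>
      lintegral_exp_inner_of_map_gaussianNoise (ex.corNoise_law t ht _ _ p.2) _]
    rw [← ENNReal.ofReal_prod_of_nonneg fun _ _ => (Real.exp_pos _).le,
      ← ENNReal.ofReal_prod_of_nonneg fun _ _ => (Real.exp_pos _).le, ← Real.exp_sum,
      ← Real.exp_sum]
    simp only [Real.exp_zero, ENNReal.ofReal_one, lintegral_const, measure_univ, mul_one,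
      Finset.prod_const_one, one_mul, ← Finset.mul_sum]
    refine (mul_le_mul_left h0 _).trans ?_
    rw [← ENNReal.ofReal_mul (Real.exp_pos _).le, ← ENNReal.ofReal_mul (Real.exp_pos _).le,
      ← Real.exp_add, ← Real.exp_add]
    refine ENNReal.ofReal_le_ofReal (Real.exp_le_exp.2 ?_)
    simp only [norm_smul, mul_pow, Real.norm_eq_abs, sq_abs, ← Finset.mul_sum]
    rw [sum_pairs_sq_norm_sub, momentumVariance]
    have h2 : 0 ≤ sCor ^ 2 / 2 * ((1 - β t) ^ 2 * ‖∑ i, a i‖ ^ 2) := by positivity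
    nlinarith [h2]

/-- Convexity of the square: a momentum is a sub-convex combination of past values, so a directional
second-moment bound valid at every θ survives, pathwise and without damping. -/
lemma mean_sq_inner_driftMomentum_le (hβ : ∀ t, β t ∈ Set.Icc (0 : ℝ) 1) {G : ℝ}
    (hG : BoundedHeterogeneity ℓ D H G) (t : ℕ) (ω : Ω) {v : E d} (hv : ‖v‖ ≤ 1) :
    (H.card : ℝ)⁻¹ * ∑ i ∈ H, (inner ℝ v (ex.driftMomentum t i ω)) ^ 2 ≤ G ^ 2 := by
  induction t with
  | zero => simp [driftMomentum, momentum, sq_nonneg]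
  | succ t ih =>
    have h1 := hG (ex.θ (t + 1) ω) v hv
    have hβ0 := (hβ t).1
    have hβ1 := (hβ t).2
    calc _ ≤ (H.card : ℝ)⁻¹ * ∑ i ∈ H, (β t * (inner ℝ v (ex.driftMomentum t i ω)) ^ 2
          + (1 - β t) * (inner ℝ v (∇ (localLoss ℓ D i) (ex.θ (t + 1) ω)
            - ∇ (honestLoss ℓ D H) (ex.θ (t + 1) ω))) ^ 2) := by
          refine mul_le_mul_of_nonneg_left (Finset.sum_le_sum fun i _ => ?_) (by positivity)
          rw [driftMomentum, momentum, inner_add_right, real_inner_smul_right,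
            real_inner_smul_right]
          exact sq_convex_combination_le hβ0 hβ1
      _ = β t * ((H.card : ℝ)⁻¹ * ∑ i ∈ H, (inner ℝ v (ex.driftMomentum t i ω)) ^ 2)
          + (1 - β t) * ((H.card : ℝ)⁻¹ * ∑ i ∈ H, (inner ℝ v
            (∇ (localLoss ℓ D i) (ex.θ (t + 1) ω)
              - ∇ (honestLoss ℓ D H) (ex.θ (t + 1) ω))) ^ 2) := by
          rw [Finset.sum_add_distrib, ← Finset.mul_sum, ← Finset.mul_sum]
          ring
      _ ≤ β t * G ^ 2 + (1 - β t) * G ^ 2 :=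
          add_le_add (mul_le_mul_of_nonneg_left ih hβ0)
            (mul_le_mul_of_nonneg_left h1 (by linarith))
      _ = G ^ 2 := by ring

lemma nontrivial (hT : 1 ≤ T) (ω : Ω) (ex : Execution ℓ D H f b C sCor sInd γ β θ₀ T P) :
    Nontrivial (E d) := by
  obtain ⟨c, v, -, -, hv, -⟩ := ex.agg_spec 0 (by omega) ω
  exact (hv 0).nontrivial

lemma lambdaMax_msg_le [Nontrivial (E d)] (hβ : ∀ t, β t ∈ Set.Icc (0 : ℝ) 1) {G : ℝ}
    (hG : BoundedHeterogeneity ℓ D H G) (hH : 0 < H.card) {t : ℕ} (ht : t < T) (ω : Ω) {B : ℝ}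
    (hB : ∀ v : E d, ‖v‖ = 1 → ∑ i, (inner ℝ v (ex.gaussMomentum t i ω)) ^ 2 ≤ B) :
    lambdaMax (weightedCov (unitWeights H) fun i => ex.msg t i ω) ≤
      3 * G ^ 2 + 3 * ((H.card : ℝ)⁻¹ * ∑ i ∈ H, ‖ex.batchMomentum t i ω‖ ^ 2)
        + 3 * ((H.card : ℝ)⁻¹ * B) := by
  have hpos : (0 : ℝ) < H.card := by exact_mod_cast hH
  refine lambdaMax_le fun v hv => ?_
  have hsum : ∀ y : Fin n → ℝ, ∑ i, unitWeights H i * y i = ∑ i ∈ H, y i :=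
    sum_unitWeights_smul H
  -- The momenta are centered at the momentum of the honest gradients, common to all workers,
  -- instead of at their mean; this can only increase the second moment.
  have h1 := sum_mul_inner_sub_sq (c := unitWeights H) (by rw [sum_unitWeights]; exact hpos.ne')
    (fun i => ex.msg t i ω) v (ex.gradMomentum t ω)
  rw [sum_unitWeights] at h1
  rw [directionalVariance, sum_unitWeights]
  have h2 : ∑ i, unitWeights H i * (inner ℝ v (ex.msg t i ω
      - weightedMean (unitWeights H) fun i => ex.msg t i ω)) ^ 2 ≤
      ∑ i ∈ H, (inner ℝ v (ex.msg t i ω - ex.gradMomentum t ω)) ^ 2 := by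
    rw [← hsum, h1]
    exact le_add_of_nonneg_right (by positivity)
  have h3 : ∑ i ∈ H, (inner ℝ v (ex.msg t i ω - ex.gradMomentum t ω)) ^ 2 ≤
      ∑ i ∈ H, (3 * (inner ℝ v (ex.driftMomentum t i ω)) ^ 2
        + 3 * ‖ex.batchMomentum t i ω‖ ^ 2
        + 3 * (inner ℝ v (ex.gaussMomentum t i ω)) ^ 2) := by
    refine Finset.sum_le_sum fun i hi => ?_
    rw [ex.msg_eq ht hi, add_sub_cancel_left, inner_add_right, inner_add_right]
    have h4 : (inner ℝ v (ex.batchMomentum t i ω)) ^ 2 ≤ ‖ex.batchMomentum t i ω‖ ^ 2 := by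
      rw [sq_le_sq, abs_norm]
      exact (abs_real_inner_le_norm _ _).trans (by rw [hv, one_mul])
    set x : ℝ := inner ℝ v (ex.driftMomentum t i ω)
    set y : ℝ := inner ℝ v (ex.batchMomentum t i ω)
    set z : ℝ := inner ℝ v (ex.gaussMomentum t i ω)
    nlinarith [sq_nonneg (x - y), sq_nonneg (x - z), sq_nonneg (y - z)]
  have h5 := ex.mean_sq_inner_driftMomentum_le hβ hG t ω hv.le
  have h6 : ∑ i ∈ H, (inner ℝ v (ex.gaussMomentum t i ω)) ^ 2 ≤ B :=
    (Finset.sum_le_sum_of_subset_of_nonneg (Finset.subset_univ H)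
      fun _ _ _ => sq_nonneg _).trans (hB v hv)
  calc _ ≤ (H.card : ℝ)⁻¹ * ∑ i ∈ H, (3 * (inner ℝ v (ex.driftMomentum t i ω)) ^ 2
        + 3 * ‖ex.batchMomentum t i ω‖ ^ 2
        + 3 * (inner ℝ v (ex.gaussMomentum t i ω)) ^ 2) :=
        mul_le_mul_of_nonneg_left (h2.trans h3) (by positivity)
    _ = 3 * ((H.card : ℝ)⁻¹ * ∑ i ∈ H, (inner ℝ v (ex.driftMomentum t i ω)) ^ 2)
        + 3 * ((H.card : ℝ)⁻¹ * ∑ i ∈ H, ‖ex.batchMomentum t i ω‖ ^ 2)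
        + 3 * ((H.card : ℝ)⁻¹ * ∑ i ∈ H, (inner ℝ v (ex.gaussMomentum t i ω)) ^ 2) := by
        rw [Finset.sum_add_distrib, Finset.sum_add_distrib, ← Finset.mul_sum, ← Finset.mul_sum,
          ← Finset.mul_sum]
        ring
    _ ≤ _ := by
        have := mul_le_mul_of_nonneg_left h6 (inv_nonneg.2 hpos.le)
        linarith

lemma measurable_batchErr_succ (hC : BoundedGradients ℓ D H C) {i : Fin n} (hi : i ∈ H) {t : ℕ}
    (ht : t + 1 < T) : Measurable[ex.ℱ (t + 1)] (ex.batchErr (t + 1) i) :=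
  ex.measurable_batchErr hC hi ht (ex.ℱ.mono (Nat.le_succ t))
    (measurable_iff_comap_le.1 (ex.batch_measurable t ht i))

lemma isCentered_batchErr_succ [IsProbabilityMeasure P] (hℓ : ∀ x, Differentiable ℝ fun θ => ℓ θ x)
    (hC : BoundedGradients ℓ D H C) {σ : ℝ} (hσ : BoundedVariance ℓ D H σ) (hb : 1 ≤ b)
    (hbm : b ≤ m) {i : Fin n} (hi : i ∈ H) {t : ℕ} (ht : t + 1 < T) :
    IsCentered (ex.ℱ t) (ex.batchErr (t + 1) i) P :=
  (ex.isCentered_batchErr hℓ hC hσ hb hbm hi ht).1.mono (ex.history_le_otherSources t _)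

lemma memLp_batchMomentum [IsProbabilityMeasure P] (hℓ : ∀ x, Differentiable ℝ fun θ => ℓ θ x)
    (hC : BoundedGradients ℓ D H C) {σ : ℝ} (hσ : BoundedVariance ℓ D H σ) (hb : 1 ≤ b)
    (hbm : b ≤ m) {i : Fin n} (hi : i ∈ H) {t : ℕ} (ht : t < T) :
    MemLp (ex.batchMomentum t i) 2 P := by
  rw [batchMomentum]
  exact memLp_momentum (u := fun t => ex.batchErr t i)
    (fun t ht => (ex.isCentered_batchErr_succ hℓ hC hσ hb hbm hi ht).1) ht

lemma integral_sq_norm_batchMomentum_le [IsProbabilityMeasure P]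
    (hℓ : ∀ x, Differentiable ℝ fun θ => ℓ θ x)
    (hC : BoundedGradients ℓ D H C) {σ : ℝ} (hσ : BoundedVariance ℓ D H σ) (hb : 1 ≤ b)
    (hbm : b ≤ m) {i : Fin n} (hi : i ∈ H) {t : ℕ} (ht : t < T) :
    ∫ ω, ‖ex.batchMomentum t i ω‖ ^ 2 ∂P ≤ momentumVariance β t * batchVariance m b σ := by
  rw [batchMomentum]
  exact integral_sq_norm_momentum_le (u := fun t => ex.batchErr t i) (ℱ := ex.ℱ)
    (fun t ht => ex.measurable_batchErr_succ hC hi ht)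
    (fun t ht => ex.isCentered_batchErr_succ hℓ hC hσ hb hbm hi ht)
    (fun t ht => (ex.isCentered_batchErr hℓ hC hσ hb hbm hi ht).2) ht

/-- The largest eigenvalue of the covariance of the honest messages has an integrable bound. -/
lemma exists_lambdaMax_msg_bound [IsProbabilityMeasure P]
    (hℓ : ∀ x, Differentiable ℝ fun θ => ℓ θ x)
    (hC : BoundedGradients ℓ D H C) {σ : ℝ} (hσ : BoundedVariance ℓ D H σ) (hb : 1 ≤ b)
    (hbm : b ≤ m) (hf : 2 * f < n) (hH : H.card = n - f)
    (hβ : ∀ t, β t ∈ Set.Icc (0 : ℝ) 1) {G : ℝ} (hG : BoundedHeterogeneity ℓ D H G)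
    {t : ℕ} (ht : t < T) {s : ℝ} (hs0 : 0 < s)
    (hs : momentumVariance β t * (n * sCor ^ 2 + sInd ^ 2) ≤ s) :
    ∃ Ψ : Ω → ℝ, Integrable Ψ P ∧
      ∫ ω, Ψ ω ∂P ≤ 3 * G ^ 2 + 3 * (momentumVariance β t * batchVariance m b σ)
        + 72 * s * (1 + d / ((n : ℝ) - f)) ∧
      ∀ ω, lambdaMax (weightedCov (unitWeights H) fun i => ex.msg t i ω) ≤ Ψ ω := by
  have hcard : (H.card : ℝ) = n - f := by rw [hH, Nat.cast_sub (by omega)]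
  have hH0 : 0 < H.card := by omega
  have hpos : (0 : ℝ) < H.card := by exact_mod_cast hH0
  have hsub : JointlySubGaussian (ex.gaussMomentum t) s P := fun a =>
    (ex.jointlySubGaussian_gaussMomentum ht a).trans (ENNReal.ofReal_le_ofReal
      (Real.exp_le_exp.2 (mul_le_mul_of_nonneg_right (by linarith) (by positivity))))
  obtain ⟨Φ, hΦi, hΦ, hΦb⟩ := hsub.exists_uniform_bound
    (fun i => (ex.measurable_gaussMomentum ht i).mono (ex.ℱ.le t) le_rfl) hs0
  have hb2 : ∀ i ∈ H, Integrable (fun ω => ‖ex.batchMomentum t i ω‖ ^ 2) P := fun i hi =>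
    integrable_sq_norm (ex.memLp_batchMomentum hℓ hC hσ hb hbm hi ht)
  have hbV : ∀ i ∈ H, ∫ ω, ‖ex.batchMomentum t i ω‖ ^ 2 ∂P ≤
      momentumVariance β t * batchVariance m b σ := fun i hi =>
    ex.integral_sq_norm_batchMomentum_le hℓ hC hσ hb hbm hi ht
  have hi1 : Integrable (fun ω => 3 * ((H.card : ℝ)⁻¹ * ∑ i ∈ H, ‖ex.batchMomentum t i ω‖ ^ 2)) P :=
    ((integrable_finsetSum _ hb2).const_mul _).const_mul _
  have hi2 : Integrable (fun ω => 3 * ((H.card : ℝ)⁻¹ * Φ ω)) P := (hΦi.const_mul _).const_mul _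
  have hi0 : Integrable (fun ω => 3 * G ^ 2
      + 3 * ((H.card : ℝ)⁻¹ * ∑ i ∈ H, ‖ex.batchMomentum t i ω‖ ^ 2)) P :=
    (integrable_const _).add hi1
  refine ⟨fun ω => 3 * G ^ 2 + 3 * ((H.card : ℝ)⁻¹ * ∑ i ∈ H, ‖ex.batchMomentum t i ω‖ ^ 2)
    + 3 * ((H.card : ℝ)⁻¹ * Φ ω), hi0.add hi2, ?_, fun ω => ?_⟩
  · rw [integral_add hi0 hi2, integral_add (integrable_const _) hi1]
    simp only [integral_const_mul, integral_const, probReal_univ, one_smul]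
    rw [integral_finsetSum _ hb2]
    have h1 : (H.card : ℝ)⁻¹ * ∑ i ∈ H, ∫ ω, ‖ex.batchMomentum t i ω‖ ^ 2 ∂P ≤
        momentumVariance β t * batchVariance m b σ := by
      rw [inv_mul_le_iff₀ hpos, ← nsmul_eq_mul]
      exact Finset.sum_le_card_nsmul _ _ _ hbV
    have h2 : (H.card : ℝ)⁻¹ * ∫ ω, Φ ω ∂P ≤ 24 * s * (1 + d / H.card) := by
      rw [inv_mul_le_iff₀ hpos]
      refine hΦ.trans ?_
      -- Since 2f < n, the noise of all n workers is comparable to that of the honest ones; this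
      -- doubles 12 to 24.
      have h3 : (Fintype.card (Fin n) : ℝ) ≤ 2 * H.card := by
        rw [Fintype.card_fin, hcard]
        have : (2 : ℝ) * f < n := by exact_mod_cast hf
        linarith
      have h4 : (H.card : ℝ) * (24 * s * (1 + d / H.card)) = 12 * s * (2 * H.card + 2 * d) := by
        field_simp
        ring
      rw [h4]
      refine mul_le_mul_of_nonneg_left ?_ (by positivity)
      have : (0 : ℝ) ≤ d := Nat.cast_nonneg d
      linarith
    rw [← hcard]
    linarith
  · have := ex.nontrivial (by omega) ω
    exact ex.lambdaMax_msg_le hβ hG hH0 ht ω fun v hv => hΦb ω v hv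

end Execution

/-- The standing assumptions on the losses and the parameters. -/
structure IsAdmissible {X : Type*} {d n m : ℕ} (ℓ : E d → X → ℝ) (D : Fin n → Fin m → X)
    (H : Finset (Fin n)) (f b : ℕ) (C : ℝ≥0∞) (L G σ : ℝ) : Prop where
  two_mul_lt : 2 * f < n
  one_le_batch : 1 ≤ b
  batch_le : b ≤ m
  card_honest : H.card = n - f
  differentiable : ∀ x, Differentiable ℝ fun θ => ℓ θ x
  pos : 0 < L
  heterogeneity : BoundedHeterogeneity ℓ D H G
  variance : BoundedVariance ℓ D H σ
  gradients : BoundedGradients ℓ D H C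
  smooth : IsSmooth L (honestLoss ℓ D H)

lemma batchVariance_nonneg {m b : ℕ} (hbm : b ≤ m) (σ : ℝ) : 0 ≤ batchVariance m b σ := by
  have h : (b : ℝ) / m ≤ 1 := div_le_one_of_le₀ (by exact_mod_cast hbm) (Nat.cast_nonneg m)
  exact mul_nonneg (by linarith) (by positivity)

lemma IsSmooth.memLp_gradient_comp {Ω : Type*} {mΩ : MeasurableSpace Ω} {P : Measure Ω}
    [IsProbabilityMeasure P] {d : ℕ} {L : ℝ} {F : E d → ℝ} (hF : IsSmooth L F)
    {U : Ω → E d} (hU : MemLp U 2 P) : MemLp (fun ω => ∇ F (U ω)) 2 P := by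
  have h0 : MemLp (fun _ : Ω => ‖∇ F 0‖) 2 P := memLp_const _
  have h1 : MemLp (fun ω => ‖∇ F 0‖ + L * ‖U ω‖) 2 P := h0.add (hU.norm.const_mul L)
  refine h1.mono' ((measurable_gradient _).comp_aemeasurable
    hU.1.aemeasurable).aestronglyMeasurable (Filter.Eventually.of_forall fun ω => ?_)
  have h2 := hF 0 (U ω)
  rw [sub_zero] at h2
  exact (norm_le_norm_add_norm_sub' _ _).trans (add_le_add_right h2 _)

namespace IsAdmissible

variable {X : Type*} {d n m : ℕ} {ℓ : E d → X → ℝ} {D : Fin n → Fin m → X}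
  {H : Finset (Fin n)} {f b : ℕ} {C : ℝ≥0∞} {L G σ : ℝ}

lemma cast_card (hA : IsAdmissible ℓ D H f b C L G σ) : (H.card : ℝ) = n - f := by
  have := hA.two_mul_lt
  rw [hA.card_honest, Nat.cast_sub (by omega)]

lemma card_pos (hA : IsAdmissible ℓ D H f b C L G σ) : 0 < H.card := by
  have := hA.two_mul_lt
  rw [hA.card_honest]
  omega

lemma sub_pos (hA : IsAdmissible ℓ D H f b C L G σ) : (0 : ℝ) < n - f := by
  rw [← hA.cast_card]
  exact_mod_cast hA.card_pos

lemma differentiable_loss (hA : IsAdmissible ℓ D H f b C L G σ) :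
    Differentiable ℝ (honestLoss ℓ D H) :=
  differentiable_honestLoss hA.differentiable

lemma mean_noise_le (hA : IsAdmissible ℓ D H f b C L G σ) {κ : ℝ} (hκ : 0 ≤ κ) (sCor sInd : ℝ) :
    (batchVariance m b σ + d * (f * sCor ^ 2 + sInd ^ 2)) / ((n : ℝ) - f) ≤
      totalVariance d n m f b κ σ sCor sInd := by
  have h1 := batchVariance_nonneg hA.batch_le σ
  have h2 := hA.sub_pos
  exact le_add_of_nonneg_right (by positivity)

lemma deviation_le (hA : IsAdmissible ℓ D H f b C L G σ) (κ sCor sInd : ℝ) :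
    4 * κ * (batchVariance m b σ
      + 108 * (n * sCor ^ 2 + sInd ^ 2) * (1 + d / ((n : ℝ) - f))) ≤
      totalVariance d n m f b κ σ sCor sInd := by
  have h1 := batchVariance_nonneg hA.batch_le σ
  have h2 := hA.sub_pos
  exact le_add_of_nonneg_left (by positivity)

lemma totalVariance_nonneg (hA : IsAdmissible ℓ D H f b C L G σ) {κ : ℝ} (hκ : 0 ≤ κ)
    (sCor sInd : ℝ) : 0 ≤ totalVariance d n m f b κ σ sCor sInd := by
  have h1 := batchVariance_nonneg hA.batch_le σ
  have h2 := hA.sub_pos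
  exact le_trans (by positivity) (hA.mean_noise_le hκ sCor sInd)

end IsAdmissible

namespace Execution

variable {X : Type*} {d n m : ℕ} {ℓ : E d → X → ℝ} {D : Fin n → Fin m → X}
  {H : Finset (Fin n)} {f b : ℕ} {C : ℝ≥0∞} {sCor sInd : ℝ} {γ β : ℕ → ℝ} {θ₀ : E d} {T : ℕ}
  {Ω : Type*} [mΩ : MeasurableSpace Ω] {P : Measure Ω} {L G σ κ : ℝ}
  (ex : Execution ℓ D H f b C sCor sInd γ β θ₀ T P)

/-! ### Mean of the honest messages and the error of the aggregation -/

/-- Mean of the honest messages. -/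
noncomputable def meanMsg (t : ℕ) (ω : Ω) : E d :=
  weightedMean (unitWeights H) fun i => ex.msg t i ω

/-- Error of the aggregate as an approximation of the mean of the honest messages. -/
noncomputable def aggErr (t : ℕ) (ω : Ω) : E d := ex.agg t ω - ex.meanMsg t ω

/-- Deviation of the mean of the honest messages from the honest gradient. -/
noncomputable def gradErr (t : ℕ) (ω : Ω) : E d :=
  ex.meanMsg t ω - ∇ (honestLoss ℓ D H) (ex.θ t ω)

lemma meanMsg_eq (t : ℕ) (ω : Ω) :
    ex.meanMsg t ω = (H.card : ℝ)⁻¹ • ∑ i ∈ H, ex.msg t i ω := by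
  rw [meanMsg, weightedMean, sum_unitWeights, sum_unitWeights_smul]

lemma meanMsg_zero (ω : Ω) : ex.meanMsg 0 ω = 0 := by
  rw [meanMsg_eq, Finset.sum_eq_zero fun i hi => ex.msg_zero i hi ω, smul_zero]

lemma meanMsg_succ (hA : IsAdmissible ℓ D H f b C L G σ) {t : ℕ} (ht : t + 1 < T) (ω : Ω) :
    ex.meanMsg (t + 1) ω = β t • ex.meanMsg t ω + (1 - β t) •
      (∇ (honestLoss ℓ D H) (ex.θ (t + 1) ω) + ex.meanNoise (t + 1) ω) := by
  have hc : (H.card : ℝ) ≠ 0 := by exact_mod_cast hA.card_pos.ne'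
  have h0 := sum_gradient_sub (D := D) hA.card_pos.ne' hA.differentiable (ex.θ (t + 1) ω)
  rw [Finset.sum_sub_distrib, sub_eq_zero, Finset.sum_const, ← Nat.cast_smul_eq_nsmul ℝ] at h0
  have h1 : ∀ i ∈ H, ex.msg (t + 1) i ω = β t • ex.msg t i ω + (1 - β t) •
      (∇ (localLoss ℓ D i) (ex.θ (t + 1) ω)
        + (ex.batchErr (t + 1) i ω + ex.gauss (t + 1) i ω)) := fun i hi => by
    rw [ex.msg_succ t ht i hi, batchErr, batchError, gauss]
    module
  rw [meanMsg_eq, Finset.sum_congr rfl h1, Finset.sum_add_distrib, ← Finset.smul_sum,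
    ← Finset.smul_sum, Finset.sum_add_distrib, h0, meanMsg_eq, meanNoise, smul_add,
    smul_comm _ (β t), smul_comm _ (1 - β t), smul_add (H.card : ℝ)⁻¹, inv_smul_smul₀ hc]

lemma measurable_meanNoise (hA : IsAdmissible ℓ D H f b C L G σ) {t : ℕ} (ht : t + 1 < T) :
    Measurable[ex.ℱ (t + 1)] (ex.meanNoise (t + 1)) := by
  have h : Measurable[ex.ℱ (t + 1)] fun ω =>
      ∑ i ∈ H, (ex.batchErr (t + 1) i ω + ex.gauss (t + 1) i ω) :=
    Finset.measurable_fun_sum _ fun i hi =>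
      (ex.measurable_batchErr_succ hA.gradients hi ht).add (ex.measurable_gauss ht i)
  exact h.const_smul (H.card : ℝ)⁻¹

lemma measurable_gradient_θ {t : ℕ} (ht : t ≤ T) :
    Measurable[ex.ℱ t] fun ω => ∇ (honestLoss ℓ D H) (ex.θ t ω) :=
  (measurable_gradient _).comp (ex.measurable_θ ht)

lemma measurable_gradient_θ_succ {t : ℕ} (ht : t < T) :
    Measurable[ex.ℱ t] fun ω => ∇ (honestLoss ℓ D H) (ex.θ (t + 1) ω) :=
  (measurable_gradient _).comp (ex.measurable_θ_succ ht)

lemma measurable_meanMsg (hA : IsAdmissible ℓ D H f b C L G σ) {t : ℕ} (ht : t < T) :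
    Measurable[ex.ℱ t] (ex.meanMsg t) := by
  induction t with
  | zero =>
    rw [show ex.meanMsg 0 = fun _ => 0 from funext ex.meanMsg_zero]
    exact measurable_const
  | succ t ih =>
    rw [show ex.meanMsg (t + 1) = _ from funext (ex.meanMsg_succ hA ht)]
    exact (((ih (by omega)).mono (ex.ℱ.mono (Nat.le_succ t)) le_rfl).const_smul (β t)).add
      (((ex.measurable_gradient_θ ht.le).add (ex.measurable_meanNoise hA ht)).const_smul
        (1 - β t))

lemma measurable_aggErr (hA : IsAdmissible ℓ D H f b C L G σ) {t : ℕ} (ht : t < T) :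
    Measurable[ex.ℱ t] (ex.aggErr t) :=
  (ex.agg_measurable t ht).sub (ex.measurable_meanMsg hA ht)

lemma sq_norm_aggErr_le (hA : IsAdmissible ℓ D H f b C L G σ)
    (hκ : IsRobustnessCoefficient d n f κ) {t : ℕ} (ht : t < T) (ω : Ω) :
    ‖ex.aggErr t ω‖ ^ 2 ≤
      κ * lambdaMax (weightedCov (unitWeights H) fun i => ex.msg t i ω) :=
  hκ.2 _ _ (ex.agg_spec t ht ω) H hA.card_honest

lemma exists_sq_norm_aggErr_bound [IsProbabilityMeasure P]
    (hA : IsAdmissible ℓ D H f b C L G σ) (hκ : IsRobustnessCoefficient d n f κ)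
    (hβ : ∀ t, β t ∈ Set.Icc (0 : ℝ) 1) {t : ℕ} (ht : t < T) {s : ℝ} (hs0 : 0 < s)
    (hs : momentumVariance β t * (n * sCor ^ 2 + sInd ^ 2) ≤ s) :
    MemLp (ex.aggErr t) 2 P ∧ ∫ ω, ‖ex.aggErr t ω‖ ^ 2 ∂P ≤
      κ * (3 * G ^ 2 + 3 * (momentumVariance β t * batchVariance m b σ)
        + 72 * s * (1 + d / ((n : ℝ) - f))) := by
  obtain ⟨Ψ, hΨi, hΨ, hb⟩ := ex.exists_lambdaMax_msg_bound hA.differentiable hA.gradients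
    hA.variance hA.one_le_batch hA.batch_le hA.two_mul_lt hA.card_honest hβ hA.heterogeneity ht
    hs0 hs
  have hle : ∀ ω, ‖ex.aggErr t ω‖ ^ 2 ≤ κ * Ψ ω := fun ω =>
    (ex.sq_norm_aggErr_le hA hκ ht ω).trans (mul_le_mul_of_nonneg_left (hb ω) hκ.1)
  have hm : Measurable (ex.aggErr t) := (ex.measurable_aggErr hA ht).mono (ex.ℱ.le t) le_rfl
  have hi : Integrable (fun ω => ‖ex.aggErr t ω‖ ^ 2) P :=
    (hΨi.const_mul κ).mono' (hm.norm.pow_const 2).aestronglyMeasurable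
      (Filter.Eventually.of_forall fun ω => by
        rw [Real.norm_of_nonneg (sq_nonneg _)]
        exact hle ω)
  refine ⟨(memLp_two_iff_integrable_sq_norm hm.aestronglyMeasurable).2 hi, ?_⟩
  calc _ ≤ ∫ ω, κ * Ψ ω ∂P := integral_mono hi (hΨi.const_mul κ) hle
    _ = κ * ∫ ω, Ψ ω ∂P := integral_const_mul _ _
    _ ≤ _ := mul_le_mul_of_nonneg_left hΨ hκ.1

lemma memLp_aggErr [IsProbabilityMeasure P]
    (hA : IsAdmissible ℓ D H f b C L G σ) (hκ : IsRobustnessCoefficient d n f κ)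
    (hβ : ∀ t, β t ∈ Set.Icc (0 : ℝ) 1) {t : ℕ} (ht : t < T) : MemLp (ex.aggErr t) 2 P :=
  (ex.exists_sq_norm_aggErr_bound hA hκ hβ ht
    (s := |momentumVariance β t * (n * sCor ^ 2 + sInd ^ 2)| + 1) (by positivity)
    ((le_abs_self _).trans (by linarith))).1

lemma integral_sq_norm_aggErr_le [IsProbabilityMeasure P]
    (hA : IsAdmissible ℓ D H f b C L G σ) (hκ : IsRobustnessCoefficient d n f κ)
    (hβ : ∀ t, β t ∈ Set.Icc (0 : ℝ) 1) {t : ℕ} (ht : t < T) :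
    ∫ ω, ‖ex.aggErr t ω‖ ^ 2 ∂P ≤ 3 * κ * G ^ 2
      + 3 / 4 * momentumVariance β t * totalVariance d n m f b κ σ sCor sInd := by
  set ν := momentumVariance β t with hν
  set Λ : ℝ := n * sCor ^ 2 + sInd ^ 2 with hΛ
  set a : ℝ := 1 + d / ((n : ℝ) - f) with ha
  have hν0 : 0 ≤ ν := momentumVariance_nonneg β t
  have hΛ0 : 0 ≤ Λ := by positivity
  have hnf := hA.sub_pos
  have ha0 : 0 < a := by positivity
  have h1 : ∫ ω, ‖ex.aggErr t ω‖ ^ 2 ∂P ≤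
      κ * (3 * G ^ 2 + 3 * (ν * batchVariance m b σ) + 72 * (ν * Λ) * a) := by
    -- The sub-Gaussian estimate needs a positive proxy, while ν Λ may vanish; an ε is added and
    -- removed. The denominator κ + 1 allows κ = 0.
    refine le_of_forall_pos_le_add fun ε hε => ?_
    have hκ1 : (0 : ℝ) < κ + 1 := by linarith [hκ.1]
    have h2 := (ex.exists_sq_norm_aggErr_bound hA hκ hβ ht
      (s := ν * Λ + ε / (72 * a * (κ + 1))) (by positivity)
      (le_add_of_nonneg_right (by positivity))).2
    refine h2.trans ?_
    have h3 : κ * (72 * (ε / (72 * a * (κ + 1))) * a) ≤ ε := by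
      have : κ * (72 * (ε / (72 * a * (κ + 1))) * a) = ε * (κ / (κ + 1)) := by field_simp
      rw [this]
      exact mul_le_of_le_one_right hε.le ((div_le_one hκ1).2 (by linarith))
    rw [← hν, ← ha]
    linarith
  have h2 := mul_le_mul_of_nonneg_left (hA.deviation_le κ sCor sInd) hν0
  rw [← hΛ, ← ha] at h2
  -- The coefficient obtained is 72, and 3/4 · 4 · 108 = 324 is available.
  have h3 : 0 ≤ κ * (ν * Λ * a) := mul_nonneg hκ.1 (by positivity)
  linarith

/-! ### Square integrability of the iterates -/

lemma agg_eq (t : ℕ) (ω : Ω) : ex.agg t ω = ex.meanMsg t ω + ex.aggErr t ω :=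
  (add_sub_cancel _ _).symm

/-- Joint induction: a Lipschitz gradient maps square-integrable iterates to square-integrable
gradients, and the aggregation error is square-integrable by robustness. -/
lemma memLp_θ_and_meanMsg [IsProbabilityMeasure P]
    (hA : IsAdmissible ℓ D H f b C L G σ) (hκ : IsRobustnessCoefficient d n f κ)
    (hβ : ∀ t, β t ∈ Set.Icc (0 : ℝ) 1) {t : ℕ} (ht : t < T) :
    MemLp (ex.θ t) 2 P ∧ MemLp (ex.meanMsg t) 2 P := by
  induction t with
  | zero =>
    rw [show ex.θ 0 = fun _ => θ₀ from funext ex.θ_zero,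
      show ex.meanMsg 0 = fun _ => 0 from funext ex.meanMsg_zero]
    exact ⟨memLp_const _, memLp_const _⟩
  | succ t ih =>
    obtain ⟨h1, h2⟩ := ih (by omega)
    have h3 : MemLp (ex.agg t) 2 P := by
      rw [show ex.agg t = _ from funext (ex.agg_eq t)]
      exact h2.add (ex.memLp_aggErr hA hκ hβ (by omega))
    have h4 : MemLp (ex.θ (t + 1)) 2 P := by
      rw [show ex.θ (t + 1) = _ from funext (ex.θ_succ t (by omega))]
      exact h1.sub (h3.const_smul (γ t))
    refine ⟨h4, ?_⟩
    rw [show ex.meanMsg (t + 1) = _ from funext (ex.meanMsg_succ hA ht)]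
    exact (h2.const_smul (β t)).add (((hA.smooth.memLp_gradient_comp h4).add
      (ex.isCentered_meanNoise hA.differentiable hA.gradients hA.variance hA.one_le_batch
        hA.batch_le ht).1).const_smul (1 - β t))

lemma memLp_agg [IsProbabilityMeasure P]
    (hA : IsAdmissible ℓ D H f b C L G σ) (hκ : IsRobustnessCoefficient d n f κ)
    (hβ : ∀ t, β t ∈ Set.Icc (0 : ℝ) 1) {t : ℕ} (ht : t < T) : MemLp (ex.agg t) 2 P := by
  rw [show ex.agg t = _ from funext (ex.agg_eq t)]
  exact (ex.memLp_θ_and_meanMsg hA hκ hβ ht).2.add (ex.memLp_aggErr hA hκ hβ ht)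

lemma memLp_θ [IsProbabilityMeasure P]
    (hA : IsAdmissible ℓ D H f b C L G σ) (hκ : IsRobustnessCoefficient d n f κ)
    (hβ : ∀ t, β t ∈ Set.Icc (0 : ℝ) 1) {t : ℕ} (ht : t ≤ T) : MemLp (ex.θ t) 2 P := by
  cases t with
  | zero =>
    rw [show ex.θ 0 = fun _ => θ₀ from funext ex.θ_zero]
    exact memLp_const _
  | succ t =>
    rw [show ex.θ (t + 1) = _ from funext (ex.θ_succ t (by omega))]
    exact (ex.memLp_θ_and_meanMsg hA hκ hβ (by omega)).1.sub
      ((ex.memLp_agg hA hκ hβ (by omega)).const_smul (γ t))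

lemma memLp_gradErr [IsProbabilityMeasure P]
    (hA : IsAdmissible ℓ D H f b C L G σ) (hκ : IsRobustnessCoefficient d n f κ)
    (hβ : ∀ t, β t ∈ Set.Icc (0 : ℝ) 1) {t : ℕ} (ht : t < T) : MemLp (ex.gradErr t) 2 P := by
  have h := ex.memLp_θ_and_meanMsg hA hκ hβ ht
  exact h.2.sub (hA.smooth.memLp_gradient_comp h.1)

/-- The excess loss lies between 0 and the quadratic upper bound at θ₀. -/
lemma integrable_excessLoss [IsProbabilityMeasure P]
    (hA : IsAdmissible ℓ D H f b C L G σ) (hκ : IsRobustnessCoefficient d n f κ)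
    (hβ : ∀ t, β t ∈ Set.Icc (0 : ℝ) 1) (hbdd : BddBelow (Set.range (honestLoss ℓ D H)))
    {t : ℕ} (ht : t ≤ T) :
    Integrable (fun ω => honestLoss ℓ D H (ex.θ t ω) - ⨅ η, honestLoss ℓ D H η) P := by
  set F := honestLoss ℓ D H with hF
  have hθ : MemLp (fun ω => ex.θ t ω - θ₀) 2 P :=
    (ex.memLp_θ hA hκ hβ ht).sub (memLp_const θ₀)
  have h1 : Integrable (fun ω => F θ₀ - (⨅ η, F η) + inner ℝ (∇ F θ₀) (ex.θ t ω - θ₀)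
      + L / 2 * ‖ex.θ t ω - θ₀‖ ^ 2) P :=
    ((integrable_const _).add (memLp_inner (memLp_const _) hθ)).add
      ((integrable_sq_norm hθ).const_mul _)
  have hm : Measurable (ex.θ t) := (ex.measurable_θ ht).mono (ex.ℱ.le t) le_rfl
  have hFm : Measurable F := hA.differentiable_loss.continuous.measurable
  refine h1.mono' ((hFm.comp hm).sub_const _).aestronglyMeasurable
    (Filter.Eventually.of_forall fun ω => ?_)
  rw [Real.norm_of_nonneg (sub_nonneg.2 (ciInf_le hbdd _))]
  have := hA.smooth.descent hA.differentiable_loss θ₀ (ex.θ t ω)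
  linarith

end Execution

/-- One step with the aggregate `R = M + ξ` in place of the gradient `g`. -/
lemma IsSmooth.descent_step {d : ℕ} {L : ℝ} {F : E d → ℝ} (hF : Differentiable ℝ F)
    (h : IsSmooth L F) {γ : ℝ} (hγ : 0 ≤ γ) (θ M ξ : E d) :
    F (θ - γ • (M + ξ)) ≤ F θ - γ / 2 * ‖∇ F θ‖ ^ 2 - γ / 2 * (1 - L * γ) * ‖M + ξ‖ ^ 2
      + γ * ‖M - ∇ F θ‖ ^ 2 + γ * ‖ξ‖ ^ 2 := by
  have h1 := h.descent hF θ (θ - γ • (M + ξ))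
  rw [sub_sub_cancel_left, inner_neg_right, real_inner_smul_right, norm_neg, norm_smul,
    Real.norm_of_nonneg hγ] at h1
  -- Polarization: -γ⟨g, R⟩ = γ/2 (‖g - R‖² - ‖g‖² - ‖R‖²). The negative term in ‖R‖² is kept, since
  -- it pays for the drift of the momentum error.
  have h2 := norm_sub_sq_real (∇ F θ) (M + ξ)
  have h3 : ‖∇ F θ - (M + ξ)‖ ^ 2 ≤ 2 * ‖M - ∇ F θ‖ ^ 2 + 2 * ‖ξ‖ ^ 2 := by
    have h4 : ‖∇ F θ - (M + ξ)‖ ≤ ‖M - ∇ F θ‖ + ‖ξ‖ := by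
      rw [← norm_neg, show -(∇ F θ - (M + ξ)) = (M - ∇ F θ) + ξ by abel]
      exact norm_add_le _ _
    nlinarith [norm_nonneg (∇ F θ - (M + ξ)), sq_nonneg (‖M - ∇ F θ‖ - ‖ξ‖)]
  nlinarith [mul_le_mul_of_nonneg_left h3 hγ]

/-- Drift of the momentum error when the parameter moves by `-γ • R`. -/
lemma IsSmooth.sq_norm_momentum_drift_le {d : ℕ} {L : ℝ} {F : E d → ℝ} (h : IsSmooth L F)
    {γ : ℝ} (hγ : 0 ≤ γ) (hL : 0 ≤ L) (hγL : 24 * L * γ ≤ 1) (θ M R : E d) :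
    ‖(1 - 24 * L * γ) • (M - ∇ F (θ - γ • R))‖ ^ 2 ≤
      (1 - 24 * L * γ) * ‖M - ∇ F θ‖ ^ 2 + L * γ / 24 * ‖R‖ ^ 2 := by
  have h1 := h θ (θ - γ • R)
  rw [sub_sub_cancel_left, norm_neg, norm_smul, Real.norm_of_nonneg hγ] at h1
  have h2 : ‖M - ∇ F (θ - γ • R)‖ ≤ ‖M - ∇ F θ‖ + L * γ * ‖R‖ := by
    rw [show M - ∇ F (θ - γ • R) = (M - ∇ F θ) - (∇ F (θ - γ • R) - ∇ F θ) by abel]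
    refine (norm_sub_le _ _).trans ?_
    linarith
  set η := 24 * L * γ with hη
  have hη0 : 0 ≤ η := by positivity
  have h3 : L * γ * ‖R‖ = η * (‖R‖ / 24) := by rw [hη]; ring
  have h4 : L * γ / 24 * ‖R‖ ^ 2 = η * (‖R‖ / 24) ^ 2 := by rw [hη]; ring
  rw [h3] at h2
  rw [h4, norm_smul, Real.norm_of_nonneg (by linarith)]
  set a := ‖M - ∇ F θ‖
  set r := ‖R‖ / 24 with hr
  have ha : 0 ≤ a := norm_nonneg _
  have hr0 : 0 ≤ r := by positivity
  -- With η = 24 L γ the drift is η r, r = ‖R‖/24. Replacing (1 - η) η r by η r gives a convex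
  -- combination of a and r, so the square contracts by 1 - η only once.
  calc _ ≤ ((1 - η) * (a + η * r)) ^ 2 := by
        refine pow_le_pow_left₀ (mul_nonneg (by linarith) (norm_nonneg _)) ?_ 2
        exact mul_le_mul_of_nonneg_left h2 (by linarith)
    _ ≤ ((1 - η) * a + (1 - (1 - η)) * r) ^ 2 := by
        refine pow_le_pow_left₀ (mul_nonneg (by linarith) (by positivity)) ?_ 2
        nlinarith [mul_nonneg (mul_nonneg hη0 hη0) hr0]
    _ ≤ _ := by
        have := sq_convex_combination_le (w := 1 - η) (x := a) (y := r) (by linarith)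
          (by linarith)
        linarith

namespace Execution

variable {X : Type*} {d n m : ℕ} {ℓ : E d → X → ℝ} {D : Fin n → Fin m → X}
  {H : Finset (Fin n)} {f b : ℕ} {C : ℝ≥0∞} {sCor sInd : ℝ} {γ β : ℕ → ℝ} {θ₀ : E d} {T : ℕ}
  {Ω : Type*} [mΩ : MeasurableSpace Ω] {P : Measure Ω} {L G σ κ : ℝ}
  (ex : Execution ℓ D H f b C sCor sInd γ β θ₀ T P)

/-! ### Evolution of the expected loss and of the gradient error -/

/-- Expected excess loss. -/
noncomputable def excess (t : ℕ) : ℝ :=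
  ∫ ω, (honestLoss ℓ D H (ex.θ t ω) - ⨅ η, honestLoss ℓ D H η) ∂P

/-- Expected squared norm of the honest gradient. -/
noncomputable def gradSq (t : ℕ) : ℝ := ∫ ω, ‖∇ (honestLoss ℓ D H) (ex.θ t ω)‖ ^ 2 ∂P

/-- Expected squared norm of the aggregate. -/
noncomputable def aggSq (t : ℕ) : ℝ := ∫ ω, ‖ex.agg t ω‖ ^ 2 ∂P

/-- Expected squared norm of the gradient error. -/
noncomputable def gradErrSq (t : ℕ) : ℝ := ∫ ω, ‖ex.gradErr t ω‖ ^ 2 ∂P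

lemma excess_zero [IsProbabilityMeasure P] :
    ex.excess 0 = honestLoss ℓ D H θ₀ - ⨅ η, honestLoss ℓ D H η := by
  simp [excess, ex.θ_zero]

lemma excess_nonneg (hbdd : BddBelow (Set.range (honestLoss ℓ D H))) (t : ℕ) :
    0 ≤ ex.excess t :=
  integral_nonneg fun _ => sub_nonneg.2 (ciInf_le hbdd _)

lemma gradErrSq_nonneg (t : ℕ) : 0 ≤ ex.gradErrSq t := integral_nonneg fun _ => sq_nonneg _

lemma aggSq_nonneg (t : ℕ) : 0 ≤ ex.aggSq t := integral_nonneg fun _ => sq_nonneg _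

/-- The initial messages vanish, so the initial error is the gradient at θ₀. -/
lemma gradErrSq_zero_le [IsProbabilityMeasure P] (hA : IsAdmissible ℓ D H f b C L G σ)
    (hbdd : BddBelow (Set.range (honestLoss ℓ D H))) :
    ex.gradErrSq 0 ≤ 2 * L * ex.excess 0 := by
  rw [excess_zero]
  simp only [gradErrSq, gradErr, meanMsg_zero, ex.θ_zero, zero_sub, norm_neg, integral_const,
    probReal_univ, one_smul]
  exact hA.smooth.sq_norm_gradient_le hA.pos hA.differentiable_loss hbdd θ₀

lemma excess_succ_le [IsProbabilityMeasure P]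
    (hA : IsAdmissible ℓ D H f b C L G σ) (hκ : IsRobustnessCoefficient d n f κ)
    (hβ : ∀ t, β t ∈ Set.Icc (0 : ℝ) 1) (hbdd : BddBelow (Set.range (honestLoss ℓ D H)))
    (hγ : ∀ t, 0 ≤ γ t) {t : ℕ} (ht : t < T) :
    ex.excess (t + 1) ≤ ex.excess t - γ t / 2 * ex.gradSq t
      - γ t / 2 * (1 - L * γ t) * ex.aggSq t + γ t * ex.gradErrSq t
      + γ t * (3 * κ * G ^ 2
        + 3 / 4 * momentumVariance β t * totalVariance d n m f b κ σ sCor sInd) := by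
  have hF := hA.differentiable_loss
  have hS := hA.smooth
  have i0 := ex.integrable_excessLoss hA hκ hβ hbdd (show t + 1 ≤ T from ht)
  have i1 := ex.integrable_excessLoss hA hκ hβ hbdd ht.le
  have i2 := (integrable_sq_norm (hS.memLp_gradient_comp (ex.memLp_θ hA hκ hβ ht.le))).const_mul
    (γ t / 2)
  have i3 := (integrable_sq_norm (ex.memLp_agg hA hκ hβ ht)).const_mul (γ t / 2 * (1 - L * γ t))
  have i4 := (integrable_sq_norm (ex.memLp_gradErr hA hκ hβ ht)).const_mul (γ t)
  have i5 := (integrable_sq_norm (ex.memLp_aggErr hA hκ hβ ht)).const_mul (γ t)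
  have h1 := mul_le_mul_of_nonneg_left (ex.integral_sq_norm_aggErr_le hA hκ hβ ht) (hγ t)
  have h2 := integral_mono i0 ((((i1.sub i2).sub i3).add i4).add i5) fun ω => by
    have h3 := hS.descent_step hF (hγ t) (ex.θ t ω) (ex.meanMsg t ω) (ex.aggErr t ω)
    rw [← ex.agg_eq, ← ex.θ_succ t ht, ← gradErr] at h3
    simp only [Pi.add_apply, Pi.sub_apply]
    linarith
  rw [integral_add' (((i1.sub i2).sub i3).add i4) i5, integral_add' ((i1.sub i2).sub i3) i4,
    integral_sub' (i1.sub i2) i3, integral_sub' i1 i2] at h2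
  simp only [integral_const_mul] at h2
  simp only [excess, gradSq, aggSq, gradErrSq]
  linarith

lemma gradErr_succ (hA : IsAdmissible ℓ D H f b C L G σ) {t : ℕ} (ht : t + 1 < T) (ω : Ω) :
    ex.gradErr (t + 1) ω = β t • (ex.meanMsg t ω - ∇ (honestLoss ℓ D H) (ex.θ (t + 1) ω))
      + (1 - β t) • ex.meanNoise (t + 1) ω := by
  rw [gradErr, ex.meanMsg_succ hA ht]
  module

/-- The part containing M_t and ∇F(θ_{t+1}) is known at time t, so the noise of step t + 1 is
orthogonal to it and only its second moment is added. -/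
lemma gradErrSq_succ_le [IsProbabilityMeasure P]
    (hA : IsAdmissible ℓ D H f b C L G σ) (hκ : IsRobustnessCoefficient d n f κ)
    (hγ : ∀ t, 0 ≤ γ t) (hγL : ∀ t, 24 * L * γ t ≤ 1) (hβ : ∀ t, β t = 1 - 24 * L * γ t)
    {t : ℕ} (ht : t + 1 < T) :
    ex.gradErrSq (t + 1) ≤ (1 - 24 * L * γ t) * ex.gradErrSq t + L * γ t / 24 * ex.aggSq t
      + (24 * L * γ t) ^ 2 * totalVariance d n m f b κ σ sCor sInd := by
  have hβ' : ∀ t, β t ∈ Set.Icc (0 : ℝ) 1 := fun t => by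
    rw [hβ]
    have := mul_nonneg (mul_nonneg (by norm_num : (0 : ℝ) ≤ 24) hA.pos.le) (hγ t)
    exact ⟨by linarith [hγL t], by linarith⟩
  have ht' : t < T := by omega
  have hS := hA.smooth
  have hN := (ex.isCentered_meanNoise hA.differentiable hA.gradients hA.variance hA.one_le_batch
    hA.batch_le ht).smul (1 - β t)
  have hV := ex.integral_sq_norm_meanNoise_le hA.differentiable hA.gradients hA.variance
    hA.one_le_batch hA.batch_le hA.two_mul_lt hA.card_honest ht
  have hY : Measurable[ex.ℱ t] fun ω =>
      β t • (ex.meanMsg t ω - ∇ (honestLoss ℓ D H) (ex.θ (t + 1) ω)) :=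
    ((ex.measurable_meanMsg hA ht').sub (ex.measurable_gradient_θ_succ ht')).const_smul (β t)
  have hY2 : MemLp (fun ω =>
      β t • (ex.meanMsg t ω - ∇ (honestLoss ℓ D H) (ex.θ (t + 1) ω))) 2 P :=
    ((ex.memLp_θ_and_meanMsg hA hκ hβ' ht').2.sub (hS.memLp_gradient_comp
      (ex.memLp_θ hA hκ hβ' ht.le))).const_smul (β t)
  have h1 := hN.integral_sq_norm_add hY hY2
  have i1 := (integrable_sq_norm (ex.memLp_gradErr hA hκ hβ' ht')).const_mul (1 - 24 * L * γ t)
  have i2 := (integrable_sq_norm (ex.memLp_agg hA hκ hβ' ht')).const_mul (L * γ t / 24)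
  have h2 := integral_mono (integrable_sq_norm hY2) (i1.add i2) fun ω => by
    have := hS.sq_norm_momentum_drift_le (hγ t) hA.pos.le (hγL t) (ex.θ t ω) (ex.meanMsg t ω)
      (ex.agg t ω)
    rw [← ex.θ_succ t ht', ← gradErr, ← hβ] at this
    rw [hβ t] at this ⊢
    exact this
  rw [integral_add' i1 i2] at h2
  simp only [integral_const_mul] at h2
  have h3 : ∫ ω, ‖(1 - β t) • ex.meanNoise (t + 1) ω‖ ^ 2 ∂P ≤
      (24 * L * γ t) ^ 2 * totalVariance d n m f b κ σ sCor sInd := by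
    simp only [norm_smul, mul_pow, integral_const_mul, Real.norm_eq_abs, sq_abs]
    rw [hβ, sub_sub_cancel]
    have h4 := hV.trans (hA.mean_noise_le hκ.1 sCor sInd)
    have := mul_le_mul_of_nonneg_left h4 (sq_nonneg (24 * L * γ t))
    linarith
  simp only [gradErrSq, ex.gradErr_succ hA ht]
  rw [h1]
  simp only [aggSq] at *
  linarith

/-- Lyapunov function: expected excess loss plus a multiple of the gradient error, the latter
counted as long as the workers send messages. -/
noncomputable def lyapunov (L : ℝ) (t : ℕ) : ℝ :=
  ex.excess t + if t < T then ex.gradErrSq t / (8 * L) else 0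

lemma excess_le_lyapunov (hL : 0 < L) (t : ℕ) : ex.excess t ≤ ex.lyapunov L t := by
  have := ex.gradErrSq_nonneg t
  refine le_add_of_nonneg_right ?_
  split_ifs <;> positivity

lemma lyapunov_zero_le [IsProbabilityMeasure P] (hA : IsAdmissible ℓ D H f b C L G σ)
    (hbdd : BddBelow (Set.range (honestLoss ℓ D H))) :
    ex.lyapunov L 0 ≤ 5 / 4 * (honestLoss ℓ D H θ₀ - ⨅ η, honestLoss ℓ D H η) := by
  have hL := hA.pos
  have h0 := ex.excess_nonneg hbdd 0
  have h1 := ex.gradErrSq_zero_le hA hbdd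
  have h2 : ex.gradErrSq 0 / (8 * L) ≤ ex.excess 0 / 4 := by
    rw [div_le_iff₀ (by positivity)]
    linarith
  rw [← ex.excess_zero, lyapunov]
  split_ifs <;> linarith

/-- The weight 1/(8L) turns the contraction 24 L γ into 3γ: one γ pays for the gradient error in the
descent inequality, 2γ remain. The drift becomes γ/192 E‖R‖², absorbed by γ/2 (1 - Lγ) E‖R‖², and
the noise (24 L γ)²/(8L) = 72 L γ². -/
lemma lyapunov_succ_le [IsProbabilityMeasure P]
    (hA : IsAdmissible ℓ D H f b C L G σ) (hκ : IsRobustnessCoefficient d n f κ)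
    (hbdd : BddBelow (Set.range (honestLoss ℓ D H)))
    (hγ : ∀ t, 0 ≤ γ t) (hγL : ∀ t, 24 * L * γ t ≤ 1) (hβ : ∀ t, β t = 1 - 24 * L * γ t)
    {t : ℕ} (ht : t < T) :
    ex.lyapunov L (t + 1) ≤ ex.lyapunov L t - γ t / 2 * ex.gradSq t - 2 * γ t * ex.gradErrSq t
      + 3 * γ t * κ * G ^ 2
      + (3 / 4 * γ t * momentumVariance β t + 72 * L * γ t ^ 2)
        * totalVariance d n m f b κ σ sCor sInd := by
  have hL := hA.pos
  have hγt := hγ t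
  have hγLt := hγL t
  have hβ' : ∀ t, β t ∈ Set.Icc (0 : ℝ) 1 := fun t => by
    rw [hβ]
    have := mul_nonneg (mul_nonneg (by norm_num : (0 : ℝ) ≤ 24) hL.le) (hγ t)
    exact ⟨by linarith [hγL t], by linarith⟩
  have hV := hA.totalVariance_nonneg hκ.1 sCor sInd
  have h1 := ex.excess_succ_le hA hκ hβ' hbdd hγ ht
  have hq := ex.gradErrSq_nonneg t
  have hr := ex.aggSq_nonneg t
  set V := totalVariance d n m f b κ σ sCor sInd
  have h3 : 0 ≤ γ t * ex.aggSq t * (1 / 2 - L * γ t / 2 - 1 / 192) :=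
    mul_nonneg (mul_nonneg hγt hr) (by linarith)
  have h4 : 0 ≤ γ t * ex.aggSq t := mul_nonneg hγt hr
  simp only [lyapunov]
  rw [if_pos ht]
  split_ifs with hlt
  · have h2 := ex.gradErrSq_succ_le hA hκ hγ hγL hβ hlt
    have h5 : ex.gradErrSq (t + 1) / (8 * L) ≤ ex.gradErrSq t / (8 * L) - 3 * γ t * ex.gradErrSq t
        + γ t / 192 * ex.aggSq t + 72 * L * γ t ^ 2 * V := by
      rw [div_le_iff₀ (by positivity)]
      refine h2.trans (le_of_eq ?_)
      field_simp
      ring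
    linarith
  · have h5 : 3 * γ t * ex.gradErrSq t ≤ ex.gradErrSq t / (8 * L) := by
      rw [le_div_iff₀ (by positivity)]
      nlinarith
    have h6 : 0 ≤ 72 * L * γ t ^ 2 * V := by positivity
    linarith

end Execution

/-! ### Two recursions -/

lemma momentumVariance_le_of_const {β : ℕ → ℝ} {η : ℝ} (h0 : 0 ≤ η) (h1 : η ≤ 1)
    (hβ : ∀ t, β t = 1 - η) (t : ℕ) : momentumVariance β t ≤ η := by
  induction t with
  | zero => exact h0
  | succ t ih =>
    rw [momentumVariance, hβ]
    nlinarith [mul_le_mul_of_nonneg_left ih (sq_nonneg (1 - η)),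
      mul_nonneg (mul_nonneg h0 h0) (sub_nonneg.2 h1), mul_nonneg h0 (sub_nonneg.2 h1)]

/-- With η = K/(t + K), the induction step is (1 - η)² 2η + η² ≤ 2η - η², while 2η itself decreases
by only 2η/(t + K + 1) ≤ η² per step, because K ≥ 2. -/
lemma momentumVariance_le_of_harmonic {β : ℕ → ℝ} {K : ℝ} (hK : 2 ≤ K)
    (hβ : ∀ t : ℕ, β t = 1 - K / (t + K)) (t : ℕ) :
    momentumVariance β t ≤ 2 * (K / (t + K)) := by
  induction t with
  | zero => rw [momentumVariance]; positivity
  | succ t ih =>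
    have ht : (0 : ℝ) ≤ t := Nat.cast_nonneg t
    have hk : 0 < t + K := by linarith
    set η := K / (t + K) with hη
    have hη1 : η ≤ 1 := (div_le_one hk).2 (by linarith)
    have hη0 : 0 ≤ η := by positivity
    have h1 : 2 * (K / ((t + 1 : ℕ) + K)) = 2 * η - 2 * η / (t + K + 1) := by
      push_cast
      rw [hη]
      field_simp
      ring
    have h2 : 2 / (t + K + 1) ≤ η := by
      rw [hη, div_le_div_iff₀ (by linarith) hk]
      nlinarith
    have h3 : 2 * η / (t + K + 1) ≤ η * η := by
      rw [mul_comm 2 η, mul_div_assoc]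
      exact mul_le_mul_of_nonneg_left h2 hη0
    rw [momentumVariance, hβ, ← hη, h1]
    nlinarith [mul_le_mul_of_nonneg_left ih (sq_nonneg (1 - η)),
      mul_nonneg (mul_nonneg hη0 hη0) (sub_nonneg.2 hη1)]

/-- With k = t + K, the three-term bound reproduces itself: (1 - 10/k) B/k + 9B/k² = B (1/k - 1/k²)
≤ B/(k + 1), and (1 - 10/k)/k² ≤ 1/(k + 1)². The factor 9 = 10 - 1 is chosen for this. -/
lemma le_of_harmonic_recursion {V : ℕ → ℝ} {K A B D : ℝ} {T : ℕ} (hK : 10 ≤ K) (hB : 0 ≤ B)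
    (hD : 0 ≤ D) (h0 : V 0 ≤ A + B / K + D / K ^ 2)
    (h : ∀ t < T, V (t + 1) ≤ (1 - 10 / (t + K)) * V t + 10 / (t + K) * A
      + 9 * B / (t + K) ^ 2) {t : ℕ} (ht : t ≤ T) :
    V t ≤ A + B / (t + K) + D / (t + K) ^ 2 := by
  induction t with
  | zero => simpa using h0
  | succ t ih =>
    have ht0 : (0 : ℝ) ≤ t := Nat.cast_nonneg t
    have h1 := h t ht
    push_cast
    rw [show (t : ℝ) + 1 + K = (t + K) + 1 by ring]
    have hk : 10 ≤ t + K := by linarith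
    have ih' := ih (by omega)
    generalize (t : ℝ) + K = k at *
    have hk0 : 0 < k := by linarith
    have h2 : (1 - 10 / k) * V t ≤ (1 - 10 / k) * (A + B / k + D / k ^ 2) :=
      mul_le_mul_of_nonneg_left ih' (sub_nonneg.2 ((div_le_one hk0).2 hk))
    have h3 : 1 / k - 1 / k ^ 2 ≤ 1 / (k + 1) := by
      rw [div_sub_div _ _ hk0.ne' (by positivity), div_le_div_iff₀ (by positivity) (by positivity)]
      nlinarith
    have h4 : (1 - 10 / k) * (1 / k ^ 2) ≤ 1 / (k + 1) ^ 2 := by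
      rw [one_sub_div hk0.ne', div_mul_div_comm, mul_one,
        div_le_div_iff₀ (by positivity) (by positivity)]
      nlinarith [sq_nonneg k]
    have h5 := mul_le_mul_of_nonneg_left h3 hB
    have h6 := mul_le_mul_of_nonneg_left h4 hD
    calc V (t + 1) ≤ (1 - 10 / k) * (A + B / k + D / k ^ 2) + 10 / k * A + 9 * B / k ^ 2 := by
          linarith
      _ = A + B * (1 / k - 1 / k ^ 2) + D * ((1 - 10 / k) * (1 / k ^ 2)) := by ring
      _ ≤ A + B * (1 / (k + 1)) + D * (1 / (k + 1) ^ 2) := by linarith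
      _ = _ := by ring

/-- The bound of the non-convex case for the step size `constantStep`. -/
lemma constantStep_bound {L L₀ s : ℝ} {T : ℕ} (hL : 0 < L) (hT : 1 ≤ T) (hL₀ : 0 ≤ L₀)
    (hs : 0 ≤ s) (hpos : 0 < constantStep L L₀ s T) :
    5 / 2 * L₀ / (constantStep L L₀ s T * T) + 180 * L * constantStep L L₀ s T * s ^ 2 ≤
      √(5760 * 270 * L * L₀) * s / √T + 270 * L * L₀ / T := by
  have hT0 : (0 : ℝ) < T := by exact_mod_cast hT
  set γ := constantStep L L₀ s T with hγ
  rcases hs.eq_or_lt with rfl | hs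
  · rw [constantStep, if_pos rfl] at hγ
    have h1 : 5 / 2 * L₀ / (γ * T) = 60 * L * L₀ / T := by
      rw [hγ]
      field_simp
      ring
    have h2 : 60 * L * L₀ / T ≤ 270 * L * L₀ / T := by gcongr; norm_num
    rw [h1]
    simpa using h2
  rw [constantStep, if_neg hs.ne'] at hγ
  set p := √(270 * L₀) with hp
  set q := √(5760 * L * T) with hq
  have hp2 : p ^ 2 = 270 * L₀ := Real.sq_sqrt (by positivity)
  have hq2 : q ^ 2 = 5760 * L * T := Real.sq_sqrt (by positivity)
  have hq0 : 0 < q := Real.sqrt_pos.2 (by positivity)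
  have hγ2 : γ ≤ p / (2 * s * q) := hγ ▸ min_le_right _ _
  -- A positive step excludes L₀ = 0 here; p is a divisor below.
  have hp0 : 0 < p := by
    by_contra hcon
    have hp00 : p = 0 := le_antisymm (not_lt.1 hcon) (Real.sqrt_nonneg _)
    rw [hp00, zero_div] at hγ2
    linarith
  -- The reciprocal of a minimum is at most the sum of the reciprocals.
  have hinv : 1 / γ ≤ 24 * L + 2 * s * q / p := by
    rcases min_cases (1 / (24 * L)) (p / (2 * s * q)) with ⟨h, -⟩ | ⟨h, -⟩ <;> rw [h] at hγ <;>
      rw [hγ, one_div_div]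
    · rw [div_one]
      exact le_add_of_nonneg_right (by positivity)
    · exact le_add_of_nonneg_left (by positivity)
  have hX : √(5760 * 270 * L * L₀) * s / √T = p * q * s / T := by
    have h1 : √(5760 * 270 * L * L₀) * √T = p * q := by
      rw [hp, hq, ← Real.sqrt_mul (by positivity), ← Real.sqrt_mul (by positivity)]
      congr 1
      ring
    rw [← h1]
    have h2 : √(T : ℝ) ≠ 0 := (Real.sqrt_pos.2 hT0).ne'
    have h3 : (T : ℝ) = √T * √T := (Real.mul_self_sqrt hT0.le).symm
    rw [div_eq_div_iff h2 hT0.ne']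
    nth_rewrite 1 [h3]
    ring
  have h1 : 5 / 2 * L₀ / (γ * T) ≤ 60 * L * L₀ / T + 5 / 270 * (p * q * s / T) := by
    calc 5 / 2 * L₀ / (γ * T) = 5 / 2 * L₀ / T * (1 / γ) := by field_simp
      _ ≤ 5 / 2 * L₀ / T * (24 * L + 2 * s * q / p) :=
        mul_le_mul_of_nonneg_left hinv (by positivity)
      _ = 60 * L * L₀ / T + 5 * (270 * L₀) / 270 * q * s / (p * T) := by
        field_simp
        ring
      _ = _ := by
        rw [← hp2]
        field_simp
  have h2 : 180 * L * γ * s ^ 2 ≤ 90 / 5760 * (p * q * s / T) := by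
    calc 180 * L * γ * s ^ 2 ≤ 180 * L * (p / (2 * s * q)) * s ^ 2 := by gcongr
      _ = 90 / 5760 * (5760 * L * T) * p * s / (q * T) := by
        field_simp
        ring
      _ = _ := by
        rw [← hq2]
        field_simp
  have h3 : 60 * L * L₀ / T ≤ 270 * L * L₀ / T := by gcongr; norm_num
  have h4 : 0 ≤ p * q * s / T := by positivity
  rw [hX]
  linarith

lemma constantStep_nonneg {L : ℝ} (hL : 0 < L) (L₀ : ℝ) {s : ℝ} (hs : 0 ≤ s) (T : ℕ) :
    0 ≤ constantStep L L₀ s T := by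
  rw [constantStep]
  split_ifs <;> positivity

lemma constantStep_le (L L₀ s : ℝ) (T : ℕ) : constantStep L L₀ s T ≤ 1 / (24 * L) := by
  rw [constantStep]
  split_ifs
  · exact le_rfl
  · exact min_le_left _ _

lemma eq_zero_of_constantStep_eq_zero {L L₀ s : ℝ} {T : ℕ} (hL : 0 < L) (hT : 1 ≤ T)
    (hL₀ : 0 ≤ L₀) (h : constantStep L L₀ s T = 0) : L₀ = 0 := by
  have hT0 : (0 : ℝ) < T := by exact_mod_cast hT
  have h24 : 1 / (24 * L) ≠ 0 := by positivity
  rw [constantStep] at h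
  split_ifs at h with hs
  · exact absurd h h24
  have h1 : √(5760 * L * T) ≠ 0 := (Real.sqrt_pos.2 (by positivity)).ne'
  rcases min_choice (1 / (24 * L)) (√(270 * L₀) / (2 * s * √(5760 * L * T))) with h2 | h2 <;>
    rw [h2] at h
  · exact absurd h h24
  · rw [div_eq_zero_iff, or_iff_left (by positivity), Real.sqrt_eq_zero (by positivity)] at h
    linarith

/-! ### Conclusion in the strongly convex and in the non-convex case -/

namespace Execution

variable {X : Type*} {d n m : ℕ} {ℓ : E d → X → ℝ} {D : Fin n → Fin m → X}
  {H : Finset (Fin n)} {f b : ℕ} {C : ℝ≥0∞} {sCor sInd : ℝ} {γ β : ℕ → ℝ} {θ₀ : E d} {T : ℕ}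
  {Ω : Type*} [mΩ : MeasurableSpace Ω] {P : Measure Ω} {L G σ κ : ℝ}
  (ex : Execution ℓ D H f b C sCor sInd γ β θ₀ T P)

theorem excess_le_of_isStronglyConvex [IsProbabilityMeasure P]
    (hA : IsAdmissible ℓ D H f b C L G σ) (hκ : IsRobustnessCoefficient d n f κ) (hT : 1 ≤ T)
    {μ : ℝ} (hμ : 0 < μ) (hF : IsStronglyConvex μ (honestLoss ℓ D H))
    (hγ : ∀ t, γ t = 10 / (μ * (t + 240 * (L / μ)))) (hβ : ∀ t, β t = 1 - 24 * L * γ t) :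
    Integrable (fun ω => honestLoss ℓ D H (ex.θ T ω) - ⨅ η, honestLoss ℓ D H η) P ∧
      ∫ ω, (honestLoss ℓ D H (ex.θ T ω) - ⨅ η, honestLoss ℓ D H η) ∂P ≤
        4 * 240 / μ * κ * G ^ 2
          + 2 * 240 ^ 2 * L * totalVariance d n m f b κ σ sCor sInd / (μ ^ 2 * T)
          + 2 * 240 ^ 2 * L ^ 2 * (honestLoss ℓ D H θ₀ - ⨅ η, honestLoss ℓ D H η)
              / (μ ^ 2 * T ^ 2) := by
  have hL := hA.pos
  have hbdd := hF.bddBelow hμ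
  have hμL : μ ≤ L := by
    obtain ⟨ω⟩ := P.nonempty_of_neZero
    have := nontrivial hT ω ex
    exact hF.le_of_isSmooth hA.differentiable_loss hA.smooth
  -- With this K one has 24 L γ_t = K/(t + K) and μ γ_t = 10/(t + K): the momentum is harmonic and
  -- the contraction factor is that of the recursion lemma.
  set K := 240 * (L / μ) with hK
  have hKμ : K * μ = 240 * L := by rw [hK]; field_simp
  have hK240 : 240 ≤ K := by
    have : 1 ≤ L / μ := (one_le_div hμ).2 hμL
    linarith
  have hk : ∀ t : ℕ, 0 < (t : ℝ) + K := fun t => by positivity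
  have hη : ∀ t, 24 * L * γ t = K / (t + K) := fun t => by
    have := hk t
    rw [hγ, show 24 * L * (10 / (μ * (t + K))) = 240 * L / (μ * (t + K)) by ring, ← hKμ]
    field_simp
  have hγ0 : ∀ t, 0 ≤ γ t := fun t => by
    have := hk t
    rw [hγ]
    positivity
  have hγL : ∀ t, 24 * L * γ t ≤ 1 := fun t => by
    rw [hη, div_le_one (hk t)]
    linarith [(Nat.cast_nonneg t : (0 : ℝ) ≤ t)]
  have hβ' : ∀ t, β t ∈ Set.Icc (0 : ℝ) 1 := fun t => by
    rw [hβ]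
    have := mul_nonneg (mul_nonneg (by norm_num : (0 : ℝ) ≤ 24) hL.le) (hγ0 t)
    exact ⟨by linarith [hγL t], by linarith⟩
  have hν := momentumVariance_le_of_harmonic (β := β) (K := K) (by linarith)
    fun t => by rw [hβ, hη]
  have hV := hA.totalVariance_nonneg hκ.1 sCor sInd
  set V := totalVariance d n m f b κ σ sCor sInd
  set L₀ := honestLoss ℓ D H θ₀ - ⨅ η, honestLoss ℓ D H η with hL₀
  have hL₀0 : 0 ≤ L₀ := sub_nonneg.2 (ciInf_le hbdd _)
  refine ⟨ex.integrable_excessLoss hA hκ hβ' hbdd le_rfl, ?_⟩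
  have hrec : ∀ t < T, ex.lyapunov L (t + 1) ≤ (1 - 10 / (t + K)) * ex.lyapunov L t
      + 10 / (t + K) * (3 * κ * G ^ 2 / μ) + 9 * (1200 * L * V / μ ^ 2) / (t + K) ^ 2 := by
    intro t ht
    have h1 := ex.lyapunov_succ_le hA hκ hbdd hγ0 hγL hβ ht
    have h2 : 2 * μ * ex.excess t ≤ ex.gradSq t := by
      rw [excess, gradSq, ← integral_const_mul]
      exact integral_mono ((ex.integrable_excessLoss hA hκ hβ' hbdd ht.le).const_mul _)
        (integrable_sq_norm (hA.smooth.memLp_gradient_comp (ex.memLp_θ hA hκ hβ' ht.le)))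
        fun ω => hF.le_sq_norm_gradient hμ _
    have hq := ex.gradErrSq_nonneg t
    have h3 : γ t * μ = 10 / (t + K) := by
      have := hk t
      rw [hγ]
      field_simp
    -- The surplus -2γ in the gradient error makes that half of the Lyapunov function contract at
    -- the rate μγ too, as μ ≤ L.
    have h4 : μ * (ex.gradErrSq t / (8 * L)) ≤ 2 * ex.gradErrSq t := by
      rw [← mul_div_assoc, div_le_iff₀ (by positivity)]
      nlinarith [mul_le_mul_of_nonneg_right hμL hq, mul_nonneg hL.le hq]
    -- Since ν ≤ 48 L γ, the total is (36 + 72) L γ² V, and 108 · 10² = 9 · 1200 gives B below.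
    have h5 : (3 / 4 * γ t * momentumVariance β t + 72 * L * γ t ^ 2) * V ≤
        108 * L * γ t ^ 2 * V := by
      have h6 := hν t
      rw [← hη] at h6
      refine mul_le_mul_of_nonneg_right ?_ hV
      nlinarith [mul_le_mul_of_nonneg_left h6 (hγ0 t)]
    have h6 : 108 * L * γ t ^ 2 * V = 9 * (1200 * L * V / μ ^ 2) / (t + K) ^ 2 := by
      have := hk t
      rw [hγ]
      field_simp
      ring
    have h7 : 10 / (t + K) * (3 * κ * G ^ 2 / μ) = 3 * γ t * κ * G ^ 2 := by
      rw [← h3]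
      field_simp
    have h8 := mul_le_mul_of_nonneg_left h2 (hγ0 t)
    have h9 := mul_le_mul_of_nonneg_left h4 (hγ0 t)
    rw [h7, ← h6, ← h3]
    simp only [lyapunov] at h1 ⊢
    rw [if_pos ht] at h1 ⊢
    linarith
  have h0 := ex.lyapunov_zero_le hA hbdd
  rw [← hL₀] at h0
  have hK0 : 0 < K := by linarith
  have hκG : 0 ≤ κ * G ^ 2 := mul_nonneg hκ.1 (sq_nonneg G)
  -- D is chosen so that D/K² is the bound 5/4 L₀ on the initial value; D = 72000 L² L₀/μ² fits
  -- under 2 · 240².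
  have h1 := le_of_harmonic_recursion (V := ex.lyapunov L) (K := K) (A := 3 * κ * G ^ 2 / μ)
    (B := 1200 * L * V / μ ^ 2) (D := 5 / 4 * L₀ * K ^ 2) (by linarith) (by positivity)
    (by positivity) (by
      rw [mul_div_cancel_right₀ _ (by positivity)]
      have h2 : 0 ≤ 3 * κ * G ^ 2 / μ := div_nonneg (by linarith) hμ.le
      have h3 : 0 ≤ 1200 * L * V / μ ^ 2 / K := by positivity
      linarith) hrec (le_refl T)
  have hT0 : (0 : ℝ) < T := by exact_mod_cast hT
  have hTK : (T : ℝ) ≤ T + K := by linarith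
  refine (ex.excess_le_lyapunov hL T).trans (h1.trans ?_)
  refine add_le_add (add_le_add ?_ ?_) ?_
  · rw [show 4 * 240 / μ * κ * G ^ 2 = 960 * (κ * G ^ 2) / μ by ring]
    exact div_le_div_of_nonneg_right (by linarith) hμ.le
  · rw [div_div]
    gcongr
    norm_num
  · have h2 : 5 / 4 * L₀ * K ^ 2 = 72000 * L ^ 2 * L₀ / μ ^ 2 := by
      rw [hK]
      field_simp
      ring
    rw [h2, div_div]
    gcongr
    norm_num

theorem gradient_le_of_bddBelow [IsProbabilityMeasure P]
    (hA : IsAdmissible ℓ D H f b C L G σ) (hκ : IsRobustnessCoefficient d n f κ) (hT : 1 ≤ T)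
    (hbdd : BddBelow (Set.range (honestLoss ℓ D H))) {L₀ σbar : ℝ}
    (hL₀ : L₀ = honestLoss ℓ D H θ₀ - ⨅ η, honestLoss ℓ D H η)
    (hσbar : σbar = √(totalVariance d n m f b κ σ sCor sInd))
    (hγ : ∀ t, γ t = constantStep L L₀ σbar T) (hβ : ∀ t, β t = 1 - 24 * L * γ t)
    {τ : Ω → ℕ} (hτ : Measurable τ) (hlaw : P.map τ = uniformOn {t : ℕ | t < T})
    (hind : IndepFun τ (fun ω (t : Fin T) => ex.θ t ω) P) :
    Integrable (fun ω => ‖∇ (honestLoss ℓ D H) (ex.θ (τ ω) ω)‖ ^ 2) P ∧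
      ∫ ω, ‖∇ (honestLoss ℓ D H) (ex.θ (τ ω) ω)‖ ^ 2 ∂P ≤
        480 * κ * G ^ 2 + √(5760 * 270 * L * L₀) * σbar / √T + 270 * L * L₀ / T := by
  have hL := hA.pos
  have hσ0 : 0 ≤ σbar := hσbar ▸ Real.sqrt_nonneg _
  have hL₀0 : 0 ≤ L₀ := hL₀ ▸ sub_nonneg.2 (ciInf_le hbdd _)
  have hT0 : (0 : ℝ) < T := by exact_mod_cast hT
  have hV2 : totalVariance d n m f b κ σ sCor sInd = σbar ^ 2 := by
    rw [hσbar, Real.sq_sqrt (hA.totalVariance_nonneg hκ.1 sCor sInd)]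
  set g := constantStep L L₀ σbar T with hg
  have hg0 : 0 ≤ g := constantStep_nonneg hL L₀ hσ0 T
  have hgL : 24 * L * g ≤ 1 := by
    have h1 := constantStep_le L L₀ σbar T
    rw [← hg, le_div_iff₀ (by positivity)] at h1
    linarith
  have hγ0 : ∀ t, 0 ≤ γ t := fun t => by rw [hγ]; exact hg0
  have hγL : ∀ t, 24 * L * γ t ≤ 1 := fun t => by rw [hγ]; exact hgL
  have hη0 : 0 ≤ 24 * L * g := by positivity
  have hβ' : ∀ t, β t ∈ Set.Icc (0 : ℝ) 1 := fun t => by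
    rw [hβ, hγ]
    exact ⟨by linarith, by linarith⟩
  have hν := momentumVariance_le_of_const (β := β) hη0 hgL fun t => by rw [hβ, hγ]
  have hi : ∀ t ≤ T, Integrable (fun ω => ‖∇ (honestLoss ℓ D H) (ex.θ t ω)‖ ^ 2) P := fun t ht =>
    integrable_sq_norm (hA.smooth.memLp_gradient_comp (ex.memLp_θ hA hκ hβ' ht))
  have hκG : 0 ≤ κ * G ^ 2 := mul_nonneg hκ.1 (sq_nonneg G)
  have hstep : ∀ t < T, ex.lyapunov L (t + 1) ≤ ex.lyapunov L t - g / 2 * ex.gradSq t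
      + (3 * g * (κ * G ^ 2) + 90 * L * g ^ 2 * σbar ^ 2) := by
    intro t ht
    have h1 := ex.lyapunov_succ_le hA hκ hbdd hγ0 hγL hβ ht
    rw [hV2, hγ] at h1
    have h2 := mul_nonneg hg0 (ex.gradErrSq_nonneg t)
    -- For constant β, ν ≤ 24 L g, and 3/4 · 24 + 72 = 90.
    have h3 : (3 / 4 * g * momentumVariance β t + 72 * L * g ^ 2) * σbar ^ 2 ≤
        90 * L * g ^ 2 * σbar ^ 2 := by
      refine mul_le_mul_of_nonneg_right ?_ (sq_nonneg _)
      nlinarith [mul_le_mul_of_nonneg_left (hν t) hg0]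
    linarith
  have hsum : ∀ t ≤ T, ex.lyapunov L t + g / 2 * ∑ s ∈ range t, ex.gradSq s ≤ 5 / 4 * L₀
      + t * (3 * g * (κ * G ^ 2) + 90 * L * g ^ 2 * σbar ^ 2) := by
    intro t
    induction t with
    | zero => simpa [hL₀] using ex.lyapunov_zero_le hA hbdd
    | succ t ih =>
      intro ht
      have h1 := ih (by omega)
      have h2 := hstep t ht
      rw [Finset.sum_range_succ]
      push_cast
      linarith
  have hset : {t : ℕ | t < T} = (range T : Set ℕ) := by
    ext
    simp
  rw [hset] at hlaw
  have hmix := integral_uniform_mixture hτ (Finset.nonempty_range_iff.2 (by omega)) hlaw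
    (ψ := fun t ω => ‖∇ (honestLoss ℓ D H) (ex.θ t ω)‖ ^ 2)
    -- Independence of τ from the vector of iterates is used only one iterate at a time.
    (fun t ht => hi t (Finset.mem_range.1 ht).le) fun t ht => by
      have hev : Measurable fun x : Fin T → E d => x ⟨t, Finset.mem_range.1 ht⟩ :=
        measurable_pi_apply _
      exact hind.comp measurable_id
        (((measurable_gradient (honestLoss ℓ D H)).comp hev).norm.pow_const 2)
  refine ⟨hmix.1, ?_⟩
  rw [hmix.2, Finset.card_range]
  change (T : ℝ)⁻¹ * ∑ t ∈ range T, ex.gradSq t ≤ _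
  -- A zero step occurs only for L₀ = 0. Then the Lyapunov function never exceeds 0, so all
  -- gradients vanish almost surely; the other branch divides by g.
  rcases hg0.eq_or_lt with h0 | hpos
  · have hL₀z : L₀ = 0 := eq_zero_of_constantStep_eq_zero hL hT hL₀0 h0.symm
    have h1 : ∀ t ∈ range T, ex.gradSq t ≤ 0 := by
      intro t ht
      have ht' := (Finset.mem_range.1 ht).le
      have h2 := hsum t ht'
      rw [← h0, hL₀z] at h2
      have h3 := ex.excess_le_lyapunov hL t
      have h4 : ex.gradSq t ≤ 2 * L * ex.excess t := by
        rw [excess, gradSq, ← integral_const_mul]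
        exact integral_mono (hi t ht')
          ((ex.integrable_excessLoss hA hκ hβ' hbdd ht').const_mul _)
          fun ω => hA.smooth.sq_norm_gradient_le hL hA.differentiable_loss hbdd _
      have h5 : ex.excess t ≤ 0 := by linarith
      exact h4.trans (mul_nonpos_of_nonneg_of_nonpos (by positivity) h5)
    rw [hL₀z]
    have h2 : (T : ℝ)⁻¹ * ∑ t ∈ range T, ex.gradSq t ≤ 0 :=
      mul_nonpos_of_nonneg_of_nonpos (by positivity) (Finset.sum_nonpos h1)
    simp only [mul_zero, Real.sqrt_zero, zero_mul, zero_div, add_zero]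
    linarith
  · have h1 := hsum T le_rfl
    have h2 := (ex.excess_nonneg hbdd T).trans (ex.excess_le_lyapunov hL T)
    have h3 := constantStep_bound (s := σbar) hL hT hL₀0 hσ0 hpos
    rw [← hg] at h3
    -- The telescoped inequality is divided by g T/2, after dropping the Lyapunov function at T,
    -- which is nonnegative.
    have h4 : (T : ℝ)⁻¹ * ∑ t ∈ range T, ex.gradSq t ≤
        5 / 2 * L₀ / (g * T) + 6 * (κ * G ^ 2) + 180 * L * g * σbar ^ 2 := by
      have h5 : 5 / 2 * L₀ / (g * T) + 6 * (κ * G ^ 2) + 180 * L * g * σbar ^ 2 =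
          (T : ℝ)⁻¹ * (2 / g * (5 / 4 * L₀
            + T * (3 * g * (κ * G ^ 2) + 90 * L * g ^ 2 * σbar ^ 2))) := by
        field_simp
        ring
      rw [h5]
      refine mul_le_mul_of_nonneg_left ?_ (by positivity)
      rw [div_mul_eq_mul_div, le_div_iff₀ hpos]
      linarith
    linarith

end Execution

end CafCor

open CafCor in
theorem mainTheorem1 {X : Type*} {d n m : ℕ} (f b T : ℕ)
    (hf : 2 * f < n) (hb : 1 ≤ b) (hbm : b ≤ m) (hT : 1 ≤ T)
    (H : Finset (Fin n)) (hH : H.card = n - f)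
    (ℓ : E d → X → ℝ) (hℓ : ∀ x, Differentiable ℝ (fun θ => ℓ θ x))
    (D : Fin n → Fin m → X)
    (L G σ sCor sInd : ℝ) (C : ℝ≥0∞) (hL : 0 < L)
    (hG : BoundedHeterogeneity ℓ D H G) (hσ : BoundedVariance ℓ D H σ)
    (hC : BoundedGradients ℓ D H C)
    (hsmooth : IsSmooth L (honestLoss ℓ D H)) (θ₀ : E d)
    {Ω : Type*} [MeasurableSpace Ω] (P : Measure Ω) [IsProbabilityMeasure P] :
    IsRobustnessCoefficient d n f
      (2 * f / ((n : ℝ) - 2 * f) * (1 + 6 * ((n : ℝ) - f) / ((n : ℝ) - 2 * f))) ∧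
    ∀ κ : ℝ, IsRobustnessCoefficient d n f κ →
      -- strongly convex case
      (∀ μ : ℝ, 0 < μ → IsStronglyConvex μ (honestLoss ℓ D H) →
        ∀ γ β : ℕ → ℝ, (∀ t, γ t = 10 / (μ * (t + 240 * (L / μ)))) →
          (∀ t, β t = 1 - 24 * L * γ t) →
        ∀ ex : Execution ℓ D H f b C sCor sInd γ β θ₀ T P,
          Integrable (fun ω => honestLoss ℓ D H (ex.θ T ω) - ⨅ η, honestLoss ℓ D H η) P ∧
          ∫ ω, (honestLoss ℓ D H (ex.θ T ω) - ⨅ η, honestLoss ℓ D H η) ∂P ≤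
            4 * 240 / μ * κ * G ^ 2
              + 2 * 240 ^ 2 * L * totalVariance d n m f b κ σ sCor sInd / (μ ^ 2 * T)
              + 2 * 240 ^ 2 * L ^ 2 * (honestLoss ℓ D H θ₀ - ⨅ η, honestLoss ℓ D H η)
                  / (μ ^ 2 * T ^ 2)) ∧
      -- non-convex case
      (BddBelow (Set.range (honestLoss ℓ D H)) →
        ∀ L₀ σbar : ℝ, L₀ = honestLoss ℓ D H θ₀ - ⨅ η, honestLoss ℓ D H η →
          σbar = √(totalVariance d n m f b κ σ sCor sInd) →
        ∀ γ β : ℕ → ℝ, (∀ t, γ t = constantStep L L₀ σbar T) →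
          (∀ t, β t = 1 - 24 * L * γ t) →
        ∀ ex : Execution ℓ D H f b C sCor sInd γ β θ₀ T P,
        -- the output index is uniform on `{0, …, T - 1}` and independent of the iterates
        ∀ τ : Ω → ℕ, Measurable τ →
          P.map τ = uniformOn {t : ℕ | t < T} →
          IndepFun τ (fun ω (t : Fin T) => ex.θ t ω) P →
          Integrable (fun ω => ‖∇ (honestLoss ℓ D H) (ex.θ (τ ω) ω)‖ ^ 2) P ∧
          ∫ ω, ‖∇ (honestLoss ℓ D H) (ex.θ (τ ω) ω)‖ ^ 2 ∂P ≤
            480 * κ * G ^ 2 + √(5760 * 270 * L * L₀) * σbar / √T + 270 * L * L₀ / T) := by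
  have hA : IsAdmissible ℓ D H f b C L G σ :=
    ⟨hf, hb, hbm, hH, hℓ, hL, hG, hσ, hC, hsmooth⟩
  exact ⟨isRobustnessCoefficient_caf d hf, fun κ hκ =>
    ⟨fun μ hμ hF γ β hγ hβ ex => ex.excess_le_of_isStronglyConvex hA hκ hT hμ hF hγ hβ,
      fun hbdd L₀ σbar hL₀ hσbar γ β hγ hβ ex τ hτ hlaw hind =>
        ex.gradient_le_of_bddBelow hA hκ hT hbdd hL₀ hσbar hγ hβ hτ hlaw hind⟩⟩
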